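/- Let $\mathcal{Y}$ be a finite alphabet. A channel is a pair of probability distributions $W(\cdot|0),W(\cdot|1)$ on $\mathcal{Y}$; it is symmetric if $W(y|1)=W(\pi(y)|0)$ for all $y$, for some permutation $\pi=\pi^{-1}$ of $\mathcal{Y}$ (which may depend on $W$). Put $q_W(y)=\tfrac12(W(y|0)+W(y|1))$, let $I(Q,W)=\sum_{x,y}Q(x)W(y|x)\log_2\frac{W(y|x)}{\sum_{x'}Q(x')W(y|x')}$ be the mutual information for the input distribution $Q$, let $I(W)$ be its value for uniform $Q$, and let $$I(W,V)=\sum_{y}\sum_{x\in\{0,1\}}\tfrac12 W(y|x)\log_2\frac{V(y|x)}{q_V(y)}\in[-\infty,1],$$ where a term with $W(y|x)=0$ is $0$ and a term with $W(y|x)>0=V(y|x)$ is $-\infty$. For $N=2^n$, let $W_N^{(i)}(y_1^N,u_1^{i-1}|u_i)=\sum_{u_{i+1}^N}2^{-(N-1)}\prod_{j}W(y_j|(uG_N)_j)$, $1\le i\le N$, be Arıkan's synthetic channels, $G_N$ being the polar transform. Let $\mathcal{W}$ be a class of symmetric channels with output alphabet $\mathcal{Y}$, and let $V$ minimize $I$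 over the closure $\mathsf{cl}(\mathcal{W})$. Assume that either (a) $\mathcal{W}$ is one-sided, that is, the minimizer $V$ is unique and $I(W,V)\ge I(V)$ for all $W\in\mathcal{W}$; or (b) $\mathcal{W}$ is convex and, for every $W\in\mathcal{W}$, $q_V(y)=0$ implies $q_W(y)=0$. Then the compound capacity of $\mathcal{W}$ is $\max_Q\inf_{W\in\mathcal{W}}I(Q,W)=I(V)$. Moreover, for every $\beta\in(0,\tfrac12)$, with $\epsilon_N=2^{-N^\beta}$ and the information sets $\mathcal{A}_N^{\epsilon_N}(W,V)=\{i: I(W_N^{(i)},V_N^{(i)})\ge 1-\epsilon_N\}$: 1. for every $R<I(V)$ and all sufficiently large $N=2^n$, $|\mathcal{A}_N^{\epsilon_N}(W,V)|\ge NR$ for all $W\in\mathcal{W}$; 2. the block error probability over $W$ of the polar code with information set $\mathcal{A}_N^{\epsilon_N}(W,V)$, decoded by the successive cancellation decoder that uses the decision rule of $V$ (each information bit $u_i$ is decided by maximum likelihood for $V_N^{(i)}$ given the channel output and the previous decisions), for uniform information bits and averaged over uniform frozen bits known to the decoder, tends to $0$ as $N\to\infty$, uniformly over $W\in\mathcal{W}$.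 Thus polar codes with this mismatched successive cancellation decoder achieve the compound capacity of $\mathcal{W}$. -/

import Mathlib

open Filter

noncomputable section

namespace PolarCompound

/-- `W x y` is the transition probability `W(y|x)` of a binary-input discrete memoryless channel
with finite output alphabet `Y`. -/
def IsChannel {Y : Type*} [Fintype Y] (W : ZMod 2 → Y → ℝ) : Prop :=
  (∀ x y, 0 ≤ W x y) ∧ ∀ x, ∑ y, W x y = 1

/-- Symmetric channel: some involutive permutation of the output alphabet exchanges the two
transition laws. The permutation may depend on the channel. -/
def IsSymmetric {Y : Type*} (W : ZMod 2 → Y → ℝ) : Prop :=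
  ∃ π : Equiv.Perm Y, (∀ y, π (π y) = y) ∧ ∀ y, W 1 y = W 0 (π y)

/-- `Q` is a probability distribution on the inputs. -/
def IsInputDist (Q : ZMod 2 → ℝ) : Prop := (∀ x, 0 ≤ Q x) ∧ ∑ x, Q x = 1

/-- The mutual information `I(Q, W)` in bits. A summand with `W x y = 0` or with a vanishing
denominator is zero, since its prefactor `Q x * W x y` is zero. -/
def mutualInfo {Y : Type*} [Fintype Y] (Q : ZMod 2 → ℝ) (W : ZMod 2 → Y → ℝ) : ℝ :=
  ∑ y, ∑ x, Q x * W x y * Real.logb 2 (W x y / ∑ x', Q x' * W x' y)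

/-- The symmetric capacity `I(W)`: the mutual information for uniform input. -/
def symCapacity {Y : Type*} [Fintype Y] (W : ZMod 2 → Y → ℝ) : ℝ :=
  mutualInfo (fun _ => 1 / 2) W

/-- The output distribution `q_W` for uniform input. -/
def outputDist {Y : Type*} (W : ZMod 2 → Y → ℝ) (y : Y) : ℝ := (W 0 y + W 1 y) / 2

/-- The mismatched information `I(W, V) = ∑ ½ W(y|x) log₂ (V(y|x) / q_V(y))`, with values in
`[-∞, 1]`: a summand with `W(y|x) = 0` is `0`, and one with `W(y|x) > 0 = V(y|x)` is `-∞`. -/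
def mismatchedInfo {Y : Type*} [Fintype Y] (W V : ZMod 2 → Y → ℝ) : EReal :=
  open scoped Classical in
  ∑ y, ∑ x, if W x y = 0 then (0 : EReal)
    else if V x y = 0 then ⊥
    else ((1 / 2 * W x y * Real.logb 2 (V x y / outputDist V y) : ℝ) : EReal)

/-- `V` minimizes the symmetric capacity over the closure of the class `𝒲`. -/
def IsClosureMinimizer {Y : Type*} [Fintype Y] (𝒲 : Set (ZMod 2 → Y → ℝ))
    (V : ZMod 2 → Y → ℝ) : Prop :=
  V ∈ closure 𝒲 ∧ ∀ W ∈ closure 𝒲, symCapacity V ≤ symCapacity W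

/-- `𝒲` is one-sided with respect to the uniform input distribution, and `V` is the unique
minimizer of `I` over its closure. -/
def IsOneSided {Y : Type*} [Fintype Y] (𝒲 : Set (ZMod 2 → Y → ℝ))
    (V : ZMod 2 → Y → ℝ) : Prop :=
  IsClosureMinimizer 𝒲 V ∧ (∀ V', IsClosureMinimizer 𝒲 V' → V' = V) ∧
    ∀ W ∈ 𝒲, (symCapacity V : EReal) ≤ mismatchedInfo W V

/-- The polar transform `u ↦ u G_N`, `N = 2 ^ n`, through its recursion: the first half of the
codeword encodes `u_odd ⊕ u_even` and the second half encodes `u_even`. (The positions called odd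
when counted from one are the `2 * k` when counted from zero.) -/
def polarEncode : (n : ℕ) → (Fin (2 ^ n) → ZMod 2) → Fin (2 ^ n) → ZMod 2
  | 0, u => u
  | n + 1, u => fun j =>
    if h : j.1 < 2 ^ n then
      polarEncode n
        (fun k => u ⟨2 * k.1, by have := k.2; have := pow_succ 2 n; omega⟩ +
          u ⟨2 * k.1 + 1, by have := k.2; have := pow_succ 2 n; omega⟩) ⟨j.1, h⟩
    else
      polarEncode n (fun k => u ⟨2 * k.1 + 1, by have := k.2; have := pow_succ 2 n; omega⟩)
        ⟨j.1 - 2 ^ n, by have := j.2; have := pow_succ 2 n; omega⟩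

/-- `W_N(y | u) = ∏ W(y_j | x_j)` with `x = u G_N`: `N` independent uses of `W`. -/
def blockLaw {Y : Type*} (W : ZMod 2 → Y → ℝ) (n : ℕ) (u : Fin (2 ^ n) → ZMod 2)
    (y : Fin (2 ^ n) → Y) : ℝ :=
  ∏ j, W (polarEncode n u j) (y j)

/-- The synthetic channel `W_N^{(i)}(y, u_1 … u_{i-1} | u_i)`, with `i` counted from zero. -/
def synthChannel {Y : Type*} (W : ZMod 2 → Y → ℝ) (n : ℕ) (i : Fin (2 ^ n)) :
    ZMod 2 → (Fin (2 ^ n) → Y) × (Fin i.1 → ZMod 2) → ℝ := fun x z =>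
  open scoped Classical in
  ∑ u : Fin (2 ^ n) → ZMod 2,
    if u i = x ∧ ∀ j : Fin i.1, u ⟨j.1, j.2.trans i.2⟩ = z.2 j then
      blockLaw W n u z.1 / 2 ^ (2 ^ n - 1)
    else 0

/-- The information set `{i : I(W_N^{(i)}, V_N^{(i)}) ≥ 1 - ε}`. -/
def infoSet {Y : Type*} [Fintype Y] (W V : ZMod 2 → Y → ℝ) (n : ℕ) (ε : ℝ) :
    Finset (Fin (2 ^ n)) :=
  open scoped Classical in
  Finset.univ.filter fun i =>
    ((1 - ε : ℝ) : EReal) ≤ mismatchedInfo (synthChannel W n i) (synthChannel V n i)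

/-- The successive cancellation decoder operating with the channel `V`: the bits outside the
information set `A` are the frozen bits, taken from `f`; a bit in `A` is decided by maximum
likelihood for `V_N^{(i)}` given the output `y` and the earlier decisions (ties go to `0`). -/
def scDecode {Y : Type*} (V : ZMod 2 → Y → ℝ) (n : ℕ) (A : Finset (Fin (2 ^ n)))
    (f : Fin (2 ^ n) → ZMod 2) (y : Fin (2 ^ n) → Y) (i : Fin (2 ^ n)) : ZMod 2 :=
  open scoped Classical in
  if i ∈ A then
    if synthChannel V n i 1 (y, fun j : Fin i.1 => scDecode V n A f y ⟨j.1, j.2.trans i.2⟩) ≤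
        synthChannel V n i 0 (y, fun j : Fin i.1 => scDecode V n A f y ⟨j.1, j.2.trans i.2⟩)
    then 0 else 1
  else f i
termination_by i.1
decreasing_by all_goals exact j.2

/-- Block error probability over `W` of the polar code with information set `A` and frozen bits
`f` (only the values of `f` outside `A` matter), for uniform information bits, when it is decoded
by the successive cancellation decoder for `V`. -/
def codeErrorProb {Y : Type*} [Fintype Y] (W V : ZMod 2 → Y → ℝ) (n : ℕ)
    (A : Finset (Fin (2 ^ n))) (f : Fin (2 ^ n) → ZMod 2) : ℝ :=
  open scoped Classical in
  (∑ u : Fin (2 ^ n) → ZMod 2, if ∀ i, i ∉ A → u i = f i then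
    ∑ y : Fin (2 ^ n) → Y, if scDecode V n A f y = u then 0 else blockLaw W n u y
    else 0) / 2 ^ A.card

/-- The block error probability averaged over a uniform choice of the frozen bits, that is, for a
uniform channel input. -/
def scErrorProb {Y : Type*} [Fintype Y] (W V : ZMod 2 → Y → ℝ) (n : ℕ)
    (A : Finset (Fin (2 ^ n))) : ℝ :=
  (∑ f : Fin (2 ^ n) → ZMod 2, codeErrorProb W V n A f) / 2 ^ 2 ^ n

end PolarCompound

end

open Filter

noncomputable section

namespace PolarCompound

universe u

/-! Let `L = V(x+1|y) / V(x|y)` be the likelihood ratio computed by the mismatched decoder while the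
data come from `W` with uniform input. If `W` is dominated by `V`, then `I(W,V) = 1 - E log₂ (1 +
L)`. A polarization step turns two independent copies of `L` into `checkOp a b` or `a * b`, and it
conserves the mean of this information (`info_minus_add_plus`), so everything reduces to the law of
`L`. The obstacle is that the law of `L` under `W` need not satisfy the consistency relation of the
matched case: the information martingale is not bounded below, and no single moment of `L` is
controlled uniformly.

The core is `info_le_goodLimit`: asymptotically, a proportion at least `I(W,V)` of the synthetic
laws has a small moment `E L^s` for some `s ≤ 1`. Its engine is `exists_superharmonic_bound`:
information at least `γ > 0` implies a definite chance of meeting a law with some moment at most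
`31/32`. Either the mean soft bit is far from one, and then the all-minus descendant has little
information, so conservation gives another descendant more information, which can happen only
boundedly often; or the soft bit is nearly one, and a potential with a shrinking moment order
reaches a half-good law. Plus steps square moments, so such a law soon has a tiny one, from which
most descendants stay good (`exists_smallMoment_stable`) and polarize at the rate `2^(-N^β)`
(`exists_fast`). Iterating the chance against the harmonic information gives the full proportion.

Uniformity over the class follows from compactness: with `V` fixed, each moment of a node at a fixed
level is a polynomial in `W`, so a finite-level certificate persists in a neighbourhood, and
`exists_fast` is uniform over laws meeting a moment threshold. The error bound is a union bound: a
wrong genie-aided decision needs `L ≥ 1`, where `log₂ (1 + L) ≥ 1`.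

Each hypothesis (a), (b) gives domination and `I(V) ≤ I(W,V)`; in the convex case this is a
first-order optimality argument on the segment from `V` to `W` (`mem_dominatedClass_of_convex`). The
capacity formula uses only symmetry, which makes the uniform input optimal for `V`, and continuity
of mutual information. -/

/-- A finitely supported probability law of a likelihood ratio. -/
structure RatioLaw : Type (u + 1) where
  ι : Type u
  [fin : Fintype ι]
  w : ι → ℝ
  L : ι → ℝ
  w_nonneg : ∀ i, 0 ≤ w i
  w_sum : ∑ i, w i = 1
  L_nonneg : ∀ i, 0 ≤ L i

/-! ### Functionals of a likelihood-ratio law and their one-step inequalities -/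

namespace RatioLaw

attribute [instance] RatioLaw.fin

/-- Expectation of a function of the likelihood ratio. -/
def E (σ : RatioLaw.{u}) (φ : ℝ → ℝ) : ℝ := ∑ i, σ.w i * φ (σ.L i)

lemma E_mono (σ : RatioLaw.{u}) {φ ψ : ℝ → ℝ} (h : ∀ a, 0 ≤ a → φ a ≤ ψ a) :
    σ.E φ ≤ σ.E ψ :=
  Finset.sum_le_sum fun i _ => mul_le_mul_of_nonneg_left (h _ (σ.L_nonneg i)) (σ.w_nonneg i)

lemma E_congr (σ : RatioLaw.{u}) {φ ψ : ℝ → ℝ} (h : ∀ a, 0 ≤ a → φ a = ψ a) :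
    σ.E φ = σ.E ψ :=
  Finset.sum_congr rfl fun i _ => by rw [h _ (σ.L_nonneg i)]

lemma E_add (σ : RatioLaw.{u}) (φ ψ : ℝ → ℝ) :
    σ.E (fun a => φ a + ψ a) = σ.E φ + σ.E ψ := by
  simp [E, mul_add, Finset.sum_add_distrib]

lemma E_sub (σ : RatioLaw.{u}) (φ ψ : ℝ → ℝ) :
    σ.E (fun a => φ a - ψ a) = σ.E φ - σ.E ψ := by
  simp [E, mul_sub, Finset.sum_sub_distrib]

lemma E_const_mul (σ : RatioLaw.{u}) (k : ℝ) (φ : ℝ → ℝ) :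
    σ.E (fun a => k * φ a) = k * σ.E φ := by
  simp only [E, Finset.mul_sum]
  exact Finset.sum_congr rfl fun i _ => by ring

lemma E_mul_const (σ : RatioLaw.{u}) (k : ℝ) (φ : ℝ → ℝ) :
    σ.E (fun a => φ a * k) = σ.E φ * k := by
  simp only [E, Finset.sum_mul]
  exact Finset.sum_congr rfl fun i _ => by ring

lemma E_const (σ : RatioLaw.{u}) (k : ℝ) : σ.E (fun _ => k) = k := by
  simp [E, ← Finset.sum_mul, σ.w_sum]

lemma E_nonneg (σ : RatioLaw.{u}) {φ : ℝ → ℝ} (h : ∀ a, 0 ≤ a → 0 ≤ φ a) : 0 ≤ σ.E φ := by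
  simpa [E_const] using σ.E_mono (φ := fun _ => 0) h

/-- Jensen's inequality for powers with exponent at most one. -/
lemma E_rpow_le (σ : RatioLaw.{u}) {φ : ℝ → ℝ} (h : ∀ a, 0 ≤ a → 0 ≤ φ a) {p : ℝ}
    (hp0 : 0 ≤ p) (hp1 : p ≤ 1) : σ.E (fun a => φ a ^ p) ≤ (σ.E φ) ^ p := by
  have := (Real.concaveOn_rpow hp0 hp1).le_map_sum (t := Finset.univ) (w := σ.w)
    (p := fun i => φ (σ.L i)) (fun i _ => σ.w_nonneg i) σ.w_sum
    (fun i _ => h _ (σ.L_nonneg i))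
  simpa [E] using this

/-- The check-node combination of likelihood ratios. -/
def checkOp (a b : ℝ) : ℝ := (a + b) / (1 + a * b)

lemma checkOp_nonneg {a b : ℝ} (ha : 0 ≤ a) (hb : 0 ≤ b) : 0 ≤ checkOp a b := by
  unfold checkOp; positivity

/-- The law of an operation applied to two independent copies. -/
def comb (op : ℝ → ℝ → ℝ) (hop : ∀ a b, 0 ≤ a → 0 ≤ b → 0 ≤ op a b)
    (σ : RatioLaw.{u}) : RatioLaw.{u} where
  ι := σ.ι × σ.ι
  w := fun i => σ.w i.1 * σ.w i.2
  L := fun i => op (σ.L i.1) (σ.L i.2)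
  w_nonneg := fun i => mul_nonneg (σ.w_nonneg _) (σ.w_nonneg _)
  w_sum := by
    rw [Fintype.sum_prod_type]
    simp [← Finset.mul_sum, σ.w_sum]
  L_nonneg := fun i => hop _ _ (σ.L_nonneg _) (σ.L_nonneg _)

lemma E_comb (op : ℝ → ℝ → ℝ) (hop) (σ : RatioLaw.{u}) (φ : ℝ → ℝ) :
    (comb op hop σ).E φ = σ.E fun a => σ.E fun b => φ (op a b) := by
  have h : (comb op hop σ).E φ =
      ∑ i : σ.ι × σ.ι, σ.w i.1 * σ.w i.2 * φ (op (σ.L i.1) (σ.L i.2)) := rfl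
  rw [h, Fintype.sum_prod_type]
  simp only [E]
  refine Finset.sum_congr rfl fun i _ => ?_
  rw [Finset.mul_sum]
  exact Finset.sum_congr rfl fun j _ => by ring

/-- The law of the likelihood ratio of the worse synthetic channel. -/
def minus (σ : RatioLaw.{u}) : RatioLaw.{u} := comb checkOp (fun _ _ => checkOp_nonneg) σ

/-- The law of the likelihood ratio of the better synthetic channel. -/
def plus (σ : RatioLaw.{u}) : RatioLaw.{u} := comb (· * ·) (fun _ _ => mul_nonneg) σ

lemma E_minus (σ : RatioLaw.{u}) (φ : ℝ → ℝ) :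
    σ.minus.E φ = σ.E fun a => σ.E fun b => φ (checkOp a b) := E_comb _ _ σ φ

lemma E_plus (σ : RatioLaw.{u}) (φ : ℝ → ℝ) :
    σ.plus.E φ = σ.E fun a => σ.E fun b => φ (a * b) := E_comb _ _ σ φ

lemma E_E_mono (σ : RatioLaw.{u}) {F G : ℝ → ℝ → ℝ}
    (h : ∀ a b, 0 ≤ a → 0 ≤ b → F a b ≤ G a b) :
    (σ.E fun a => σ.E fun b => F a b) ≤ σ.E fun a => σ.E fun b => G a b :=
  σ.E_mono fun a ha => σ.E_mono fun b hb => h a b ha hb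

lemma E_E_congr (σ : RatioLaw.{u}) {F G : ℝ → ℝ → ℝ}
    (h : ∀ a b, 0 ≤ a → 0 ≤ b → F a b = G a b) :
    (σ.E fun a => σ.E fun b => F a b) = σ.E fun a => σ.E fun b => G a b :=
  σ.E_congr fun a ha => σ.E_congr fun b hb => h a b ha hb

/-- The `s`-th moment of the likelihood ratio. -/
def moment (s : ℝ) (σ : RatioLaw.{u}) : ℝ := σ.E fun a => a ^ s

/-- The `s`-th moment, truncated at ratio one. -/
def lowMoment (s : ℝ) (σ : RatioLaw.{u}) : ℝ := σ.E fun a => min 1 (a ^ s)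

/-- The excess of the `s`-th moment over its truncation. -/
def excess (s : ℝ) (σ : RatioLaw.{u}) : ℝ := σ.E fun a => max (a ^ s - 1) 0

/-- The mean log-loss `E log₂ (1 + L)`. -/
def logLoss (σ : RatioLaw.{u}) : ℝ := σ.E fun a => Real.logb 2 (1 + a)

/-- The information `1 - E log₂ (1 + L)`. -/
def info (σ : RatioLaw.{u}) : ℝ := 1 - σ.logLoss

/-- The mean soft bit. -/
def softBit (σ : RatioLaw.{u}) : ℝ := σ.E fun a => (1 - a) / (1 + a)

lemma logb_one_add_nonneg {a : ℝ} (ha : 0 ≤ a) : 0 ≤ Real.logb 2 (1 + a) :=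
  Real.logb_nonneg (by norm_num) (by linarith)

lemma logLoss_nonneg (σ : RatioLaw.{u}) : 0 ≤ σ.logLoss :=
  σ.E_nonneg fun _ ha => logb_one_add_nonneg ha

lemma info_le_one (σ : RatioLaw.{u}) : σ.info ≤ 1 := by
  have := σ.logLoss_nonneg; unfold info; linarith

lemma moment_nonneg (s : ℝ) (σ : RatioLaw.{u}) : 0 ≤ σ.moment s :=
  σ.E_nonneg fun _ ha => Real.rpow_nonneg ha s

lemma lowMoment_nonneg (s : ℝ) (σ : RatioLaw.{u}) : 0 ≤ σ.lowMoment s :=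
  σ.E_nonneg fun _ ha => le_min zero_le_one (Real.rpow_nonneg ha s)

lemma excess_nonneg (s : ℝ) (σ : RatioLaw.{u}) : 0 ≤ σ.excess s :=
  σ.E_nonneg fun _ _ => le_max_right _ _

lemma moment_eq (s : ℝ) (σ : RatioLaw.{u}) : σ.moment s = σ.lowMoment s + σ.excess s := by
  rw [moment, lowMoment, excess, ← E_add]
  refine σ.E_congr fun a _ => ?_
  rcases le_total (a ^ s) 1 with h | h
  · rw [min_eq_right h, max_eq_right (by linarith)]; ring
  · rw [min_eq_left h, max_eq_left (by linarith)]; ring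

/-- The conservation law is pointwise: `(1 + checkOp a b) * (1 + a * b) = (1 + a) * (1 + b)`. -/
lemma logLoss_minus_add_plus (σ : RatioLaw.{u}) :
    σ.minus.logLoss + σ.plus.logLoss = 2 * σ.logLoss := by
  have h : ∀ a b : ℝ, 0 ≤ a → 0 ≤ b →
      Real.logb 2 (1 + checkOp a b) + Real.logb 2 (1 + a * b) =
        Real.logb 2 (1 + a) + Real.logb 2 (1 + b) := by
    intro a b ha hb
    have h1 : 0 < 1 + a * b := by positivity
    have h2 : 0 ≤ checkOp a b := checkOp_nonneg ha hb
    rw [← Real.logb_mul (by positivity) (by positivity),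
      ← Real.logb_mul (by positivity) (by positivity)]
    congr 1
    unfold checkOp
    field_simp
    ring
  simp only [logLoss]
  rw [E_minus, E_plus, ← E_add]
  have : ∀ a, 0 ≤ a → (σ.E fun b => Real.logb 2 (1 + checkOp a b)) +
      (σ.E fun b => Real.logb 2 (1 + a * b)) =
      Real.logb 2 (1 + a) + σ.E fun b => Real.logb 2 (1 + b) := by
    intro a ha
    rw [← E_add, σ.E_congr (fun b hb => h a b ha hb), E_add, E_const]
  rw [σ.E_congr this, E_add, E_const]
  ring

lemma info_minus_add_plus (σ : RatioLaw.{u}) : σ.minus.info + σ.plus.info = 2 * σ.info := by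
  have := σ.logLoss_minus_add_plus; unfold info; linarith

/-- The soft bit `(1 - a) / (1 + a)` is the hyperbolic tangent of `-log a / 2`, which the check-node
rule multiplies. -/
lemma softBit_minus (σ : RatioLaw.{u}) : σ.minus.softBit = σ.softBit ^ 2 := by
  have h : ∀ a b : ℝ, 0 ≤ a → 0 ≤ b → (1 - checkOp a b) / (1 + checkOp a b) =
      (1 - a) / (1 + a) * ((1 - b) / (1 + b)) := by
    intro a b ha hb
    have h1 : 0 < 1 + a * b := by positivity
    have h2 : 0 < 1 + checkOp a b := by have := checkOp_nonneg ha hb; linarith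
    have h3 : 1 + checkOp a b = (1 + a) * (1 + b) / (1 + a * b) := by
      unfold checkOp; field_simp; ring
    have h4 : 1 - checkOp a b = (1 - a) * (1 - b) / (1 + a * b) := by
      unfold checkOp; field_simp; ring
    rw [h3, h4]
    have : 0 < 1 + a := by linarith
    have : 0 < 1 + b := by linarith
    field_simp
  rw [softBit, E_minus, E_E_congr σ h]
  simp only [E_const_mul, E_mul_const]
  rw [softBit]; ring

lemma softBit_le_one (σ : RatioLaw.{u}) : σ.softBit ≤ 1 := by
  have := σ.E_mono (φ := fun a => (1 - a) / (1 + a)) (ψ := fun _ => 1) fun a ha => by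
    rw [div_le_one (by linarith)]; linarith
  simpa [E_const, softBit] using this

/-- This is `log x ≤ x - 1` at `x = 2 / (1 + a)`. Minus steps that shrink the soft bit therefore
also cap the information. -/
lemma info_le_softBit (σ : RatioLaw.{u}) : σ.info ≤ σ.softBit / Real.log 2 := by
  have h2 : (0 : ℝ) < Real.log 2 := Real.log_pos (by norm_num)
  have : σ.info = σ.E fun a => 1 - Real.logb 2 (1 + a) := by
    rw [E_sub, E_const]; rfl
  rw [this, div_eq_mul_inv, softBit, ← E_mul_const]
  refine σ.E_mono fun a ha => ?_
  have h1 : 0 < 1 + a := by linarith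
  have h3 : 1 - Real.logb 2 (1 + a) = Real.log (2 / (1 + a)) * (Real.log 2)⁻¹ := by
    rw [Real.log_div (by norm_num) h1.ne', Real.logb]; field_simp
  rw [h3]
  refine mul_le_mul_of_nonneg_right ?_ (inv_nonneg.2 h2.le)
  have := Real.log_le_sub_one_of_pos (x := 2 / (1 + a)) (by positivity)
  refine this.trans (le_of_eq ?_)
  field_simp; ring

lemma moment_plus (s : ℝ) (σ : RatioLaw.{u}) : σ.plus.moment s = σ.moment s ^ 2 := by
  rw [moment, E_plus, E_E_congr σ fun a b ha hb => Real.mul_rpow ha hb]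
  simp only [E_const_mul, E_mul_const]
  rw [moment]; ring

lemma checkOp_rpow_le {s a b : ℝ} (hs0 : 0 < s) (hs1 : s ≤ 1) (ha : 0 ≤ a) (hb : 0 ≤ b) :
    checkOp a b ^ s ≤ a ^ s + b ^ s := by
  refine le_trans (Real.rpow_le_rpow (checkOp_nonneg ha hb) ?_ hs0.le)
    (Real.rpow_add_le_add_rpow ha hb hs0.le hs1)
  unfold checkOp
  rw [div_le_iff₀ (by positivity)]
  nlinarith [mul_nonneg ha hb, mul_nonneg (add_nonneg ha hb) (mul_nonneg ha hb)]

lemma moment_minus_le {s : ℝ} (hs0 : 0 < s) (hs1 : s ≤ 1) (σ : RatioLaw.{u}) :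
    σ.minus.moment s ≤ 2 * σ.moment s := by
  rw [moment, E_minus]
  refine (E_E_mono σ fun a b ha hb => checkOp_rpow_le hs0 hs1 ha hb).trans (le_of_eq ?_)
  simp only [E_add, E_const]
  rw [moment]; ring

/-- Since `s * log (1 + a) = log ((1 + a) ^ s) ≤ (1 + a) ^ s - 1 ≤ a ^ s`, the last step by
subadditivity of the power. -/
lemma logLoss_le_moment {s : ℝ} (hs0 : 0 < s) (hs1 : s ≤ 1) (σ : RatioLaw.{u}) :
    σ.logLoss ≤ σ.moment s / (s * Real.log 2) := by
  have h2 : (0 : ℝ) < Real.log 2 := Real.log_pos (by norm_num)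
  rw [div_eq_mul_inv, moment, ← E_mul_const]
  refine σ.E_mono fun a ha => ?_
  rw [← div_eq_mul_inv, le_div_iff₀ (by positivity), Real.logb]
  have h1 : Real.log (1 + a) * s ≤ a ^ s := by
    have h3 : (1 + a) ^ s ≤ 1 + a ^ s := by
      simpa using Real.rpow_add_le_add_rpow zero_le_one ha hs0.le hs1
    have h4 : Real.log ((1 + a) ^ s) ≤ (1 + a) ^ s - 1 :=
      Real.log_le_sub_one_of_pos (by positivity)
    rw [Real.log_rpow (by linarith)] at h4
    linarith
  calc Real.log (1 + a) / Real.log 2 * (s * Real.log 2) = Real.log (1 + a) * s := by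
        field_simp
    _ ≤ a ^ s := h1

lemma lowMoment_minus_le {s : ℝ} (hs0 : 0 < s) (hs1 : s ≤ 1) (σ : RatioLaw.{u}) :
    σ.minus.lowMoment s ≤ 2 * σ.lowMoment s := by
  have h : ∀ a b : ℝ, 0 ≤ a → 0 ≤ b →
      min 1 (checkOp a b ^ s) ≤ min 1 (a ^ s) + min 1 (b ^ s) := by
    intro a b ha hb
    have := checkOp_rpow_le hs0 hs1 ha hb
    have h1 : 0 ≤ a ^ s := Real.rpow_nonneg ha s
    have h2 : 0 ≤ b ^ s := Real.rpow_nonneg hb s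
    rcases min_cases 1 (checkOp a b ^ s) with h | h <;> rcases min_cases 1 (a ^ s) with h' | h' <;>
      rcases min_cases 1 (b ^ s) with h'' | h'' <;> linarith
  rw [lowMoment, E_minus]
  refine (E_E_mono σ h).trans (le_of_eq ?_)
  simp only [E_add, E_const]
  rw [lowMoment]; ring

/-- The truncated excess is controlled by the log-loss. -/
lemma min_excess_le {s a : ℝ} (hs0 : 0 < s) (ha : 0 ≤ a) :
    min 1 (max (a ^ s - 1) 0) ≤ s * Real.logb 2 (1 + a) := by
  have h2 : (0 : ℝ) < Real.log 2 := Real.log_pos (by norm_num)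
  have hl := logb_one_add_nonneg ha
  rcases le_total a 1 with h | h
  · have : a ^ s ≤ 1 := Real.rpow_le_one ha h hs0.le
    rw [max_eq_right (by linarith), min_eq_right zero_le_one]
    positivity
  · have ha0 : 0 < a := by linarith
    have h1 : 1 ≤ a ^ s := Real.one_le_rpow h hs0.le
    have hle : s * Real.logb 2 a ≤ s * Real.logb 2 (1 + a) :=
      mul_le_mul_of_nonneg_left (Real.logb_le_logb_of_le (by norm_num) ha0 (by linarith)) hs0.le
    refine le_trans ?_ hle
    rw [max_eq_left (by linarith), ← Real.logb_rpow_eq_mul_logb_of_pos ha0]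
    set x := a ^ s with hx
    rcases le_total x 2 with hx2 | hx2
    · refine (min_le_right _ _).trans ?_
      -- The chord of the logarithm between `1` and `2` lies below its graph, that is, `x - 1 ≤ log₂
      -- x` there.
      have := strictConcaveOn_log_Ioi.concaveOn.2 (Set.mem_Ioi.2 one_pos) (Set.mem_Ioi.2 two_pos)
        (by linarith : 0 ≤ 2 - x) (by linarith : 0 ≤ x - 1) (by ring)
      simp only [smul_eq_mul, Real.log_one, mul_zero, zero_add, mul_one] at this
      rw [Real.logb, le_div_iff₀ h2]
      convert this using 2
      ring
    · refine (min_le_left _ _).trans ?_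
      rw [Real.le_logb_iff_rpow_le (by norm_num) (by linarith)]
      simpa using hx2

lemma E_min_excess_le {s : ℝ} (hs0 : 0 < s) (σ : RatioLaw.{u}) :
    (σ.E fun a => min 1 (max (a ^ s - 1) 0)) ≤ s * σ.logLoss := by
  rw [logLoss, ← E_const_mul]
  exact σ.E_mono fun a ha => min_excess_le hs0 ha

/-- Truncation is not multiplicative when exactly one factor exceeds one. The defect is at most the
excess truncated at one, whose mean is at most `s` times the log-loss, so no bound on an untruncated
moment is needed. -/
lemma lowMoment_plus_le {s : ℝ} (hs0 : 0 < s) (σ : RatioLaw.{u}) :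
    σ.plus.lowMoment s ≤ σ.lowMoment s ^ 2 + 2 * s * σ.logLoss := by
  have key : ∀ x y : ℝ, 0 ≤ x → 0 ≤ y → min 1 (x * y) ≤
      min 1 x * min 1 y + (min 1 (max (x - 1) 0) + min 1 (max (y - 1) 0)) := by
    intro x y hx hy
    have hx' : 0 ≤ min 1 (max (x - 1) 0) := le_min zero_le_one (le_max_right _ _)
    have hy' : 0 ≤ min 1 (max (y - 1) 0) := le_min zero_le_one (le_max_right _ _)
    rcases le_total x 1 with h | h <;> rcases le_total y 1 with h' | h'
    · rw [min_eq_right h, min_eq_right h']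
      exact (min_le_right _ _).trans (by linarith)
    · rw [min_eq_right h, min_eq_left h', max_eq_left (a := y - 1) (by linarith)]
      rcases min_cases 1 (y - 1) with h3 | h3
      · rw [h3.1]; exact (min_le_left _ _).trans (by linarith)
      · rw [h3.1]; exact (min_le_right _ _).trans (by nlinarith)
    · rw [min_eq_right h', min_eq_left h, max_eq_left (a := x - 1) (by linarith)]
      rcases min_cases 1 (x - 1) with h3 | h3
      · rw [h3.1]; exact (min_le_left _ _).trans (by linarith)
      · rw [h3.1]; exact (min_le_right _ _).trans (by nlinarith)
    · rw [min_eq_left h, min_eq_left h']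
      exact (min_le_left _ _).trans (by linarith)
  have h : ∀ a b : ℝ, 0 ≤ a → 0 ≤ b → min 1 ((a * b) ^ s) ≤
      min 1 (a ^ s) * min 1 (b ^ s) +
        (min 1 (max (a ^ s - 1) 0) + min 1 (max (b ^ s - 1) 0)) := by
    intro a b ha hb
    rw [Real.mul_rpow ha hb]
    exact key _ _ (Real.rpow_nonneg ha s) (Real.rpow_nonneg hb s)
  rw [lowMoment, E_plus]
  refine (E_E_mono σ h).trans ?_
  simp only [E_add, E_const, E_const_mul, E_mul_const]
  have := E_min_excess_le hs0 σ
  rw [lowMoment]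
  nlinarith

lemma excess_plus_le (s : ℝ) (σ : RatioLaw.{u}) :
    σ.plus.excess s ≤ 2 * σ.excess s + σ.excess s ^ 2 := by
  have h : ∀ a b : ℝ, 0 ≤ a → 0 ≤ b → max ((a * b) ^ s - 1) 0 ≤
      max (a ^ s - 1) 0 + max (b ^ s - 1) 0 + max (a ^ s - 1) 0 * max (b ^ s - 1) 0 := by
    intro a b ha hb
    rw [Real.mul_rpow ha hb]
    have h1 : 0 ≤ a ^ s := Real.rpow_nonneg ha s
    have h2 : 0 ≤ b ^ s := Real.rpow_nonneg hb s
    have h3 := le_max_right (a ^ s - 1) 0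
    have h4 := le_max_right (b ^ s - 1) 0
    have h5 := le_max_left (a ^ s - 1) 0
    have h6 := le_max_left (b ^ s - 1) 0
    refine max_le ?_ (by positivity)
    nlinarith [mul_le_mul (by linarith : a ^ s ≤ 1 + max (a ^ s - 1) 0)
      (by linarith : b ^ s ≤ 1 + max (b ^ s - 1) 0) h2 (by linarith)]
  rw [excess, E_plus]
  refine (E_E_mono σ h).trans (le_of_eq ?_)
  simp only [E_add, E_const, E_const_mul, E_mul_const]
  rw [excess]; ring

lemma checkOp_comm (a b : ℝ) : checkOp a b = checkOp b a := by
  unfold checkOp; rw [add_comm a b, mul_comm a b]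

/-- A check node exceeds one only if `b < 1 < a` up to order, and then it is at most both `a` and `1
/ b`. If `b ^ s ≤ 1/2`, the excess of `a` is charged to `2 * (1 - b ^ s) ≥ 1`; otherwise the new
excess is at most one, hence a truncated excess. So the excess contracts when the low moment is
close to one. -/
lemma excess_minus_le {s : ℝ} (hs0 : 0 < s) (σ : RatioLaw.{u}) :
    σ.minus.excess s ≤ 4 * (1 - σ.lowMoment s) * σ.excess s + 2 * s * σ.logLoss := by
  have key : ∀ a b : ℝ, 0 ≤ a → 0 ≤ b → b ≤ a → max (checkOp a b ^ s - 1) 0 ≤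
      2 * (1 - min 1 (b ^ s)) * max (a ^ s - 1) 0 + min 1 (max (a ^ s - 1) 0) := by
    intro a b ha hb hba
    have hn : 0 ≤ 1 - min 1 (b ^ s) := by linarith [min_le_left 1 (b ^ s)]
    have hp := le_max_right (a ^ s - 1) 0
    have hq : 0 ≤ min 1 (max (a ^ s - 1) 0) := le_min zero_le_one hp
    have hpos : 0 < 1 + a * b := by positivity
    refine max_le ?_ (by positivity)
    by_cases h1 : checkOp a b ≤ 1
    · have := Real.rpow_le_one (checkOp_nonneg ha hb) h1 hs0.le
      nlinarith [mul_nonneg hn hp]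
    · push Not at h1
      have h2 : 1 + a * b < a + b := by
        rwa [checkOp, one_lt_div hpos] at h1
      have hb1 : b < 1 := by nlinarith
      have ha1 : 1 < a := by nlinarith
      have hx1 : 1 ≤ a ^ s := Real.one_le_rpow ha1.le hs0.le
      have hy1 : b ^ s ≤ 1 := Real.rpow_le_one hb hb1.le hs0.le
      have hy0 : 0 ≤ b ^ s := Real.rpow_nonneg hb s
      have h3 : checkOp a b ^ s ≤ a ^ s := by
        refine Real.rpow_le_rpow (checkOp_nonneg ha hb) ?_ hs0.le
        rw [checkOp, div_le_iff₀ hpos]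
        nlinarith [mul_nonneg hb (by nlinarith : 0 ≤ a * a - 1)]
      have h4 : checkOp a b ^ s * b ^ s ≤ 1 := by
        rw [← Real.mul_rpow (checkOp_nonneg ha hb) hb]
        refine Real.rpow_le_one (mul_nonneg (checkOp_nonneg ha hb) hb) ?_ hs0.le
        rw [checkOp, div_mul_eq_mul_div, div_le_one hpos]
        nlinarith
      rw [min_eq_right hy1, max_eq_left (by linarith : (0 : ℝ) ≤ a ^ s - 1)]
      rw [min_eq_right hy1] at hn
      rcases le_total (b ^ s) (1 / 2) with h5 | h5
      · have : 0 ≤ min 1 (a ^ s - 1) := le_min zero_le_one (by linarith)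
        nlinarith
      · have h6 : checkOp a b ^ s - 1 ≤ min 1 (a ^ s - 1) := by
          refine le_min ?_ (by linarith)
          have : 0 ≤ checkOp a b ^ s := Real.rpow_nonneg (checkOp_nonneg ha hb) s
          nlinarith
        nlinarith [mul_nonneg hn (by linarith : 0 ≤ a ^ s - 1)]
  have h : ∀ a b : ℝ, 0 ≤ a → 0 ≤ b → max (checkOp a b ^ s - 1) 0 ≤
      (max (a ^ s - 1) 0 * (2 * (1 - min 1 (b ^ s))) + min 1 (max (a ^ s - 1) 0)) +
      (2 * (1 - min 1 (a ^ s)) * max (b ^ s - 1) 0 + min 1 (max (b ^ s - 1) 0)) := by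
    intro a b ha hb
    have aux : ∀ x y : ℝ, 0 ≤ 2 * (1 - min 1 (x ^ s)) * max (y ^ s - 1) 0 +
        min 1 (max (y ^ s - 1) 0) := by
      intro x y
      have hn : 0 ≤ 1 - min 1 (x ^ s) := by linarith [min_le_left 1 (x ^ s)]
      have hp := le_max_right (y ^ s - 1) 0
      have hq : 0 ≤ min 1 (max (y ^ s - 1) 0) := le_min zero_le_one hp
      positivity
    rcases le_total b a with hab | hab
    · have := key a b ha hb hab
      have := aux a b
      linarith
    · have := key b a hb ha hab
      rw [checkOp_comm] at this
      have := aux b a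
      linarith
  rw [excess, E_minus]
  refine (E_E_mono σ h).trans ?_
  simp only [E_add, E_sub, E_const, E_const_mul, E_mul_const]
  have := E_min_excess_le hs0 σ
  rw [lowMoment, excess]
  nlinarith

/-- Bernoulli's inequality. For a fixed law the excess vanishes linearly with the order, although
not uniformly over laws. -/
lemma excess_le_mul {s : ℝ} (hs0 : 0 ≤ s) (hs1 : s ≤ 1) (σ : RatioLaw.{u}) :
    σ.excess s ≤ s * σ.excess 1 := by
  rw [excess, excess, ← E_const_mul]
  refine σ.E_mono fun a ha => ?_
  rw [Real.rpow_one]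
  refine max_le ?_ (mul_nonneg hs0 (le_max_right _ _))
  have := rpow_one_add_le_one_add_mul_self (s := a - 1) (by linarith) hs0 hs1
  rw [add_sub_cancel] at this
  have h2 := mul_le_mul_of_nonneg_left (le_max_left (a - 1) 0) hs0
  linarith

lemma lowMoment_eq_min_rpow {s : ℝ} (hs : 0 ≤ s) {a : ℝ} (ha : 0 ≤ a) :
    min 1 (a ^ s) = min 1 a ^ s := by
  rcases le_total a 1 with h | h
  · rw [min_eq_right h, min_eq_right (Real.rpow_le_one ha h hs)]
  · rw [min_eq_left h, min_eq_left (Real.one_le_rpow h hs), Real.one_rpow]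

lemma lowMoment_mul_le {s p : ℝ} (hs : 0 ≤ s) (hp0 : 0 ≤ p) (hp1 : p ≤ 1)
    (σ : RatioLaw.{u}) : σ.lowMoment (s * p) ≤ σ.lowMoment s ^ p := by
  refine le_trans (le_of_eq ?_) (σ.E_rpow_le (φ := fun a => min 1 (a ^ s))
    (fun a ha => le_min zero_le_one (Real.rpow_nonneg ha s)) hp0 hp1)
  refine σ.E_congr fun a ha => ?_
  rw [lowMoment_eq_min_rpow (mul_nonneg hs hp0) ha, lowMoment_eq_min_rpow hs ha,
    Real.rpow_mul (le_min zero_le_one ha)]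

lemma lowMoment_anti {s t : ℝ} (hs : 0 < s) (hst : s ≤ t) (σ : RatioLaw.{u}) :
    σ.lowMoment t ≤ σ.lowMoment s := by
  refine σ.E_mono fun a ha => ?_
  rw [lowMoment_eq_min_rpow hs.le ha, lowMoment_eq_min_rpow (hs.le.trans hst) ha]
  rcases ha.eq_or_lt with rfl | ha
  · rw [min_eq_right zero_le_one, Real.zero_rpow hs.ne', Real.zero_rpow (hs.trans_le hst).ne']
  · exact Real.rpow_le_rpow_of_exponent_ge (lt_min one_pos ha) (min_le_left _ _) hst

/-- Order one is `min 1 a ≤ 2 * a / (1 + a)`, and Jensen's inequality lowers the order. -/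
lemma lowMoment_le_softBit {s : ℝ} (hs0 : 0 ≤ s) (hs1 : s ≤ 1) (σ : RatioLaw.{u}) :
    σ.lowMoment s ≤ (1 - σ.softBit) ^ s := by
  have h1 : σ.lowMoment 1 ≤ 1 - σ.softBit := by
    have : 1 - σ.softBit = σ.E fun a => 1 - (1 - a) / (1 + a) := by
      rw [E_sub, E_const]; rfl
    rw [this]
    refine σ.E_mono fun a ha => ?_
    have h0 : 0 < 1 + a := by linarith
    have h2 : 1 - (1 - a) / (1 + a) = 2 * a / (1 + a) := by field_simp; ring
    rw [Real.rpow_one, h2, le_div_iff₀ h0]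
    rcases min_cases 1 a with h | h <;> nlinarith
  have h2 := σ.lowMoment_mul_le (s := 1) (p := s) zero_le_one hs0 hs1
  rw [one_mul] at h2
  exact h2.trans (Real.rpow_le_rpow (σ.lowMoment_nonneg 1) h1 hs0)

end RatioLaw

/-! ### Polarization tree, superharmonic functionals and the chance of meeting a half-good law -/

namespace RatioLaw

/-- Average of a functional over the two synthetic laws. -/
def avg (F : RatioLaw.{u} → ℝ) (σ : RatioLaw.{u}) : ℝ := (F σ.minus + F σ.plus) / 2

/-- The law of the `i`-th synthetic channel after `n` polarization steps. -/
def node (σ : RatioLaw.{u}) : ℕ → ℕ → RatioLaw.{u}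
  | 0, _ => σ
  | n + 1, i => if i % 2 = 0 then (node σ n (i / 2)).minus else (node σ n (i / 2)).plus

lemma sum_range_two_mul (G : ℕ → ℝ) (m : ℕ) :
    ∑ i ∈ Finset.range (2 * m), G i = ∑ k ∈ Finset.range m, (G (2 * k) + G (2 * k + 1)) := by
  induction m with
  | zero => simp
  | succ m ih =>
    rw [Finset.sum_range_succ, ← ih, show 2 * (m + 1) = 2 * m + 1 + 1 by ring,
      Finset.sum_range_succ, Finset.sum_range_succ]
    ring

lemma avg_iterate (F : RatioLaw.{u} → ℝ) (n : ℕ) (σ : RatioLaw.{u}) :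
    avg^[n] F σ = (∑ i ∈ Finset.range (2 ^ n), F (σ.node n i)) / 2 ^ n := by
  induction n generalizing F with
  | zero => simp [node]
  | succ n ih =>
    rw [Function.iterate_succ_apply, ih, pow_succ' 2 n, sum_range_two_mul, pow_succ' (2 : ℝ) n]
    have : ∀ k, F (σ.node (n + 1) (2 * k)) + F (σ.node (n + 1) (2 * k + 1)) =
        2 * avg F (σ.node n k) := by
      intro k
      have h1 : (2 * k + 1) / 2 = k := by omega
      have h2 : (2 * k + 1) % 2 = 1 := by omega
      simp [node, h1, avg]
      ring
    simp only [this, ← Finset.mul_sum]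
    field_simp

lemma avg_iterate_succ (F : RatioLaw.{u} → ℝ) (n : ℕ) (σ : RatioLaw.{u}) :
    avg^[n + 1] F σ = (avg^[n] F σ.minus + avg^[n] F σ.plus) / 2 := by
  rw [Function.iterate_succ_apply']; rfl

lemma avg_iterate_mono {F G : RatioLaw.{u} → ℝ} (h : ∀ σ, F σ ≤ G σ) (n : ℕ)
    (σ : RatioLaw.{u}) : avg^[n] F σ ≤ avg^[n] G σ := by
  rw [avg_iterate, avg_iterate]
  gcongr
  exact h _

lemma avg_iterate_const (k : ℝ) (n : ℕ) (σ : RatioLaw.{u}) :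
    avg^[n] (fun _ => k) σ = k := by
  rw [avg_iterate]; simp

lemma avg_iterate_info (n : ℕ) (σ : RatioLaw.{u}) : avg^[n] info σ = σ.info := by
  induction n generalizing σ with
  | zero => rfl
  | succ n ih => rw [avg_iterate_succ, ih, ih, info_minus_add_plus]; ring

/-- Superharmonicity with respect to the polarization step. -/
def Superharmonic (f : RatioLaw.{u} → ℝ) : Prop := ∀ σ, avg f σ ≤ f σ

lemma Superharmonic.iterate_le {f : RatioLaw.{u} → ℝ} (hf : Superharmonic f) (n : ℕ)
    (σ : RatioLaw.{u}) : avg^[n] f σ ≤ f σ := by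
  induction n with
  | zero => rfl
  | succ n ih =>
    rw [Function.iterate_succ_apply]
    exact (avg_iterate_mono hf n σ).trans ih

lemma Superharmonic.node_le {f : RatioLaw.{u} → ℝ} (hf : Superharmonic f) (h0 : ∀ σ, 0 ≤ f σ)
    (n : ℕ) (σ : RatioLaw.{u}) {i : ℕ} (hi : i < 2 ^ n) : f (σ.node n i) / 2 ^ n ≤ f σ := by
  refine le_trans ?_ (hf.iterate_le n σ)
  rw [avg_iterate]
  gcongr
  exact Finset.single_le_sum (f := fun i => f (σ.node n i)) (fun j _ => h0 _)
    (Finset.mem_range.2 hi)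

/-- Some moment of order at most one is bounded away from one. -/
def HalfGood (σ : RatioLaw.{u}) : Prop := ∃ s, 0 < s ∧ s ≤ 1 ∧ σ.moment s ≤ 31 / 32

/-- The potential which bounds the probability of not meeting a `HalfGood` law in `n` steps. -/
def potential (s : ℝ) (n : ℕ) (σ : RatioLaw.{u}) (t : ℝ) : ℝ :=
  8 * √(σ.excess s) + 6 * n * √(s * σ.logLoss) +
    16 * (√(σ.lowMoment t) + 10 * √(t * σ.logLoss)) + (15 / 16) ^ n * √(t / s)

lemma potential_nonneg (s : ℝ) (n : ℕ) (σ : RatioLaw.{u}) (t : ℝ) : 0 ≤ potential s n σ t := by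
  unfold potential; positivity

lemma sqrt_add_sqrt_le {x y : ℝ} (hx : 0 ≤ x) (hy : 0 ≤ y) : √x + √y ≤ √(2 * (x + y)) := by
  refine Real.le_sqrt_of_sq_le ?_
  nlinarith [Real.sq_sqrt hx, Real.sq_sqrt hy, sq_nonneg (√x - √y)]

/-- In square roots the minus branch has factor `1/2` and the plus branch `3/2`, so the mean does
not grow apart from the log-loss term. The minus factor needs the low moment of order `s` close to
one, which is what failing to be half-good provides. -/
lemma sqrt_excess_step {s : ℝ} (hs0 : 0 < s) (σ : RatioLaw.{u})
    (he : σ.excess s ≤ 1 / 64) (hw : 1 - σ.lowMoment s ≤ 1 / 16) :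
    √(σ.minus.excess s) + √(σ.plus.excess s) ≤
      2 * √(σ.excess s) + 3 / 2 * √(s * σ.logLoss) := by
  have he0 := σ.excess_nonneg s
  have hc := σ.logLoss_nonneg
  set e := σ.excess s
  have h1 : √(σ.minus.excess s) ≤ 1 / 2 * √e + 3 / 2 * √(s * σ.logLoss) := by
    refine Real.sqrt_le_iff.2 ⟨by positivity, (σ.excess_minus_le hs0).trans ?_⟩
    have hsc : 0 ≤ s * σ.logLoss := by positivity
    nlinarith [Real.sq_sqrt he0, Real.sq_sqrt hsc, Real.sqrt_nonneg e,
      Real.sqrt_nonneg (s * σ.logLoss), mul_nonneg (Real.sqrt_nonneg e)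
      (Real.sqrt_nonneg (s * σ.logLoss)), mul_le_mul_of_nonneg_right hw he0]
  have h2 : √(σ.plus.excess s) ≤ 3 / 2 * √e := by
    refine Real.sqrt_le_iff.2 ⟨by positivity, (σ.excess_plus_le s).trans ?_⟩
    nlinarith [Real.sq_sqrt he0]
  linarith

lemma sqrt_logLoss_step {s : ℝ} (hs0 : 0 < s) (σ : RatioLaw.{u}) :
    √(s * σ.minus.logLoss) + √(s * σ.plus.logLoss) ≤ 2 * √(s * σ.logLoss) := by
  refine (sqrt_add_sqrt_le (mul_nonneg hs0.le (logLoss_nonneg _))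
    (mul_nonneg hs0.le (logLoss_nonneg _))).trans (le_of_eq ?_)
  rw [← mul_add, logLoss_minus_add_plus,
    show 2 * (s * (2 * σ.logLoss)) = 2 ^ 2 * (s * σ.logLoss) by ring,
    Real.sqrt_mul (by norm_num), Real.sqrt_sq (by norm_num)]

/-- By Cauchy–Schwarz and conservation of the log-loss, shrinking `t` by `3/4` on the plus branch
gives a total factor `√(7/2)`, and `√(7/2) ≤ 15/8 < 2`. -/
lemma sqrt_scaled_logLoss_step {t : ℝ} (ht0 : 0 < t) (σ : RatioLaw.{u}) :
    √(t * σ.minus.logLoss) + √(3 / 4 * t * σ.plus.logLoss) ≤ 15 / 8 * √(t * σ.logLoss) := by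
  have hm := σ.minus.logLoss_nonneg
  have hp := σ.plus.logLoss_nonneg
  have hc := σ.logLoss_nonneg
  have hs := σ.logLoss_minus_add_plus
  have h1 : 0 ≤ t * σ.minus.logLoss := by positivity
  have h2 : 0 ≤ t * σ.plus.logLoss := by positivity
  have h3 : 0 ≤ t * σ.logLoss := by positivity
  rw [mul_assoc (3 / 4), Real.sqrt_mul (by norm_num : (0 : ℝ) ≤ 3 / 4)]
  set x := √(t * σ.minus.logLoss)
  set y := √(t * σ.plus.logLoss)
  have hx : x ^ 2 = t * σ.minus.logLoss := Real.sq_sqrt h1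
  have hy : y ^ 2 = t * σ.plus.logLoss := Real.sq_sqrt h2
  have hxy : x ^ 2 + y ^ 2 = 2 * (t * σ.logLoss) := by rw [hx, hy, ← mul_add, hs]; ring
  have hq : √(3 / 4 : ℝ) ^ 2 = 3 / 4 := Real.sq_sqrt (by norm_num)
  set q := √(3 / 4 : ℝ)
  have : x + q * y ≤ √(7 / 4 * (2 * (t * σ.logLoss))) := by
    refine Real.le_sqrt_of_sq_le ?_
    rw [← hxy]
    nlinarith [sq_nonneg (q * x - y)]
  refine this.trans (Real.sqrt_le_iff.2 ⟨by positivity, ?_⟩)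
  rw [mul_pow, Real.sq_sqrt h3]
  nlinarith

/-- Minus at most doubles `w`. Plus squares it, which pays for lowering the order: `w` becomes about
`(w ^ (3/4)) ^ 2 = w ^ (3/2)`, at most `w / 16` when `√w ≤ 1/16`. -/
lemma sqrt_lowMoment_step {t : ℝ} (ht0 : 0 < t) (ht1 : t ≤ 1) (σ : RatioLaw.{u})
    (hw : √(σ.lowMoment t) ≤ 1 / 16) :
    √(σ.minus.lowMoment t) + √(σ.plus.lowMoment (3 / 4 * t)) ≤
      7 / 4 * √(σ.lowMoment t) + 5 / 4 * √(t * σ.logLoss) := by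
  have hc := σ.logLoss_nonneg
  have h3 : 0 ≤ t * σ.logLoss := by positivity
  have hw0 := σ.lowMoment_nonneg t
  have hp := σ.lowMoment_plus_le (s := 3 / 4 * t) (by positivity)
  have hj := σ.lowMoment_mul_le (s := t) (p := 3 / 4) ht0.le (by norm_num) (by norm_num)
  rw [mul_comm t] at hj
  set w := σ.lowMoment t
  have hsq : √w ^ 2 = w := Real.sq_sqrt hw0
  have h1 : √(σ.minus.lowMoment t) ≤ 3 / 2 * √w := by
    refine Real.sqrt_le_iff.2 ⟨by positivity, (σ.lowMoment_minus_le ht0 ht1).trans ?_⟩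
    rw [mul_pow, hsq]; linarith
  have h2 : (w ^ (3 / 4 : ℝ)) ^ 2 = w * √w := by
    rw [← Real.rpow_natCast, ← Real.rpow_mul hw0, Real.sqrt_eq_rpow]
    nth_rewrite 2 [← Real.rpow_one w]
    rw [← Real.rpow_add' hw0 (by norm_num)]
    norm_num
  have h4 : √(σ.plus.lowMoment (3 / 4 * t)) ≤ 1 / 4 * √w + 5 / 4 * √(t * σ.logLoss) := by
    refine Real.sqrt_le_iff.2 ⟨by positivity, hp.trans ?_⟩
    have h5 : σ.lowMoment (3 / 4 * t) ^ 2 ≤ w * √w := by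
      rw [← h2]; exact pow_le_pow_left₀ (σ.lowMoment_nonneg _) hj 2
    have h6 : w * √w ≤ 1 / 16 * w := by nlinarith
    nlinarith [Real.sq_sqrt h3, mul_nonneg (Real.sqrt_nonneg w)
      (Real.sqrt_nonneg (t * σ.logLoss))]
  linarith

/-- The weights balance the errors: `8 * (3/2) = 2 * 6` is absorbed by one unit of `n`, and `5/4 +
10 * (15/8) = 2 * 10` closes the low-moment terms. The ratio `√(t / s)` loses a mean factor `15/16`,
since the plus branch scales it by `√(3/4) ≤ 7/8`. -/
lemma potential_step {s t : ℝ} (hs0 : 0 < s) (ht0 : 0 < t) (ht1 : t ≤ 1) (n : ℕ)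
    (σ : RatioLaw.{u}) (he : σ.excess s ≤ 1 / 64) (hJ : 1 - σ.lowMoment s ≤ 1 / 16)
    (hw : √(σ.lowMoment t) ≤ 1 / 16) :
    potential s n σ.minus t + potential s n σ.plus (3 / 4 * t) ≤ 2 * potential s (n + 1) σ t := by
  have h1 := sqrt_excess_step hs0 σ he hJ
  have h2 := mul_le_mul_of_nonneg_left (sqrt_logLoss_step hs0 σ)
    (by positivity : (0 : ℝ) ≤ 6 * n)
  have h3 := sqrt_scaled_logLoss_step ht0 σ
  have h4 := sqrt_lowMoment_step ht0 ht1 σ hw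
  have h5 : √(3 / 4 * t / s) ≤ 7 / 8 * √(t / s) := by
    refine Real.sqrt_le_iff.2 ⟨by positivity, ?_⟩
    rw [mul_pow, Real.sq_sqrt (by positivity), mul_div_assoc]
    have : 0 < t / s := by positivity
    nlinarith
  have h6 := mul_le_mul_of_nonneg_left h5 (by positivity : (0 : ℝ) ≤ (15 / 16) ^ n)
  have h7 := Real.sqrt_nonneg (s * σ.logLoss)
  have h8 := Real.sqrt_nonneg (t * σ.logLoss)
  have h9 := Real.sqrt_nonneg (σ.lowMoment t)
  unfold potential
  rw [pow_succ]
  push_cast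
  linarith

/-- A nonnegative superharmonic functional which is at least `d` on `HalfGood` laws is bounded
below by `d` times the complement of the potential. -/
lemma Superharmonic.le_of_potential {f : RatioLaw.{u} → ℝ} (hf : Superharmonic f)
    (h0 : ∀ σ, 0 ≤ f σ) {d : ℝ} (hd0 : 0 ≤ d) (hd : ∀ σ, HalfGood σ → d ≤ f σ)
    {s : ℝ} (hs0 : 0 < s) (hs1 : s ≤ 1) (n : ℕ) (σ : RatioLaw.{u}) {t : ℝ} (ht0 : 0 < t)
    (ht1 : t ≤ 1) : d * (1 - potential s n σ t) ≤ f σ := by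
  induction n generalizing σ t with
  | zero =>
    by_cases hg : HalfGood σ
    · exact le_trans (by nlinarith [potential_nonneg s 0 σ t]) (hd σ hg)
    refine le_trans (mul_nonpos_of_nonneg_of_nonpos hd0 ?_) (h0 σ)
    rw [sub_nonpos]
    by_contra! hlt
    have hn := hlt
    unfold potential at hn
    have p1 := Real.sqrt_nonneg (σ.excess s)
    have p2 := Real.sqrt_nonneg (s * σ.logLoss)
    have p3 := Real.sqrt_nonneg (σ.lowMoment t)
    have p4 := Real.sqrt_nonneg (t * σ.logLoss)
    have p5 := Real.sqrt_nonneg (t / s)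
    simp only [CharP.cast_eq_zero, mul_zero, zero_mul, pow_zero, one_mul] at hn
    have he : σ.excess s ≤ 1 / 64 := by
      have : √(σ.excess s) ≤ 1 / 8 := by linarith
      nlinarith [Real.sq_sqrt (σ.excess_nonneg s)]
    have hw : σ.lowMoment t ≤ 1 / 256 := by
      have : √(σ.lowMoment t) ≤ 1 / 16 := by linarith
      nlinarith [Real.sq_sqrt (σ.lowMoment_nonneg t)]
    -- With no steps left the last term is `√(t / s)` itself, so potential below one means that the
    -- order `t` has come down to `s`; the low moment at `t` then bounds the one at `s`.
    have hts : t ≤ s := by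
      have h : √(t / s) ≤ 1 := by linarith
      have := (Real.sqrt_le_iff.1 h).2
      rwa [one_pow, div_le_one hs0] at this
    refine hg ⟨s, hs0, hs1, ?_⟩
    rw [moment_eq]
    have := σ.lowMoment_anti ht0 hts
    linarith
  | succ n ih =>
    by_cases hg : HalfGood σ
    · exact le_trans (by nlinarith [potential_nonneg s (n + 1) σ t]) (hd σ hg)
    by_cases hlt : 1 ≤ potential s (n + 1) σ t
    · exact le_trans (mul_nonpos_of_nonneg_of_nonpos hd0 (by linarith)) (h0 σ)
    push Not at hlt
    have hn := hlt
    unfold potential at hn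
    have p1 := Real.sqrt_nonneg (σ.excess s)
    have p2 : 0 ≤ 6 * ((n + 1 : ℕ) : ℝ) * √(s * σ.logLoss) := by positivity
    have p3 := Real.sqrt_nonneg (σ.lowMoment t)
    have p4 := Real.sqrt_nonneg (t * σ.logLoss)
    have p5 : 0 ≤ (15 / 16 : ℝ) ^ (n + 1) * √(t / s) := by positivity
    have he : σ.excess s ≤ 1 / 64 := by
      have : √(σ.excess s) ≤ 1 / 8 := by linarith
      nlinarith [Real.sq_sqrt (σ.excess_nonneg s)]
    have hw : √(σ.lowMoment t) ≤ 1 / 16 := by linarith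
    -- Otherwise the moment of order `s` would be at most `15/16 + 1/64 < 31/32`, and the law would
    -- be half-good.
    have hJ : 1 - σ.lowMoment s ≤ 1 / 16 := by
      by_contra! hJ
      refine hg ⟨s, hs0, hs1, ?_⟩
      rw [moment_eq]
      linarith
    have h1 := potential_step hs0 ht0 ht1 n σ he hJ hw
    have h2 := ih σ.minus ht0 ht1
    have h3 := ih σ.plus (t := 3 / 4 * t) (by positivity) (by linarith)
    have h4 := hf σ
    unfold avg at h4
    have h5 := mul_le_mul_of_nonneg_left h1 hd0
    linarith

lemma softBit_node_zero (σ : RatioLaw.{u}) (j : ℕ) :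
    (σ.node j 0).softBit = σ.softBit ^ 2 ^ j := by
  induction j with
  | zero => simp [node]
  | succ j ih =>
    simp only [node, Nat.zero_mod, if_true, Nat.zero_div, softBit_minus, ih]
    rw [← pow_mul, pow_succ]

/-- A superharmonic functional on a law with nearly perfect soft bits. -/
lemma Superharmonic.half_le {f : RatioLaw.{u} → ℝ} (hf : Superharmonic f)
    (h0 : ∀ σ, 0 ≤ f σ) {d : ℝ} (hd0 : 0 ≤ d) (hd : ∀ σ, HalfGood σ → d ≤ f σ)
    (σ : RatioLaw.{u}) (hI : 0 ≤ σ.info) (hw : σ.lowMoment (1 / 10 ^ 6) ≤ 1 / 10 ^ 6) :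
    d / 2 ≤ f σ := by
  -- The target order decays with the horizon `n`: fast enough to kill the excess and `n * √(s *
  -- logLoss)`, slowly enough that `(15/16) ^ n * √(t / s) = (75/76) ^ n` still vanishes. The
  -- surviving terms are at most `16 * (1 + 10) / 1000 < 1/4`.
  set s : ℕ → ℝ := fun n => 1 / 10 ^ 6 * ((19 / 20) ^ n) ^ 2 with hs
  have hs0 : ∀ n, 0 < s n := fun n => by simp only [hs]; positivity
  have hs1 : ∀ n, s n ≤ 1 := fun n => by
    have : (19 / 20 : ℝ) ^ n ≤ 1 := pow_le_one₀ (by norm_num) (by norm_num)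
    have h2 : ((19 / 20 : ℝ) ^ n) ^ 2 ≤ 1 := pow_le_one₀ (by positivity) this
    simp only [hs]; linarith
  have hc0 := σ.logLoss_nonneg
  have hc1 : σ.logLoss ≤ 1 := by unfold info at hI; linarith
  have hsqrt : √(1 / 10 ^ 6 : ℝ) = 1 / 1000 := by
    rw [show (1 / 10 ^ 6 : ℝ) = (1 / 1000) ^ 2 by norm_num, Real.sqrt_sq (by norm_num)]
  have hwq : √(σ.lowMoment (1 / 10 ^ 6)) ≤ 1 / 1000 := hsqrt ▸ Real.sqrt_le_sqrt hw
  have hcq : √(1 / 10 ^ 6 * σ.logLoss) ≤ 1 / 1000 := by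
    rw [← hsqrt]; exact Real.sqrt_le_sqrt (by linarith)
  have hss : ∀ n (x : ℝ), √(s n * x) = (19 / 20) ^ n * √(1 / 10 ^ 6 * x) := by
    intro n x
    simp only [hs]
    rw [show 1 / 10 ^ 6 * ((19 / 20 : ℝ) ^ n) ^ 2 * x =
      ((19 / 20 : ℝ) ^ n) ^ 2 * (1 / 10 ^ 6 * x) by ring, Real.sqrt_mul (by positivity),
      Real.sqrt_sq (by positivity)]
  have hsd : ∀ n, √(1 / 10 ^ 6 / s n) = (20 / 19) ^ n := by
    intro n
    have : 1 / 10 ^ 6 / s n = ((20 / 19 : ℝ) ^ n) ^ 2 := by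
      simp only [hs]
      rw [show (20 / 19 : ℝ) = (19 / 20)⁻¹ by norm_num, inv_pow]
      have : (0 : ℝ) < (19 / 20) ^ n := by positivity
      field_simp
    rw [this, Real.sqrt_sq (by positivity)]
  have hbound : ∀ n, potential (s n) n σ (1 / 10 ^ 6) ≤
      8 * √(1 / 10 ^ 6 * σ.excess 1) * (19 / 20) ^ n +
      6 * √(1 / 10 ^ 6 * σ.logLoss) * (n * (19 / 20) ^ n) + 1 / 4 + (75 / 76) ^ n := by
    intro n
    have h1 : √(σ.excess (s n)) ≤ (19 / 20) ^ n * √(1 / 10 ^ 6 * σ.excess 1) := by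
      rw [← hss]
      exact Real.sqrt_le_sqrt (σ.excess_le_mul (hs0 n).le (hs1 n))
    unfold potential
    rw [hss, hsd, ← mul_pow, show (15 / 16 : ℝ) * (20 / 19) = 75 / 76 by norm_num]
    linarith
  have hlim : Tendsto (fun n : ℕ => 8 * √(1 / 10 ^ 6 * σ.excess 1) * (19 / 20 : ℝ) ^ n +
      6 * √(1 / 10 ^ 6 * σ.logLoss) * (n * (19 / 20 : ℝ) ^ n) + 1 / 4 + (75 / 76 : ℝ) ^ n) atTop
      (nhds (8 * √(1 / 10 ^ 6 * σ.excess 1) * 0 + 6 * √(1 / 10 ^ 6 * σ.logLoss) * 0 + 1 / 4 + 0)) :=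
    ((((tendsto_pow_atTop_nhds_zero_of_lt_one (by norm_num) (by norm_num)).const_mul _).add
      ((tendsto_self_mul_const_pow_of_lt_one (by norm_num) (by norm_num)).const_mul _)).add_const
      _).add (tendsto_pow_atTop_nhds_zero_of_lt_one (by norm_num) (by norm_num))
  obtain ⟨n, hn⟩ := (hlim.eventually (gt_mem_nhds (by norm_num : _ < (1 / 2 : ℝ)))).exists
  have h := hf.le_of_potential h0 hd0 hd (hs0 n) (hs1 n) n σ (t := 1 / 10 ^ 6)
    (by norm_num) (by norm_num)
  have := hbound n
  nlinarith

/-- A law with information at least `γ` meets `HalfGood` laws with a probability bounded below in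
terms of `γ`, expressed through superharmonic functionals. -/
lemma exists_superharmonic_bound {γ : ℝ} (hγ : 0 < γ) : ∃ ρ : ℝ, 0 < ρ ∧ ρ ≤ 1 ∧
    ∀ f : RatioLaw.{u} → ℝ, Superharmonic f → (∀ σ, 0 ≤ f σ) → ∀ d : ℝ, 0 ≤ d →
      (∀ σ, HalfGood σ → d ≤ f σ) → ∀ σ, γ ≤ σ.info → ρ * d ≤ f σ := by
  have hl2 : (0 : ℝ) < Real.log 2 := Real.log_pos (by norm_num)
  -- Chosen so that `η ^ (1 / 10 ^ 6) = 1 / 10 ^ 6`, the low-moment threshold in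
  -- `Superharmonic.half_le`.
  set η : ℝ := (1 / 10 ^ 6 : ℝ) ^ (10 ^ 6 : ℝ) with hη
  have hη0 : 0 < η := by positivity
  have hη1 : η < 1 := Real.rpow_lt_one (by norm_num) (by norm_num) (by norm_num)
  have hlow : ∀ σ : RatioLaw.{u}, 1 - η ≤ σ.softBit →
      σ.lowMoment (1 / 10 ^ 6) ≤ 1 / 10 ^ 6 := by
    intro σ hm
    refine (σ.lowMoment_le_softBit (by norm_num) (by norm_num)).trans ?_
    have h6 : (1 - σ.softBit) ^ (1 / 10 ^ 6 : ℝ) ≤ η ^ (1 / 10 ^ 6 : ℝ) :=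
      Real.rpow_le_rpow (by linarith [σ.softBit_le_one]) (by linarith) (by norm_num)
    refine h6.trans (le_of_eq ?_)
    rw [hη, ← Real.rpow_mul (by norm_num)]
    norm_num
  obtain ⟨j, hj⟩ : ∃ j : ℕ, (1 - η) ^ 2 ^ j < γ / 2 * Real.log 2 := by
    have h1 : Tendsto (fun j : ℕ => (1 - η) ^ 2 ^ j) atTop (nhds 0) :=
      (tendsto_pow_atTop_nhds_zero_of_lt_one (by linarith) (by linarith)).comp
        (tendsto_pow_atTop_atTop_of_one_lt (by norm_num))
    exact (h1.eventually (gt_mem_nhds (by positivity : (0 : ℝ) < γ / 2 * Real.log 2))).exists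
  set δ : ℝ := γ / 2 / 2 ^ j with hδ
  have hδ0 : 0 < δ := by positivity
  obtain ⟨r, hr⟩ := exists_nat_gt (1 / δ)
  rw [div_lt_iff₀ hδ0] at hr
  have h2j : (1 : ℝ) ≤ 2 ^ j := one_le_pow₀ (by norm_num)
  -- At most `r` rounds of `j` steps, each following one of `2 ^ j` descendants, and a final factor
  -- `1/2` for a nearly perfect soft bit.
  refine ⟨1 / 2 / (2 ^ j) ^ r, by positivity, ?_, ?_⟩
  · rw [div_le_one (by positivity)]
    have : (1 : ℝ) ≤ (2 ^ j) ^ r := one_le_pow₀ h2j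
    linarith
  intro f hf h0 d hd0 hd σ hσ
  have main : ∀ (r : ℕ) (σ : RatioLaw.{u}), γ ≤ σ.info → 1 - r * δ ≤ σ.info →
      1 / 2 / (2 ^ j) ^ r * d ≤ f σ := by
    intro r
    induction r with
    | zero =>
      intro σ h1 h2
      have hI : σ.info = 1 := le_antisymm σ.info_le_one (by simpa using h2)
      have hc : σ.logLoss = 0 := by unfold info at hI; linarith
      -- Information one means zero log-loss, which every minus step preserves; a soft bit below `1
      -- - η` would force the `j`-fold minus descendant below information `γ / 2`.
      have hm : 1 - η ≤ σ.softBit := by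
        by_contra! hm
        have := σ.info_le_softBit
        have hz : (σ.node j 0).info = 1 := by
          have hall : ∀ n, (σ.node n 0).logLoss = 0 := by
            intro n
            induction n with
            | zero => exact hc
            | succ n ih =>
              have h3 := (σ.node n 0).logLoss_minus_add_plus
              have h4 := (σ.node n 0).minus.logLoss_nonneg
              have h5 := (σ.node n 0).plus.logLoss_nonneg
              simp only [node, Nat.zero_mod, if_true, Nat.zero_div]
              linarith
          unfold info; rw [hall]; ring
        have h3 := (σ.node j 0).info_le_softBit
        rw [hz, softBit_node_zero, le_div_iff₀ hl2] at h3
        have hpos : 0 ≤ σ.softBit := by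
          rw [hI, le_div_iff₀ hl2] at this; linarith
        have h4 := pow_le_pow_left₀ hpos hm.le (2 ^ j)
        have hg1 : γ ≤ 1 := hI ▸ h1
        nlinarith
      have hw := hlow σ hm
      have := hf.half_le h0 hd0 hd σ (by linarith) hw
      simpa using by linarith
    | succ r ih =>
      intro σ h1 h2
      by_cases hm : 1 - η ≤ σ.softBit
      · have hw := hlow σ hm
        have h3 := hf.half_le h0 hd0 hd σ (by linarith) hw
        refine le_trans ?_ h3
        have : (1 : ℝ) ≤ (2 ^ j) ^ (r + 1) := one_le_pow₀ h2j
        have h4 : 1 / 2 / ((2 : ℝ) ^ j) ^ (r + 1) ≤ 1 / 2 :=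
          div_le_self (by norm_num) this
        nlinarith
      · push Not at hm
        have hpos : 0 ≤ σ.softBit := by
          have := σ.info_le_softBit
          rw [le_div_iff₀ hl2] at this
          nlinarith
        have hz : (σ.node j 0).info ≤ γ / 2 := by
          refine (σ.node j 0).info_le_softBit.trans ?_
          rw [softBit_node_zero, div_le_iff₀ hl2]
          exact (pow_le_pow_left₀ hpos hm.le _).trans hj.le
        -- The all-minus descendant holds at most `γ / 2`, so by conservation the deficit of at
        -- least `γ / 2` is spread over the others.
        obtain ⟨i, hi, hiI⟩ : ∃ i < 2 ^ j, σ.info + δ ≤ (σ.node j i).info := by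
          by_contra! hcon
          have h3 := avg_iterate_info j σ
          rw [avg_iterate, div_eq_iff (by positivity)] at h3
          have h4 : ∑ i ∈ Finset.range (2 ^ j), (σ.node j i).info ≤
              ∑ i ∈ Finset.range (2 ^ j), if i = 0 then γ / 2 else σ.info + δ := by
            refine Finset.sum_le_sum fun i hi => ?_
            split_ifs with h0
            · rw [h0]; exact hz
            · exact (hcon i (Finset.mem_range.1 hi)).le
          have h5 : (∑ i ∈ Finset.range (2 ^ j), if i = 0 then γ / 2 else σ.info + δ) =
              γ / 2 + (2 ^ j - 1) * (σ.info + δ) := by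
            have hne : 2 ^ j = (2 ^ j - 1) + 1 := (Nat.sub_add_cancel Nat.one_le_two_pow).symm
            rw [hne, Finset.sum_range_succ']
            simp only [Nat.add_eq_zero_iff, one_ne_zero, and_false, if_false, if_true,
              Finset.sum_const, Finset.card_range, nsmul_eq_mul]
            push_cast [Nat.one_le_two_pow]
            ring
          have h6 : δ * 2 ^ j = γ / 2 := by rw [hδ]; field_simp
          nlinarith
        have h3 := ih (σ.node j i) (by linarith) (by push_cast at h2; linarith)
        have h4 := hf.node_le h0 j σ hi
        refine le_trans ?_ h4
        rw [le_div_iff₀ (by positivity)]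
        refine le_trans (le_of_eq ?_) h3
        rw [pow_succ]
        field_simp
  exact main r σ hσ (by linarith)

end RatioLaw

/-! ### Fast polarization and the asymptotic proportion of small moments -/

namespace RatioLaw

/-- Parameters for the contraction of the potential `a ↦ a ^ (-t)` under `a ↦ a - 1` and
`a ↦ 2 * a`. -/
lemma exists_contraction {β : ℝ} (hβ0 : 0 < β) (hβ : β < 1 / 2) : ∃ t a₀ l : ℝ,
    0 < t ∧ 1 < a₀ ∧ 0 < l ∧ l ≤ 1 ∧ l * 2 ^ (β * t) < 1 ∧
    ∀ a, a₀ ≤ a → ((a - 1) ^ (-t) + (2 * a) ^ (-t)) / 2 ≤ l * a ^ (-t) := by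
  have hl2 : (0 : ℝ) < Real.log 2 := Real.log_pos (by norm_num)
  -- Here `h` is `t * log 2`. The bounds `2 ^ (-t) ≤ 1 / (1 + h)` and `1 - β * h ≤ 2 ^ (-β * t)`
  -- leave room for `l` as soon as `1 + h < 1 / (2 * β)`; half the admissible range is taken.
  set h : ℝ := (1 / (2 * β) - 1) / 2 with hh
  have hh1 : 1 < 1 / (2 * β) := by rw [lt_div_iff₀ (by positivity)]; linarith
  have hh0 : 0 < h := by rw [hh]; linarith
  set t : ℝ := h / Real.log 2 with ht
  have ht0 : 0 < t := by positivity
  have htl : Real.log 2 * t = h := by rw [ht]; field_simp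
  have h2t : (2 : ℝ) ^ (-t) ≤ 1 / (1 + h) := by
    rw [Real.rpow_neg (by norm_num), Real.rpow_def_of_pos (by norm_num), htl, one_div]
    exact inv_anti₀ (by positivity) (by linarith [Real.add_one_le_exp h])
  have hbt : 1 - β * h ≤ (2 : ℝ) ^ (-(β * t)) := by
    rw [Real.rpow_def_of_pos (by norm_num)]
    have h3 : Real.log 2 * -(β * t) = -(β * h) := by rw [← htl]; ring
    rw [h3]
    linarith [Real.add_one_le_exp (-(β * h))]
  have hlt : (2 ^ (-t) + 1) / 2 < (2 : ℝ) ^ (-(β * t)) := by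
    refine lt_of_lt_of_le ?_ hbt
    have h4 : 1 / (1 + h) = 1 - h / (1 + h) := by field_simp; ring
    have h5 : 2 * β < 1 / (1 + h) := by
      rw [lt_div_iff₀ (by positivity), hh]
      have : β * (1 / (2 * β)) = 1 / 2 := by field_simp
      nlinarith
    have h6 : 2 * β * h < h / (1 + h) := by
      have := mul_lt_mul_of_pos_right h5 hh0
      rwa [one_div_mul_eq_div] at this
    linarith
  obtain ⟨l, hl1, hl3⟩ := exists_between hlt
  have hbt1 : (2 : ℝ) ^ (-(β * t)) ≤ 1 :=
    Real.rpow_le_one_of_one_le_of_nonpos (by norm_num) (by nlinarith)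
  have hl0 : 0 < l := lt_trans (by positivity) hl1
  have hlim : Tendsto (fun a : ℝ => (2 ^ (-t) + (1 - a⁻¹) ^ (-t)) / 2) atTop
      (nhds ((2 ^ (-t) + (1 - 0) ^ (-t)) / 2)) := by
    refine (Tendsto.const_add _ ?_).div_const _
    exact (tendsto_inv_atTop_zero.const_sub 1).rpow_const (Or.inl (by norm_num))
  rw [sub_zero, Real.one_rpow] at hlim
  obtain ⟨a₁, ha₁⟩ := eventually_atTop.1 (hlim.eventually (gt_mem_nhds hl1))
  refine ⟨t, max a₁ 2, l, ht0, lt_max_of_lt_right (by norm_num), hl0, hl3.le.trans hbt1, ?_, ?_⟩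
  · calc l * 2 ^ (β * t) < 2 ^ (-(β * t)) * (2 : ℝ) ^ (β * t) := by gcongr
      _ = 1 := by rw [← Real.rpow_add (by norm_num)]; simp
  · intro a ha
    have ha2 : 2 ≤ a := (le_max_right _ _).trans ha
    have ha0 : 0 < a := by linarith
    have h1 := (ha₁ a ((le_max_left _ _).trans ha)).le
    have hinv : 0 ≤ 1 - a⁻¹ := by
      rw [sub_nonneg]; exact inv_le_one_of_one_le₀ (by linarith)
    have h3 : (a - 1) ^ (-t) = (1 - a⁻¹) ^ (-t) * a ^ (-t) := by
      rw [← Real.mul_rpow hinv ha0.le]; congr 1; field_simp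
    rw [h3, Real.mul_rpow (by norm_num) ha0.le]
    have h4 : 0 < a ^ (-t) := by positivity
    nlinarith

/-- The indicator of a property of laws. -/
def ind (P : RatioLaw.{u} → Prop) (σ : RatioLaw.{u}) : ℝ :=
  open scoped Classical in if P σ then 1 else 0

lemma ind_nonneg (P : RatioLaw.{u} → Prop) (σ : RatioLaw.{u}) : 0 ≤ ind P σ := by
  unfold ind; split_ifs <;> norm_num

lemma ind_le_one (P : RatioLaw.{u} → Prop) (σ : RatioLaw.{u}) : ind P σ ≤ 1 := by
  unfold ind; split_ifs <;> norm_num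

lemma ind_not (P : RatioLaw.{u} → Prop) (σ : RatioLaw.{u}) :
    ind P σ = 1 - ind (fun σ => ¬ P σ) σ := by
  unfold ind; by_cases h : P σ <;> simp [h]

lemma avg_iterate_one_sub (F : RatioLaw.{u} → ℝ) (n : ℕ) (σ : RatioLaw.{u}) :
    avg^[n] (fun σ => 1 - F σ) σ = 1 - avg^[n] F σ := by
  rw [avg_iterate, avg_iterate, Finset.sum_sub_distrib, sub_div]
  simp

lemma avg_iterate_ind_nonneg (P : RatioLaw.{u} → Prop) (n : ℕ) (σ : RatioLaw.{u}) :
    0 ≤ avg^[n] (ind P) σ := by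
  rw [← avg_iterate_const 0 n σ]; exact avg_iterate_mono (ind_nonneg P) n σ

lemma avg_iterate_ind_le_one (P : RatioLaw.{u} → Prop) (n : ℕ) (σ : RatioLaw.{u}) :
    avg^[n] (ind P) σ ≤ 1 := by
  rw [← avg_iterate_const 1 n σ]; exact avg_iterate_mono (ind_le_one P) n σ

lemma avg_iterate_ind_not (P : RatioLaw.{u} → Prop) (n : ℕ) (σ : RatioLaw.{u}) :
    avg^[n] (ind P) σ = 1 - avg^[n] (ind fun σ => ¬ P σ) σ := by
  rw [← avg_iterate_one_sub, show ind P = fun σ => 1 - ind (fun σ => ¬ P σ) σ from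
    funext (ind_not P)]

lemma avg_iterate_ind_mono {P Q : RatioLaw.{u} → Prop} (h : ∀ σ, P σ → Q σ) (n : ℕ)
    (σ : RatioLaw.{u}) : avg^[n] (ind P) σ ≤ avg^[n] (ind Q) σ := by
  refine avg_iterate_mono (fun σ => ?_) n σ
  unfold ind
  by_cases hP : P σ
  · simp [hP, h σ hP]
  · simp only [hP, if_false]; split_ifs <;> norm_num

/-- Starting from a small moment, the proportion of synthetic laws whose moment exceeds `2 ^ (-M)`
is small. -/
lemma avg_iterate_moment_gt_le {t a₀ l : ℝ} (ht : 0 < t) (ha₀ : 1 < a₀) (hl0 : 0 < l)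
    (hl1 : l ≤ 1)
    (hc : ∀ a, a₀ ≤ a → ((a - 1) ^ (-t) + (2 * a) ^ (-t)) / 2 ≤ l * a ^ (-t))
    {s : ℝ} (hs0 : 0 < s) (hs1 : s ≤ 1) {M : ℝ} (hM : 0 < M) (k : ℕ) (σ : RatioLaw.{u}) {a : ℝ}
    (ha : 0 < a) (hσ : σ.moment s ≤ 2 ^ (-a)) :
    avg^[k] (ind fun σ => ¬ σ.moment s ≤ 2 ^ (-M)) σ ≤ (a₀ ^ t + M ^ t * l ^ k) * a ^ (-t) := by
  induction k generalizing σ a with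
  | zero =>
    simp only [Function.iterate_zero, id, pow_zero, mul_one]
    by_cases h : σ.moment s ≤ 2 ^ (-M)
    · simp only [ind, h, not_true, if_false]; positivity
    · simp only [ind, h, not_false_eq_true, if_true]
      have haM : a ≤ M := by
        by_contra! hlt
        exact h (hσ.trans (Real.rpow_le_rpow_of_exponent_le (by norm_num) (by linarith)))
      have h1 : a ^ t ≤ M ^ t := Real.rpow_le_rpow ha.le haM ht.le
      rw [Real.rpow_neg ha.le, ← div_eq_mul_inv, one_le_div (by positivity)]
      have : 0 < a₀ ^ t := by positivity
      linarith
  | succ k ih =>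
    -- Below `a₀` the contraction is unavailable, but the term `a₀ ^ t * a ^ (-t)` already exceeds
    -- one. Above it, minus costs one unit of the exponent `a` and plus doubles it.
    rcases lt_or_ge a a₀ with h | h
    · refine (avg_iterate_ind_le_one _ _ _).trans ?_
      have h1 : a ^ t ≤ a₀ ^ t := Real.rpow_le_rpow ha.le h.le ht.le
      rw [Real.rpow_neg ha.le, ← div_eq_mul_inv, one_le_div (by positivity)]
      have : 0 < M ^ t * l ^ (k + 1) := by positivity
      linarith
    · rw [avg_iterate_succ]
      have h1 := ih σ.minus (a := a - 1) (by linarith) (by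
        refine (σ.moment_minus_le hs0 hs1).trans ?_
        rw [show -(a - 1) = 1 + -a by ring, Real.rpow_add (by norm_num), Real.rpow_one]
        linarith)
      have h2 := ih σ.plus (a := 2 * a) (by linarith) (by
        rw [moment_plus, show -(2 * a) = -a * 2 by ring, Real.rpow_mul (by norm_num)]
        norm_cast
        exact pow_le_pow_left₀ (σ.moment_nonneg s) hσ 2)
      have h3 := hc a h
      have h4 : 0 < a ^ (-t) := by positivity
      have h5 : 0 ≤ a₀ ^ t := by positivity
      have h6 : 0 ≤ M ^ t * l ^ k := by positivity
      calc _ ≤ (a₀ ^ t + M ^ t * l ^ k) * (((a - 1) ^ (-t) + (2 * a) ^ (-t)) / 2) := by linarith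
        _ ≤ (a₀ ^ t + M ^ t * l ^ k) * (l * a ^ (-t)) := by gcongr
        _ = (a₀ ^ t * l + M ^ t * l ^ (k + 1)) * a ^ (-t) := by ring
        _ ≤ _ := by
          gcongr
          nlinarith

lemma exists_rpow_neg_mul_le {t K ε : ℝ} (ht : 0 < t) (hε : 0 < ε) :
    ∃ a : ℝ, 0 < a ∧ K * a ^ (-t) ≤ ε := by
  have h := (tendsto_rpow_neg_atTop ht).const_mul K
  rw [mul_zero] at h
  obtain ⟨a, ha1, ha2⟩ := ((h.eventually (gt_mem_nhds hε)).and (eventually_gt_atTop 0)).exists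
  exact ⟨a, ha2, ha1.le⟩

/-- Laws with some moment of order at most one below `θ`. -/
def SmallMoment (θ : ℝ) (σ : RatioLaw.{u}) : Prop := ∃ s, 0 < s ∧ s ≤ 1 ∧ σ.moment s < θ

/-- The bound `avg_iterate_moment_gt_le` with fixed target `M` is uniform in the number of steps
because `l ≤ 1`. The value `1/4` of `β` is an arbitrary admissible one. -/
lemma exists_smallMoment_stable {θ ε : ℝ} (hθ : 0 < θ) (hε : 0 < ε) : ∃ θ' : ℝ, 0 < θ' ∧
    ∀ σ : RatioLaw.{u}, SmallMoment θ' σ → ∀ k, 1 - ε ≤ avg^[k] (ind (SmallMoment θ)) σ := by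
  obtain ⟨t, a₀, l, ht, ha₀, hl0, hl1, -, hc⟩ :=
    exists_contraction (β := 1 / 4) (by norm_num) (by norm_num)
  obtain ⟨M, hM, hMθ⟩ : ∃ M : ℝ, 0 < M ∧ (2 : ℝ) ^ (-M) < θ := by
    refine ⟨max 1 (1 - Real.logb 2 θ), lt_max_of_lt_left one_pos, ?_⟩
    rw [← Real.lt_logb_iff_rpow_lt (by norm_num) hθ]
    linarith [le_max_right 1 (1 - Real.logb 2 θ)]
  obtain ⟨a, ha, hKa⟩ := exists_rpow_neg_mul_le (K := a₀ ^ t + M ^ t) ht hε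
  refine ⟨2 ^ (-a), by positivity, fun σ hσ k => ?_⟩
  obtain ⟨s, hs0, hs1, hs⟩ := hσ
  have h1 := avg_iterate_moment_gt_le ht ha₀ hl0 hl1 hc hs0 hs1 hM k σ ha hs.le
  have h2 : (a₀ ^ t + M ^ t * l ^ k) * a ^ (-t) ≤ ε := by
    refine le_trans ?_ hKa
    have : l ^ k ≤ 1 := pow_le_one₀ hl0.le hl1
    have : 0 < M ^ t := by positivity
    gcongr
    nlinarith
  have h3 := avg_iterate_ind_not (fun σ => σ.moment s ≤ 2 ^ (-M)) k σ
  have h4 := avg_iterate_ind_mono (P := fun σ => σ.moment s ≤ 2 ^ (-M)) (Q := SmallMoment θ)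
    (fun τ hτ => ⟨s, hs0, hs1, lt_of_le_of_lt hτ hMθ⟩) k σ
  linarith

/-- Fast polarization from a small moment. -/
lemma exists_fast {β ε : ℝ} (hβ0 : 0 < β) (hβ : β < 1 / 2) (hε : 0 < ε) : ∃ θ : ℝ, 0 < θ ∧
    ∀ s : ℝ, 0 < s → s ≤ 1 → ∀ m : ℕ, ∀ᶠ k : ℕ in atTop, ∀ σ : RatioLaw.{u}, σ.moment s < θ →
      1 - ε ≤ avg^[k] (ind fun σ => 1 - (2 : ℝ) ^ (-((2 : ℝ) ^ (m + k)) ^ β) ≤ σ.info) σ := by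
  obtain ⟨t, a₀, l, ht, ha₀, hl0, hl1, hlβ, hc⟩ := exists_contraction hβ0 hβ
  obtain ⟨a, ha, hKa⟩ := exists_rpow_neg_mul_le (K := a₀ ^ t + 1) ht hε
  refine ⟨2 ^ (-a), by positivity, fun s hs0 hs1 m => ?_⟩
  have hl2 : (0 : ℝ) < Real.log 2 := Real.log_pos (by norm_num)
  have hpow : ∀ k : ℕ, ((2 : ℝ) ^ (m + k)) ^ β = (2 ^ β) ^ m * (2 ^ β) ^ k := by
    intro k
    rw [← pow_add, ← Real.rpow_natCast, ← Real.rpow_natCast, ← Real.rpow_mul (by norm_num),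
      ← Real.rpow_mul (by norm_num), mul_comm]
  have hgrow : Tendsto (fun k : ℕ => ((2 : ℝ) ^ (m + k)) ^ β) atTop atTop := by
    simp only [hpow]
    refine Tendsto.const_mul_atTop (by positivity) (tendsto_pow_atTop_atTop_of_one_lt ?_)
    exact Real.one_lt_rpow (by norm_num) hβ0
  have hdec : Tendsto (fun k : ℕ => (2 * ((2 : ℝ) ^ (m + k)) ^ β) ^ t * l ^ k) atTop (nhds 0) := by
    have h1 : ∀ k : ℕ, (2 * ((2 : ℝ) ^ (m + k)) ^ β) ^ t * l ^ k =
        (2 ^ t * ((2 ^ β) ^ m) ^ t) * (l * 2 ^ (β * t)) ^ k := by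
      intro k
      rw [hpow, Real.mul_rpow (by norm_num) (by positivity),
        Real.mul_rpow (by positivity) (by positivity), mul_pow, Real.rpow_mul (by norm_num)]
      have : (((2 : ℝ) ^ β) ^ k) ^ t = (((2 : ℝ) ^ β) ^ t) ^ k := by
        rw [← Real.rpow_natCast (2 ^ β), ← Real.rpow_natCast ((2 ^ β) ^ t),
          ← Real.rpow_mul (by positivity), ← Real.rpow_mul (by positivity) t, mul_comm t]
      rw [this]; ring
    simp only [h1]
    rw [← mul_zero (2 ^ t * (((2 : ℝ) ^ β) ^ m) ^ t)]
    exact (tendsto_pow_atTop_nhds_zero_of_lt_one (by positivity) hlβ).const_mul _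
  filter_upwards [hgrow.eventually_ge_atTop (Real.logb 2 (1 / (s * Real.log 2))),
    hgrow.eventually_gt_atTop 0, hdec.eventually (gt_mem_nhds one_pos)] with k hk1 hk2 hk3 σ hσ
  set x := ((2 : ℝ) ^ (m + k)) ^ β
  -- The exponent `2 * x` instead of `x` absorbs the constant `1 / (s * log 2)` lost in passing from
  -- the moment to the log-loss.
  have h1 := avg_iterate_moment_gt_le ht ha₀ hl0 hl1 hc hs0 hs1 (M := 2 * x) (by positivity)
    k σ ha hσ.le
  have h2 : (a₀ ^ t + (2 * x) ^ t * l ^ k) * a ^ (-t) ≤ ε := by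
    refine le_trans ?_ hKa
    gcongr
  have h3 := avg_iterate_ind_not (fun σ => σ.moment s ≤ 2 ^ (-(2 * x))) k σ
  have h4 := avg_iterate_ind_mono (P := fun σ => σ.moment s ≤ 2 ^ (-(2 * x)))
    (Q := fun σ => 1 - (2 : ℝ) ^ (-x) ≤ σ.info) (fun τ hτ => by
      have h5 := τ.logLoss_le_moment hs0 hs1
      have h6 : 1 / (s * Real.log 2) ≤ 2 ^ x := by
        rwa [Real.logb_le_iff_le_rpow (by norm_num) (by positivity)] at hk1
      have h7 : τ.moment s / (s * Real.log 2) ≤ 2 ^ (-(2 * x)) * 2 ^ x := by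
        rw [div_eq_mul_one_div]
        exact mul_le_mul hτ h6 (by positivity) (by positivity)
      rw [← Real.rpow_add (by norm_num), show -(2 * x) + x = -x by ring] at h7
      unfold info
      linarith) k σ
  linarith

lemma moment_plus_iterate (s : ℝ) (k : ℕ) (σ : RatioLaw.{u}) :
    (plus^[k] σ).moment s = σ.moment s ^ 2 ^ k := by
  induction k with
  | zero => simp
  | succ k ih => rw [Function.iterate_succ_apply', moment_plus, ih, ← pow_mul, pow_succ]

lemma Superharmonic.plus_iterate_le {f : RatioLaw.{u} → ℝ} (hf : Superharmonic f)
    (h0 : ∀ σ, 0 ≤ f σ) (k : ℕ) (σ : RatioLaw.{u}) : f (plus^[k] σ) / 2 ^ k ≤ f σ := by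
  induction k with
  | zero => simp
  | succ k ih =>
    refine le_trans ?_ ih
    rw [Function.iterate_succ_apply', pow_succ', ← div_div]
    gcongr
    have h1 := hf (plus^[k] σ)
    have h2 := h0 (plus^[k] σ).minus
    unfold avg at h1
    linarith

/-- The asymptotic proportion of synthetic laws with a small moment. -/
def goodLimit (θ : ℝ) (σ : RatioLaw.{u}) : ℝ :=
  liminf (fun n => avg^[n] (ind (SmallMoment θ)) σ) atTop

lemma goodLimit_le_of_lt {θ x : ℝ} {σ : RatioLaw.{u}}
    (h : ∀ y < x, ∀ᶠ n in atTop, y ≤ avg^[n] (ind (SmallMoment θ)) σ) : x ≤ goodLimit θ σ := by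
  refine le_of_forall_lt fun y hy => ?_
  obtain ⟨z, hyz, hzx⟩ := exists_between hy
  refine lt_of_lt_of_le hyz (le_liminf_of_le ?_ (h z hzx))
  exact isCoboundedUnder_ge_of_le _ fun n => avg_iterate_ind_le_one _ n σ

lemma eventually_of_lt_goodLimit {θ x : ℝ} {σ : RatioLaw.{u}} (h : x < goodLimit θ σ) :
    ∀ᶠ n in atTop, x < avg^[n] (ind (SmallMoment θ)) σ := by
  refine eventually_lt_of_lt_liminf h ?_
  exact isBoundedUnder_of ⟨0, fun n => avg_iterate_ind_nonneg _ n σ⟩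

lemma goodLimit_nonneg (θ : ℝ) (σ : RatioLaw.{u}) : 0 ≤ goodLimit θ σ :=
  goodLimit_le_of_lt fun _ hy =>
    Eventually.of_forall fun n => hy.le.trans (avg_iterate_ind_nonneg _ n σ)

/-- The lower limit is superadditive, and shifting the number of steps by one does not change it. -/
lemma superharmonic_goodLimit (θ : ℝ) : Superharmonic (goodLimit.{u} θ) := by
  intro σ
  refine goodLimit_le_of_lt fun y hy => ?_
  unfold avg at hy
  set δ := (goodLimit θ σ.minus + goodLimit θ σ.plus) / 2 - y with hδ
  have h1 := eventually_of_lt_goodLimit (show goodLimit θ σ.minus - δ < goodLimit θ σ.minus by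
    linarith)
  have h2 := eventually_of_lt_goodLimit (show goodLimit θ σ.plus - δ < goodLimit θ σ.plus by
    linarith)
  rw [← Filter.map_add_atTop_eq_nat 1, eventually_map]
  filter_upwards [h1, h2] with n h1 h2
  rw [avg_iterate_succ]
  linarith

/-- The asymptotic proportion of synthetic laws with a small moment is at least the information. -/
lemma info_le_goodLimit {θ : ℝ} (hθ : 0 < θ) (σ : RatioLaw.{u}) : σ.info ≤ goodLimit θ σ := by
  have main : ∀ ε γ : ℝ, 0 < ε → ε < 1 → 0 < γ → ∀ σ : RatioLaw.{u},
      (1 - ε) * (σ.info - γ) ≤ goodLimit θ σ := by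
    intro ε γ hε hε1 hγ
    obtain ⟨θ', hθ', hstab⟩ := exists_smallMoment_stable.{u} hθ hε
    obtain ⟨ρ, hρ0, hρ1, hρ⟩ := exists_superharmonic_bound.{u} hγ
    obtain ⟨k, hk⟩ : ∃ k : ℕ, (31 / 32 : ℝ) ^ 2 ^ k < θ' := by
      have h1 : Tendsto (fun j : ℕ => (31 / 32 : ℝ) ^ 2 ^ j) atTop (nhds 0) :=
        (tendsto_pow_atTop_nhds_zero_of_lt_one (by norm_num) (by norm_num)).comp
          (tendsto_pow_atTop_atTop_of_one_lt (by norm_num))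
      exact (h1.eventually (gt_mem_nhds hθ')).exists
    set τ : ℝ := ρ / 2 ^ k with hτ
    have h2k : (1 : ℝ) ≤ 2 ^ k := one_le_pow₀ (by norm_num)
    have hτ0 : 0 < τ := by positivity
    have hτ1 : τ ≤ 1 := (div_le_self hρ0.le h2k).trans hρ1
    have step : ∀ r : ℕ, ∀ σ : RatioLaw.{u},
        (1 - ε) * (1 - (1 - τ) ^ r) * (σ.info - γ) ≤ goodLimit θ σ := by
      intro r
      induction r with
      | zero => intro σ; simpa using goodLimit_nonneg θ σ
      | succ r ih =>
        intro σ
        set q := (1 - τ) ^ r with hq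
        have hq0 : 0 ≤ q := pow_nonneg (by linarith) r
        have hq1 : q ≤ 1 := pow_le_one₀ (by linarith) (by linarith)
        have hq' : (1 - τ) ^ (r + 1) = q * (1 - τ) := pow_succ _ _
        rw [hq']
        rcases lt_or_ge σ.info γ with hlt | hge
        · refine le_trans (mul_nonpos_of_nonneg_of_nonpos ?_ (by linarith)) (goodLimit_nonneg θ σ)
          have : q * (1 - τ) ≤ 1 := by nlinarith
          exact mul_nonneg (by linarith) (by linarith)
        -- Information is harmonic, so subtracting the bound of the previous round keeps
        -- superharmonicity; that bound is also what makes the difference nonnegative.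
        · have hf : Superharmonic fun σ : RatioLaw.{u} =>
              goodLimit θ σ - (1 - ε) * (1 - q) * (σ.info - γ) := by
            intro σ
            have h1 := superharmonic_goodLimit θ σ
            have h2 := σ.info_minus_add_plus
            have h3 : (1 - ε) * (1 - q) * (σ.minus.info + σ.plus.info) =
                (1 - ε) * (1 - q) * (2 * σ.info) := by rw [h2]
            simp only [avg] at h1 ⊢
            linarith
          have hf0 : ∀ σ : RatioLaw.{u},
              0 ≤ goodLimit θ σ - (1 - ε) * (1 - q) * (σ.info - γ) := fun σ => by
            linarith [ih σ]
          have hd0 : 0 ≤ (1 - ε) * q / 2 ^ k :=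
            div_nonneg (mul_nonneg (by linarith) hq0) (by positivity)
          -- From a half-good law, `k` plus steps bring a moment below `θ'`, where `goodLimit` is at
          -- least `1 - ε` and the subtracted term at most `(1 - ε) * (1 - q)`. The gain shrinks the
          -- remaining gap `q` by the factor `1 - τ`.
          have h := hρ _ hf hf0 ((1 - ε) * q / 2 ^ k) hd0 (fun τ hτ => by
            refine le_trans ?_ (hf.plus_iterate_le hf0 k τ)
            gcongr
            obtain ⟨s, hs0, hs1, hs⟩ := hτ
            have h1 : SmallMoment θ' (plus^[k] τ) := by
              refine ⟨s, hs0, hs1, ?_⟩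
              rw [moment_plus_iterate]
              exact (pow_le_pow_left₀ (τ.moment_nonneg s) hs _).trans_lt hk
            have h2 : 1 - ε ≤ goodLimit θ (plus^[k] τ) :=
              goodLimit_le_of_lt fun y hy => Eventually.of_forall fun n =>
                hy.le.trans (hstab _ h1 n)
            have h3 := (plus^[k] τ).info_le_one
            have h4 : 0 ≤ (1 - ε) * (1 - q) := mul_nonneg (by linarith) (by linarith)
            nlinarith) σ hge
          have h5 : ρ * ((1 - ε) * q / 2 ^ k) = (1 - ε) * q * τ := by rw [hτ]; ring
          rw [h5] at h
          have h6 : 0 ≤ (1 - ε) * q * τ := by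
            have : 0 ≤ 1 - ε := by linarith
            positivity
          have h7 := σ.info_le_one
          nlinarith [mul_le_mul_of_nonneg_left (show σ.info - γ ≤ 1 by linarith) h6]
    intro σ
    have hlim : Tendsto (fun r : ℕ => (1 - ε) * (1 - (1 - τ) ^ r) * (σ.info - γ)) atTop
        (nhds ((1 - ε) * (1 - 0) * (σ.info - γ))) :=
      (((tendsto_pow_atTop_nhds_zero_of_lt_one (by linarith) (by linarith)).const_sub
        _).const_mul _).mul_const _
    have := le_of_tendsto' hlim fun r => step r σ
    simpa using this
  have hlim : Tendsto (fun n : ℕ => (1 - 1 / ((n : ℝ) + 2)) * (σ.info - 1 / ((n : ℝ) + 2))) atTop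
      (nhds ((1 - 0) * (σ.info - 0))) := by
    have h0 : Tendsto (fun n : ℕ => 1 / ((n : ℝ) + 2)) atTop (nhds 0) := by
      simp_rw [one_div]
      exact tendsto_inv_atTop_zero.comp
        (tendsto_atTop_add_const_right _ _ tendsto_natCast_atTop_atTop)
    exact (h0.const_sub _).mul (h0.const_sub _)
  have := le_of_tendsto' hlim fun n => main (1 / ((n : ℝ) + 2)) (1 / ((n : ℝ) + 2))
    (by positivity) (by rw [div_lt_one (by positivity)]; linarith [n.cast_nonneg (α := ℝ)])
    (by positivity) σ
  simpa using this

end RatioLaw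

/-! ### Recursive structure of the polar transform and of its likelihood ratios -/

section Split

variable {Y : Type u}

/-- The two halves of a block. -/
def halfSumEquiv (n : ℕ) : Fin (2 ^ n) ⊕ Fin (2 ^ n) ≃ Fin (2 ^ (n + 1)) :=
  finSumFinEquiv.trans (finCongr (by rw [pow_succ]; ring))

lemma halfSumEquiv_inl (n : ℕ) (j : Fin (2 ^ n)) : (halfSumEquiv n (Sum.inl j)).1 = j.1 := by
  simp [halfSumEquiv]

lemma halfSumEquiv_inr (n : ℕ) (j : Fin (2 ^ n)) :
    (halfSumEquiv n (Sum.inr j)).1 = 2 ^ n + j.1 := by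
  simp [halfSumEquiv, add_comm]

/-- A block of outputs as the pair of its halves. -/
def splitOutput (n : ℕ) :
    (Fin (2 ^ (n + 1)) → Y) ≃ (Fin (2 ^ n) → Y) × (Fin (2 ^ n) → Y) :=
  ((halfSumEquiv n).arrowCongr (Equiv.refl Y)).symm.trans (Equiv.sumArrowEquivProdArrow _ _ _)

/-- The index `2 * k`. -/
def evenIdx {n : ℕ} (k : Fin (2 ^ n)) : Fin (2 ^ (n + 1)) :=
  ⟨2 * k.1, by have := k.2; have := pow_succ 2 n; omega⟩

/-- The index `2 * k + 1`. -/
def oddIdx {n : ℕ} (k : Fin (2 ^ n)) : Fin (2 ^ (n + 1)) :=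
  ⟨2 * k.1 + 1, by have := k.2; have := pow_succ 2 n; omega⟩

/-- The index `i / 2`. -/
def halfIdx {n : ℕ} (i : Fin (2 ^ (n + 1))) : Fin (2 ^ n) :=
  ⟨i.1 / 2, by have := i.2; have := pow_succ 2 n; omega⟩

lemma zmod_two_add_add (a b : ZMod 2) : a + b + b = a := by revert a b; decide

/-- An input block as the pair of inputs of the two half-length polar transforms. -/
def splitInput (n : ℕ) : (Fin (2 ^ (n + 1)) → ZMod 2) ≃
    (Fin (2 ^ n) → ZMod 2) × (Fin (2 ^ n) → ZMod 2) where
  toFun u := (fun k => u (evenIdx k) + u (oddIdx k), fun k => u (oddIdx k))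
  invFun p := fun i =>
    if i.1 % 2 = 0 then p.1 (halfIdx i) + p.2 (halfIdx i) else p.2 (halfIdx i)
  left_inv u := by
    funext i
    by_cases h : i.1 % 2 = 0
    · have h1 : evenIdx (halfIdx i) = i := Fin.ext (by simp only [evenIdx, halfIdx]; omega)
      simp only [h, if_true, h1]
      exact zmod_two_add_add _ _
    · have h1 : oddIdx (halfIdx i) = i := Fin.ext (by simp only [oddIdx, halfIdx]; omega)
      simp only [h, if_false, h1]
  right_inv p := by
    have h0 : ∀ k : Fin (2 ^ n), halfIdx (evenIdx k) = k := fun k =>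
      Fin.ext (by simp only [evenIdx, halfIdx]; omega)
    have h1 : ∀ k : Fin (2 ^ n), halfIdx (oddIdx k) = k := fun k =>
      Fin.ext (by simp only [oddIdx, halfIdx]; omega)
    have h2 : ∀ k : Fin (2 ^ n), (evenIdx k).1 % 2 = 0 := fun k => by simp [evenIdx]
    have h3 : ∀ k : Fin (2 ^ n), ¬ (oddIdx k).1 % 2 = 0 := fun k => by
      simp only [oddIdx]; omega
    refine Prod.ext ?_ ?_
    · funext k
      simp only [h0, h1, h2, h3, if_true, if_false]
      exact zmod_two_add_add _ _
    · funext k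
      simp only [h1, h3, if_false]

lemma blockLaw_succ (W : ZMod 2 → Y → ℝ) (n : ℕ) (u : Fin (2 ^ (n + 1)) → ZMod 2)
    (y : Fin (2 ^ (n + 1)) → Y) : blockLaw W (n + 1) u y =
      blockLaw W n (splitInput n u).1 (splitOutput n y).1 *
        blockLaw W n (splitInput n u).2 (splitOutput n y).2 := by
  unfold blockLaw
  rw [← (halfSumEquiv n).prod_comp, Fintype.prod_sum_type]
  congr 1
  · refine Finset.prod_congr rfl fun j _ => ?_
    have h : polarEncode (n + 1) u (halfSumEquiv n (Sum.inl j)) =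
        polarEncode n (splitInput n u).1 j := by
      have hj := halfSumEquiv_inl n j
      have hlt : (halfSumEquiv n (Sum.inl j)).1 < 2 ^ n := by rw [hj]; exact j.2
      simp only [polarEncode, hlt, dif_pos]
      congr 1
    rw [h]; rfl
  · refine Finset.prod_congr rfl fun j _ => ?_
    have h : polarEncode (n + 1) u (halfSumEquiv n (Sum.inr j)) =
        polarEncode n (splitInput n u).2 j := by
      have hj := halfSumEquiv_inr n j
      have hlt : ¬ (halfSumEquiv n (Sum.inr j)).1 < 2 ^ n := by rw [hj]; omega
      simp only [polarEncode, hlt, dif_neg, not_false_eq_true]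
      congr 1
      exact Fin.ext (by simp [hj])
    rw [h]; rfl

lemma blockLaw_nonneg {W : ZMod 2 → Y → ℝ} (hW : ∀ x y, 0 ≤ W x y) (n : ℕ)
    (u : Fin (2 ^ n) → ZMod 2) (y : Fin (2 ^ n) → Y) : 0 ≤ blockLaw W n u y :=
  Finset.prod_nonneg fun _ _ => hW _ _

lemma blockLaw_ne_zero {W V : ZMod 2 → Y → ℝ} (h : ∀ x y, V x y = 0 → W x y = 0) {n : ℕ}
    {u : Fin (2 ^ n) → ZMod 2} {y : Fin (2 ^ n) → Y} (hW : blockLaw W n u y ≠ 0) :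
    blockLaw V n u y ≠ 0 := by
  unfold blockLaw at *
  rw [Finset.prod_ne_zero_iff] at *
  exact fun j hj h0 => hW j hj (h _ _ h0)

/-- The total block law of the inputs which agree with `u` before `i` and take the value `x`
there. -/
def cylinderLaw (V : ZMod 2 → Y → ℝ) (n : ℕ) (i : Fin (2 ^ n)) (x : ZMod 2)
    (u : Fin (2 ^ n) → ZMod 2) (y : Fin (2 ^ n) → Y) : ℝ :=
  open scoped Classical in
  ∑ v : Fin (2 ^ n) → ZMod 2, if v i = x ∧ ∀ j < i, v j = u j then blockLaw V n v y else 0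

/-- The restriction of `u` to the indices before `i`. -/
def prefixOf {n : ℕ} (i : Fin (2 ^ n)) (u : Fin (2 ^ n) → ZMod 2) : Fin i.1 → ZMod 2 :=
  fun j => u ⟨j.1, j.2.trans i.2⟩

lemma synthChannel_prefixOf (V : ZMod 2 → Y → ℝ) (n : ℕ) (i : Fin (2 ^ n)) (x : ZMod 2)
    (u : Fin (2 ^ n) → ZMod 2) (y : Fin (2 ^ n) → Y) :
    synthChannel V n i x (y, prefixOf i u) = cylinderLaw V n i x u y / 2 ^ (2 ^ n - 1) := by
  unfold synthChannel cylinderLaw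
  rw [Finset.sum_div]
  refine Finset.sum_congr rfl fun v _ => ?_
  have : (∀ j : Fin i.1, v ⟨j.1, j.2.trans i.2⟩ = prefixOf i u j) ↔ ∀ j < i, v j = u j :=
    ⟨fun h j hj => h ⟨j.1, hj⟩, fun h j => h _ j.2⟩
  simp only [this]
  split_ifs <;> simp

lemma cylinderLaw_nonneg {V : ZMod 2 → Y → ℝ} (hV : ∀ x y, 0 ≤ V x y) (n : ℕ)
    (i : Fin (2 ^ n)) (x : ZMod 2) (u : Fin (2 ^ n) → ZMod 2) (y : Fin (2 ^ n) → Y) :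
    0 ≤ cylinderLaw V n i x u y := by
  refine Finset.sum_nonneg fun v _ => ?_
  split_ifs
  exacts [blockLaw_nonneg hV n v y, le_rfl]

lemma blockLaw_le_cylinderLaw {V : ZMod 2 → Y → ℝ} (hV : ∀ x y, 0 ≤ V x y) (n : ℕ)
    (i : Fin (2 ^ n)) (u : Fin (2 ^ n) → ZMod 2) (y : Fin (2 ^ n) → Y) :
    blockLaw V n u y ≤ cylinderLaw V n i (u i) u y := by
  classical
  have := Finset.single_le_sum (s := Finset.univ) (a := u)
    (f := fun v => if v i = u i ∧ ∀ j < i, v j = u j then blockLaw V n v y else 0)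
    (fun v _ => by
      split_ifs
      exacts [blockLaw_nonneg hV n v y, le_rfl]) (Finset.mem_univ u)
  simp only [true_and, implies_true, if_true] at this
  refine this.trans (le_of_eq ?_)
  unfold cylinderLaw
  exact Finset.sum_congr rfl fun v _ => by congr

lemma lt_evenIdx_iff {n : ℕ} (k : Fin (2 ^ n)) (u v : Fin (2 ^ (n + 1)) → ZMod 2) :
    (∀ j < evenIdx k, v j = u j) ↔
      (∀ j < k, (splitInput n v).1 j = (splitInput n u).1 j) ∧
      ∀ j < k, (splitInput n v).2 j = (splitInput n u).2 j := by
  have key : ∀ a b c d : ZMod 2, a + b = c + d → b = d → a = c := by decide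
  constructor
  · intro h
    have h0 : ∀ j < k, v (evenIdx j) = u (evenIdx j) := fun j hj => h _ (by
      have : j.1 < k.1 := hj
      exact Fin.lt_def.2 (by simp only [evenIdx]; omega))
    have h1 : ∀ j < k, v (oddIdx j) = u (oddIdx j) := fun j hj => h _ (by
      have : j.1 < k.1 := hj
      exact Fin.lt_def.2 (by simp only [evenIdx, oddIdx]; omega))
    exact ⟨fun j hj => by simp only [splitInput, Equiv.coe_fn_mk, h0 j hj, h1 j hj],
      fun j hj => h1 j hj⟩
  · rintro ⟨h0, h1⟩ j hj
    have hj' : j.1 < 2 * k.1 := hj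
    have hlt : halfIdx j < k := Fin.lt_def.2 (by simp only [halfIdx]; omega)
    have h3 : v (oddIdx (halfIdx j)) = u (oddIdx (halfIdx j)) := h1 _ hlt
    by_cases h : j.1 % 2 = 0
    · have h2 : evenIdx (halfIdx j) = j := Fin.ext (by simp only [evenIdx, halfIdx]; omega)
      have h4 := key _ _ _ _ (h0 _ hlt) h3
      rwa [h2] at h4
    · have h2 : oddIdx (halfIdx j) = j := Fin.ext (by simp only [oddIdx, halfIdx]; omega)
      rwa [h2] at h3

lemma lt_oddIdx_iff {n : ℕ} (k : Fin (2 ^ n)) (u v : Fin (2 ^ (n + 1)) → ZMod 2) :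
    (∀ j < oddIdx k, v j = u j) ↔
      v (evenIdx k) = u (evenIdx k) ∧ ∀ j < evenIdx k, v j = u j := by
  constructor
  · intro h
    exact ⟨h _ (Fin.lt_def.2 (by simp [evenIdx, oddIdx])), fun j hj => h j (by
      have : j.1 < 2 * k.1 := hj
      exact Fin.lt_def.2 (by simp only [oddIdx]; omega))⟩
  · rintro ⟨h0, h1⟩ j hj
    have hj' : j.1 < 2 * k.1 + 1 := hj
    rcases Nat.lt_or_ge j.1 (2 * k.1) with h | h
    · exact h1 j h
    · have : j = evenIdx k := Fin.ext (by simp only [evenIdx]; omega)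
      rw [this, h0]

lemma ite_and_mul_ite {A B C D : Prop} [Decidable ((A ∧ D) ∧ B ∧ C)] [Decidable (A ∧ B)]
    [Decidable (D ∧ C)] (p q : ℝ) : (if (A ∧ D) ∧ B ∧ C then p * q else 0) =
      (if A ∧ B then p else 0) * if D ∧ C then q else 0 := by
  by_cases hA : A <;> by_cases hB : B <;> by_cases hC : C <;> by_cases hD : D <;>
    simp [hA, hB, hC, hD]

/-- The next bit `u (oddIdx k)` is still unknown, so the product of the two half-block laws is
summed over its value `t`. -/
lemma cylinderLaw_evenIdx (V : ZMod 2 → Y → ℝ) (n : ℕ) (k : Fin (2 ^ n)) (x : ZMod 2)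
    (u : Fin (2 ^ (n + 1)) → ZMod 2) (y : Fin (2 ^ (n + 1)) → Y) :
    cylinderLaw V (n + 1) (evenIdx k) x u y =
      ∑ t : ZMod 2, cylinderLaw V n k (x + t) (splitInput n u).1 (splitOutput n y).1 *
        cylinderLaw V n k t (splitInput n u).2 (splitOutput n y).2 := by
  classical
  unfold cylinderLaw
  simp only [Finset.sum_mul_sum]
  rw [Finset.sum_comm, ← (splitInput n).symm.sum_comp, Fintype.sum_prod_type]
  refine Finset.sum_congr rfl fun a _ => ?_
  rw [Finset.sum_comm]
  refine Finset.sum_congr rfl fun b _ => ?_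
  -- Once the second half-input `b` is fixed, only `t = b k` contributes.
  rw [Finset.sum_eq_single (b k)]
  · have h1 : (splitInput n).symm (a, b) (evenIdx k) = a k + b k := by
      have h2 : a k = ((splitInput n) ((splitInput n).symm (a, b))).1 k := by
        rw [Equiv.apply_symm_apply]
      have h3 : b k = ((splitInput n) ((splitInput n).symm (a, b))).2 k := by
        rw [Equiv.apply_symm_apply]
      rw [h2, h3]
      exact (zmod_two_add_add _ _).symm
    have h4 : a k + b k = x ↔ a k = x + b k := by
      generalize a k = p, b k = q
      revert p q x; decide
    have h5 : ((splitInput n).symm (a, b) (evenIdx k) = x ∧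
        ∀ j < evenIdx k, (splitInput n).symm (a, b) j = u j) ↔ (a k = x + b k ∧ b k = b k) ∧
        (∀ j < k, a j = (splitInput n u).1 j) ∧ ∀ j < k, b j = (splitInput n u).2 j := by
      rw [lt_evenIdx_iff, Equiv.apply_symm_apply, h1, h4, and_iff_left (a := a k = x + b k) rfl]
    rw [if_congr h5 rfl rfl, blockLaw_succ, Equiv.apply_symm_apply]
    exact ite_and_mul_ite _ _
  · intro t _ ht
    rw [if_neg (c := b k = t ∧ _) (fun h => ht h.1.symm), mul_zero]
  · simp

lemma cylinderLaw_oddIdx (V : ZMod 2 → Y → ℝ) (n : ℕ) (k : Fin (2 ^ n)) (x : ZMod 2)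
    (u : Fin (2 ^ (n + 1)) → ZMod 2) (y : Fin (2 ^ (n + 1)) → Y) :
    cylinderLaw V (n + 1) (oddIdx k) x u y =
      cylinderLaw V n k (u (evenIdx k) + x) (splitInput n u).1 (splitOutput n y).1 *
        cylinderLaw V n k x (splitInput n u).2 (splitOutput n y).2 := by
  classical
  unfold cylinderLaw
  rw [Finset.sum_mul_sum, ← (splitInput n).symm.sum_comp, Fintype.sum_prod_type]
  refine Finset.sum_congr rfl fun a _ => Finset.sum_congr rfl fun b _ => ?_
  have h3 : (splitInput n).symm (a, b) (oddIdx k) = b k := by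
    have : b k = ((splitInput n) ((splitInput n).symm (a, b))).2 k := by
      rw [Equiv.apply_symm_apply]
    rw [this]; rfl
  have h1 : (splitInput n).symm (a, b) (evenIdx k) = a k + b k := by
    have h2 : a k = ((splitInput n) ((splitInput n).symm (a, b))).1 k := by
      rw [Equiv.apply_symm_apply]
    rw [h2, ← h3]
    exact (zmod_two_add_add _ _).symm
  have h4 : (b k = x ∧ a k + b k = u (evenIdx k)) ↔ (a k = u (evenIdx k) + x ∧ b k = x) := by
    generalize a k = p, b k = q, u (evenIdx k) = r
    revert p q x r; decide
  have h5 : ((splitInput n).symm (a, b) (oddIdx k) = x ∧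
      ∀ j < oddIdx k, (splitInput n).symm (a, b) j = u j) ↔
      (a k = u (evenIdx k) + x ∧ b k = x) ∧
      (∀ j < k, a j = (splitInput n u).1 j) ∧ ∀ j < k, b j = (splitInput n u).2 j := by
    rw [lt_oddIdx_iff, lt_evenIdx_iff, Equiv.apply_symm_apply, h1, h3, ← and_assoc, h4]
  simp only [blockLaw_succ, h5, Equiv.apply_symm_apply]
  exact ite_and_mul_ite _ _

/-- The likelihood ratio of the `i`-th synthetic channel along an input and an output block. -/
def blockRatio (V : ZMod 2 → Y → ℝ) (n : ℕ) (i : Fin (2 ^ n)) (u : Fin (2 ^ n) → ZMod 2)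
    (y : Fin (2 ^ n) → Y) : ℝ :=
  cylinderLaw V n i (u i + 1) u y / cylinderLaw V n i (u i) u y

lemma zmod_two_sum (f : ZMod 2 → ℝ) (t : ZMod 2) : ∑ x, f x = f t + f (t + 1) := by
  have h : ∑ x, f x = f 0 + f 1 := Fin.sum_univ_two f
  have ht : t = 0 ∨ t = 1 := by revert t; decide
  rcases ht with rfl | rfl
  · rw [zero_add, h]
  · rw [show (1 : ZMod 2) + 1 = 0 by decide, h, add_comm]

lemma blockRatio_evenIdx {V : ZMod 2 → Y → ℝ} (hV : ∀ x y, 0 ≤ V x y) (n : ℕ)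
    (k : Fin (2 ^ n)) (u : Fin (2 ^ (n + 1)) → ZMod 2) (y : Fin (2 ^ (n + 1)) → Y)
    (h : blockLaw V (n + 1) u y ≠ 0) :
    blockRatio V (n + 1) (evenIdx k) u y =
      RatioLaw.checkOp (blockRatio V n k (splitInput n u).1 (splitOutput n y).1)
        (blockRatio V n k (splitInput n u).2 (splitOutput n y).2) := by
  rw [blockLaw_succ, mul_ne_zero_iff] at h
  unfold blockRatio
  rw [cylinderLaw_evenIdx, cylinderLaw_evenIdx, zmod_two_sum _ ((splitInput n u).2 k),
    zmod_two_sum _ ((splitInput n u).2 k)]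
  have e1 : u (evenIdx k) + (splitInput n u).2 k = (splitInput n u).1 k := rfl
  have e2 : u (evenIdx k) + ((splitInput n u).2 k + 1) = (splitInput n u).1 k + 1 := by
    rw [← e1]; ring
  have e3 : u (evenIdx k) + 1 + (splitInput n u).2 k = (splitInput n u).1 k + 1 := by
    rw [← e1]; ring
  have e4 : u (evenIdx k) + 1 + ((splitInput n u).2 k + 1) = (splitInput n u).1 k := by
    rw [← e1]
    generalize u (evenIdx k) = p, (splitInput n u).2 k = q
    revert p q; decide
  rw [e1, e2, e3, e4]
  have p1 := ((blockLaw_nonneg hV n _ _).lt_of_ne' h.1).trans_le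
    (blockLaw_le_cylinderLaw hV n k (splitInput n u).1 (splitOutput n y).1)
  have p2 := ((blockLaw_nonneg hV n _ _).lt_of_ne' h.2).trans_le
    (blockLaw_le_cylinderLaw hV n k (splitInput n u).2 (splitOutput n y).2)
  have p3 := cylinderLaw_nonneg hV n k ((splitInput n u).1 k + 1) (splitInput n u).1
    (splitOutput n y).1
  have p4 := cylinderLaw_nonneg hV n k ((splitInput n u).2 k + 1) (splitInput n u).2
    (splitOutput n y).2
  unfold RatioLaw.checkOp
  generalize cylinderLaw V n k ((splitInput n u).1 k) (splitInput n u).1 (splitOutput n y).1 = a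
    at *
  generalize cylinderLaw V n k ((splitInput n u).2 k) (splitInput n u).2 (splitOutput n y).2 = b
    at *
  generalize cylinderLaw V n k ((splitInput n u).1 k + 1) (splitInput n u).1
    (splitOutput n y).1 = a' at *
  generalize cylinderLaw V n k ((splitInput n u).2 k + 1) (splitInput n u).2
    (splitOutput n y).2 = b' at *
  have : 0 < a * b + a' * b' := by positivity
  have : 0 < 1 + a' / a * (b' / b) := by positivity
  field_simp

/-- Unlike the even case this needs no positivity, since division by zero is compatible with
products of quotients. -/
lemma blockRatio_oddIdx (V : ZMod 2 → Y → ℝ) (n : ℕ)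
    (k : Fin (2 ^ n)) (u : Fin (2 ^ (n + 1)) → ZMod 2) (y : Fin (2 ^ (n + 1)) → Y) :
    blockRatio V (n + 1) (oddIdx k) u y =
      blockRatio V n k (splitInput n u).1 (splitOutput n y).1 *
        blockRatio V n k (splitInput n u).2 (splitOutput n y).2 := by
  unfold blockRatio
  rw [cylinderLaw_oddIdx, cylinderLaw_oddIdx]
  have e1 : u (evenIdx k) + u (oddIdx k) = (splitInput n u).1 k := rfl
  have e2 : u (evenIdx k) + (u (oddIdx k) + 1) = (splitInput n u).1 k + 1 := by
    rw [← e1]; ring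
  rw [e1, e2, div_mul_div_comm]
  rfl

end Split

/-! ### Block averages and the ratio laws of the synthetic channels -/

section Link

variable {Y : Type u} [Fintype Y]

/-- The law of the likelihood ratio of `V` under uniform inputs to `W`. -/
def ratioLaw (W V : ZMod 2 → Y → ℝ) (hW : IsChannel W) (hV : ∀ x y, 0 ≤ V x y) :
    RatioLaw.{u} where
  ι := ZMod 2 × Y
  w := fun i => W i.1 i.2 / 2
  L := fun i => V (i.1 + 1) i.2 / V i.1 i.2
  w_nonneg := fun i => div_nonneg (hW.1 _ _) (by norm_num)
  w_sum := by
    rw [Fintype.sum_prod_type]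
    simp only [← Finset.sum_div, hW.2]
    simp
  L_nonneg := fun i => div_nonneg (hV _ _) (hV _ _)

/-- Expectation over a uniform input block and the corresponding outputs of `W`. -/
def blockMean (W : ZMod 2 → Y → ℝ) (n : ℕ)
    (F : (Fin (2 ^ n) → ZMod 2) → (Fin (2 ^ n) → Y) → ℝ) : ℝ :=
  ∑ u, ∑ y, blockLaw W n u y / 2 ^ 2 ^ n * F u y

lemma blockMean_congr {W : ZMod 2 → Y → ℝ} {n : ℕ}
    {F G : (Fin (2 ^ n) → ZMod 2) → (Fin (2 ^ n) → Y) → ℝ}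
    (h : ∀ u y, blockLaw W n u y ≠ 0 → F u y = G u y) : blockMean W n F = blockMean W n G := by
  refine Finset.sum_congr rfl fun u _ => Finset.sum_congr rfl fun y _ => ?_
  by_cases h0 : blockLaw W n u y = 0
  · simp [h0]
  · rw [h u y h0]

lemma blockMean_mono {W : ZMod 2 → Y → ℝ} (hW : ∀ x y, 0 ≤ W x y) {n : ℕ}
    {F G : (Fin (2 ^ n) → ZMod 2) → (Fin (2 ^ n) → Y) → ℝ}
    (h : ∀ u y, blockLaw W n u y ≠ 0 → F u y ≤ G u y) : blockMean W n F ≤ blockMean W n G := by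
  refine Finset.sum_le_sum fun u _ => Finset.sum_le_sum fun y _ => ?_
  have hb := blockLaw_nonneg hW n u y
  by_cases h0 : blockLaw W n u y = 0
  · simp [h0]
  · exact mul_le_mul_of_nonneg_left (h u y h0) (by positivity)

lemma blockMean_sub (W : ZMod 2 → Y → ℝ) (n : ℕ)
    (F G : (Fin (2 ^ n) → ZMod 2) → (Fin (2 ^ n) → Y) → ℝ) :
    blockMean W n (fun u y => F u y - G u y) = blockMean W n F - blockMean W n G := by
  simp [blockMean, mul_sub, Finset.sum_sub_distrib]

lemma blockMean_sum {ι : Type*} (s : Finset ι) (W : ZMod 2 → Y → ℝ) (n : ℕ)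
    (F : ι → (Fin (2 ^ n) → ZMod 2) → (Fin (2 ^ n) → Y) → ℝ) :
    blockMean W n (fun u y => ∑ i ∈ s, F i u y) = ∑ i ∈ s, blockMean W n (F i) := by
  unfold blockMean
  simp only [Finset.mul_sum]
  have h : ∀ u, (∑ y, ∑ i ∈ s, blockLaw W n u y / 2 ^ 2 ^ n * F i u y) =
      ∑ i ∈ s, ∑ y, blockLaw W n u y / 2 ^ 2 ^ n * F i u y := fun u => Finset.sum_comm
  simp only [h]
  exact Finset.sum_comm

lemma blockMean_succ (W : ZMod 2 → Y → ℝ) (n : ℕ)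
    (F : (Fin (2 ^ n) → ZMod 2) × (Fin (2 ^ n) → ZMod 2) →
      (Fin (2 ^ n) → Y) × (Fin (2 ^ n) → Y) → ℝ) :
    blockMean W (n + 1) (fun u y => F (splitInput n u) (splitOutput n y)) =
      blockMean W n fun a y => blockMean W n fun b z => F (a, b) (y, z) := by
  unfold blockMean
  rw [← (splitInput n).symm.sum_comp, Fintype.sum_prod_type]
  refine Finset.sum_congr rfl fun a _ => ?_
  have h : ∀ b, (∑ y, blockLaw W (n + 1) ((splitInput n).symm (a, b)) y / 2 ^ 2 ^ (n + 1) *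
      F ((splitInput n) ((splitInput n).symm (a, b))) (splitOutput n y)) =
      ∑ y, ∑ z, blockLaw W n a y / 2 ^ 2 ^ n * (blockLaw W n b z / 2 ^ 2 ^ n * F (a, b) (y, z)) := by
    intro b
    rw [← (splitOutput n).symm.sum_comp, Fintype.sum_prod_type]
    refine Finset.sum_congr rfl fun y _ => Finset.sum_congr rfl fun z _ => ?_
    rw [blockLaw_succ, Equiv.apply_symm_apply, Equiv.apply_symm_apply, pow_succ 2 n, mul_two,
      pow_add]
    ring
  simp only [h]
  rw [Finset.sum_comm]
  refine Finset.sum_congr rfl fun y _ => ?_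
  simp only [Finset.mul_sum]

lemma ratioLaw_E (W V : ZMod 2 → Y → ℝ) (hW : IsChannel W) (hV : ∀ x y, 0 ≤ V x y)
    (φ : ℝ → ℝ) : (ratioLaw W V hW hV).E φ =
      ∑ x, ∑ y, W x y / 2 * φ (V (x + 1) y / V x y) := by
  have h : (ratioLaw W V hW hV).E φ =
      ∑ i : ZMod 2 × Y, W i.1 i.2 / 2 * φ (V (i.1 + 1) i.2 / V i.1 i.2) := rfl
  rw [h, Fintype.sum_prod_type]

/-- The synthetic likelihood ratio of `V` under `W` has the law of the corresponding node. -/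
lemma blockMean_blockRatio {W V : ZMod 2 → Y → ℝ} (hW : IsChannel W) (hV : ∀ x y, 0 ≤ V x y)
    (hac : ∀ x y, V x y = 0 → W x y = 0) (n : ℕ) (i : Fin (2 ^ n)) (φ : ℝ → ℝ) :
    blockMean W n (fun u y => φ (blockRatio V n i u y)) =
      ((ratioLaw W V hW hV).node n i.1).E φ := by
  induction n generalizing φ with
  | zero =>
    have hi : i = (0 : Fin 1) := Subsingleton.elim (α := Fin 1) _ _
    subst hi
    rw [RatioLaw.node, ratioLaw_E]
    unfold blockMean
    have hc : ∀ (x : ZMod 2) (u : Fin 1 → ZMod 2) (y : Fin 1 → Y),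
        cylinderLaw V 0 (0 : Fin 1) x u y = V x (y 0) := by
      intro x u y
      unfold cylinderLaw
      have h1 : ∀ v : Fin (2 ^ 0) → ZMod 2, (v (0 : Fin 1) = x ∧ ∀ j < (0 : Fin 1), v j = u j) ↔
          v = fun _ => x := by
        intro v
        constructor
        · rintro ⟨h, -⟩
          funext j
          rw [← h]
          congr 1
          exact Subsingleton.elim (α := Fin 1) _ _
        · rintro rfl
          exact ⟨rfl, fun j hj => absurd hj (Fin.not_lt_zero j)⟩
      refine (Finset.sum_congr rfl fun v _ => if_congr (h1 v) rfl rfl).trans ?_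
      rw [Finset.sum_ite_eq' Finset.univ, if_pos (Finset.mem_univ _)]
      exact Fin.prod_univ_one (fun j : Fin 1 => V x (y j))
    have e1 := (Equiv.funUnique (Fin 1) (ZMod 2)).symm.sum_comp (fun u : Fin 1 → ZMod 2 =>
      ∑ y : Fin 1 → Y, blockLaw W 0 u y / 2 ^ 2 ^ 0 * φ (blockRatio V 0 (0 : Fin 1) u y))
    refine e1.symm.trans (Finset.sum_congr rfl fun x _ => ?_)
    refine ((Equiv.funUnique (Fin 1) Y).symm.sum_comp _).symm.trans
      (Finset.sum_congr rfl fun y _ => ?_)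
    unfold blockRatio
    rw [hc, hc]
    have hb : blockLaw W 0 ((Equiv.funUnique (Fin 1) (ZMod 2)).symm x)
        ((Equiv.funUnique (Fin 1) Y).symm y) = W x y :=
      Fin.prod_univ_one (fun j : Fin 1 => W x y)
    rw [hb]
    norm_num
  | succ n ih =>
    by_cases h : i.1 % 2 = 0
    · have hi : evenIdx (halfIdx i) = i := Fin.ext (by simp only [evenIdx, halfIdx]; omega)
      have hn : (ratioLaw W V hW hV).node (n + 1) i.1 =
          ((ratioLaw W V hW hV).node n (halfIdx i).1).minus := by
        simp only [RatioLaw.node, h, if_true]; rfl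
      rw [hn, RatioLaw.E_minus, ← ih]
      simp only [← ih]
      rw [← blockMean_succ W n fun p q => φ (RatioLaw.checkOp
        (blockRatio V n (halfIdx i) p.1 q.1) (blockRatio V n (halfIdx i) p.2 q.2))]
      refine blockMean_congr fun u y hb => ?_
      rw [← blockRatio_evenIdx hV n (halfIdx i) u y (blockLaw_ne_zero hac hb), hi]
    · have hi : oddIdx (halfIdx i) = i := Fin.ext (by simp only [oddIdx, halfIdx]; omega)
      have hn : (ratioLaw W V hW hV).node (n + 1) i.1 =
          ((ratioLaw W V hW hV).node n (halfIdx i).1).plus := by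
        simp only [RatioLaw.node, h, if_false]; rfl
      rw [hn, RatioLaw.E_plus, ← ih]
      simp only [← ih]
      rw [← blockMean_succ W n fun p q => φ (blockRatio V n (halfIdx i) p.1 q.1 *
        blockRatio V n (halfIdx i) p.2 q.2)]
      refine blockMean_congr fun u y hb => ?_
      rw [← blockRatio_oddIdx V n (halfIdx i) u y, hi]

lemma blockMean_const {W : ZMod 2 → Y → ℝ} (hW : IsChannel W) (n : ℕ) (k : ℝ) :
    blockMean W n (fun _ _ => k) = k := by
  have h := blockMean_blockRatio hW hW.1 (fun _ _ h => h) n ⟨0, by positivity⟩ fun _ => k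
  rwa [RatioLaw.E_const] at h

lemma ereal_coe_sum {ι : Type*} (s : Finset ι) (f : ι → ℝ) :
    ((∑ i ∈ s, f i : ℝ) : EReal) = ∑ i ∈ s, (f i : EReal) := by
  classical
  induction s using Finset.induction_on with
  | empty => simp
  | insert a s ha ih => rw [Finset.sum_insert ha, Finset.sum_insert ha, EReal.coe_add, ih]

/-- The mismatched information as a real number, meaningful when `W` is dominated by `V`. -/
def mismatchedInfoReal {Z : Type*} [Fintype Z] (W V : ZMod 2 → Z → ℝ) : ℝ :=
  ∑ y, ∑ x, 1 / 2 * W x y * Real.logb 2 (V x y / outputDist V y)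

lemma mismatchedInfo_eq {Z : Type*} [Fintype Z] {W V : ZMod 2 → Z → ℝ}
    (h : ∀ x y, V x y = 0 → W x y = 0) :
    mismatchedInfo W V = (mismatchedInfoReal W V : EReal) := by
  unfold mismatchedInfo mismatchedInfoReal
  rw [ereal_coe_sum]
  refine Finset.sum_congr rfl fun y _ => ?_
  rw [ereal_coe_sum]
  refine Finset.sum_congr rfl fun x _ => ?_
  by_cases h0 : W x y = 0
  · simp [h0]
  · rw [if_neg h0, if_neg fun h1 => h0 (h x y h1)]

lemma mismatchedInfo_eq_bot {Z : Type*} [Fintype Z] {W V : ZMod 2 → Z → ℝ} {x : ZMod 2} {y : Z}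
    (hV : V x y = 0) (hW : W x y ≠ 0) : mismatchedInfo W V = ⊥ := by
  classical
  unfold mismatchedInfo
  rw [← Finset.add_sum_erase _ _ (Finset.mem_univ y), ← Finset.add_sum_erase _ _
    (Finset.mem_univ x), if_neg hW, if_pos hV, EReal.bot_add, EReal.bot_add]

/-- Every input block has exactly one prefix and one value at `i`, so the sums over both collapse;
the factor `1/2` completes the normalization `2 ^ (2 ^ n - 1)`. -/
lemma sum_synthChannel (W : ZMod 2 → Y → ℝ) (n : ℕ) (i : Fin (2 ^ n))
    (ψ : ZMod 2 → (Fin (2 ^ n) → Y) × (Fin i.1 → ZMod 2) → ℝ) :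
    ∑ z, ∑ x, 1 / 2 * synthChannel W n i x z * ψ x z =
      blockMean W n fun u y => ψ (u i) (y, prefixOf i u) := by
  classical
  unfold synthChannel blockMean
  rw [Fintype.sum_prod_type]
  simp only [Finset.mul_sum, Finset.sum_mul]
  rw [Finset.sum_comm (s := (Finset.univ : Finset (Fin (2 ^ n) → ZMod 2)))]
  refine Finset.sum_congr rfl fun y _ => ?_
  have hpow : (2 : ℝ) ^ 2 ^ n = 2 * 2 ^ (2 ^ n - 1) := by
    rw [← pow_succ', Nat.sub_add_cancel Nat.one_le_two_pow]
  have h1 : ∀ (u : Fin (2 ^ n) → ZMod 2) (x : ZMod 2) (p : Fin i.1 → ZMod 2),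
      (u i = x ∧ ∀ j : Fin i.1, u ⟨j.1, j.2.trans i.2⟩ = p j) ↔ (x = u i ∧ p = prefixOf i u) := by
    intro u x p
    rw [eq_comm, funext_iff]
    simp only [prefixOf, eq_comm]
  calc ∑ p : Fin i.1 → ZMod 2, ∑ x : ZMod 2, ∑ u : Fin (2 ^ n) → ZMod 2,
        1 / 2 * (if u i = x ∧ ∀ j : Fin i.1, u ⟨j.1, j.2.trans i.2⟩ = p j then
          blockLaw W n u y / 2 ^ (2 ^ n - 1) else 0) * ψ x (y, p)
      = ∑ u : Fin (2 ^ n) → ZMod 2, ∑ p : Fin i.1 → ZMod 2, ∑ x : ZMod 2,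
        if p = prefixOf i u then (if x = u i then
          blockLaw W n u y / 2 ^ 2 ^ n * ψ x (y, p) else 0) else 0 := by
        have h2 : ∀ p : Fin i.1 → ZMod 2, (∑ x : ZMod 2, ∑ u : Fin (2 ^ n) → ZMod 2,
            1 / 2 * (if u i = x ∧ ∀ j : Fin i.1, u ⟨j.1, j.2.trans i.2⟩ = p j then
              blockLaw W n u y / 2 ^ (2 ^ n - 1) else 0) * ψ x (y, p)) =
            ∑ u : Fin (2 ^ n) → ZMod 2, ∑ x : ZMod 2,
            1 / 2 * (if u i = x ∧ ∀ j : Fin i.1, u ⟨j.1, j.2.trans i.2⟩ = p j then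
              blockLaw W n u y / 2 ^ (2 ^ n - 1) else 0) * ψ x (y, p) := fun p =>
          Finset.sum_comm
        simp only [h2]
        rw [Finset.sum_comm]
        refine Finset.sum_congr rfl fun u _ => Finset.sum_congr rfl fun p _ =>
          Finset.sum_congr rfl fun x _ => ?_
        rw [if_congr (h1 u x p) rfl rfl, hpow]
        by_cases hx : x = u i <;> by_cases hp : p = prefixOf i u <;> simp [hx, hp]
        left
        ring
    _ = _ := by
        refine Finset.sum_congr rfl fun u _ => ?_
        simp

end Link

/-! ### Information sets and successive cancellation decoding -/

section Code

variable {Y : Type u}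

lemma cylinderLaw_pos {V : ZMod 2 → Y → ℝ} (hV : ∀ x y, 0 ≤ V x y) {n : ℕ} (i : Fin (2 ^ n))
    {u : Fin (2 ^ n) → ZMod 2} {y : Fin (2 ^ n) → Y} (h : blockLaw V n u y ≠ 0) :
    0 < cylinderLaw V n i (u i) u y :=
  ((blockLaw_nonneg hV n u y).lt_of_ne' h).trans_le (blockLaw_le_cylinderLaw hV n i u y)

lemma synthChannel_eq_zero {W V : ZMod 2 → Y → ℝ} (hV : ∀ x y, 0 ≤ V x y)
    (hac : ∀ x y, V x y = 0 → W x y = 0) (n : ℕ) (i : Fin (2 ^ n)) (x : ZMod 2)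
    (z : (Fin (2 ^ n) → Y) × (Fin i.1 → ZMod 2)) (h : synthChannel V n i x z = 0) :
    synthChannel W n i x z = 0 := by
  unfold synthChannel at *
  rw [Finset.sum_eq_zero_iff_of_nonneg] at h
  · refine Finset.sum_eq_zero fun u hu => ?_
    have := h u hu
    split_ifs at this ⊢
    · rw [div_eq_zero_iff] at this ⊢
      refine this.imp_left fun h0 => ?_
      by_contra h1
      exact blockLaw_ne_zero hac h1 h0
    · rfl
  · intro u _
    split_ifs
    · exact div_nonneg (blockLaw_nonneg hV _ _ _) (by positivity)
    · exact le_rfl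

lemma logb_div_outputDist {Z : Type*} {V : ZMod 2 → Z → ℝ} {x : ZMod 2} {z : Z}
    (h : 0 < V x z) (h' : 0 ≤ V (x + 1) z) :
    Real.logb 2 (V x z / outputDist V z) = 1 - Real.logb 2 (1 + V (x + 1) z / V x z) := by
  have h0 : V 0 z + V 1 z = V x z + V (x + 1) z := by
    rw [← zmod_two_sum (fun x => V x z) x]
    exact (Fin.sum_univ_two fun x : ZMod 2 => V x z).symm
  have h1 : V x z / outputDist V z = 2 / (1 + V (x + 1) z / V x z) := by
    unfold outputDist
    rw [h0]
    have : 0 < V x z + V (x + 1) z := by positivity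
    have : 0 < 1 + V (x + 1) z / V x z := by positivity
    field_simp
  rw [h1, Real.logb_div (by norm_num) (by positivity), Real.logb_self_eq_one (by norm_num)]

open scoped Classical in
/-- The indicator that maximum likelihood for `V` may decide the bit `i` wrongly when the earlier
bits are known. -/
def genieError (V : ZMod 2 → Y → ℝ) (n : ℕ) (i : Fin (2 ^ n)) (u : Fin (2 ^ n) → ZMod 2)
    (y : Fin (2 ^ n) → Y) : ℝ :=
  if cylinderLaw V n i (u i) u y ≤ cylinderLaw V n i (u i + 1) u y then 1 else 0

lemma genieError_nonneg (V : ZMod 2 → Y → ℝ) (n : ℕ) (i : Fin (2 ^ n))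
    (u : Fin (2 ^ n) → ZMod 2) (y : Fin (2 ^ n) → Y) : 0 ≤ genieError V n i u y := by
  unfold genieError; split_ifs <;> norm_num

/-- The decoder is correct when each single decision with known past is. -/
lemma scDecode_eq {V : ZMod 2 → Y → ℝ} {n : ℕ} {A : Finset (Fin (2 ^ n))}
    {f u : Fin (2 ^ n) → ZMod 2} {y : Fin (2 ^ n) → Y} (hf : ∀ i, i ∉ A → u i = f i)
    (hA : ∀ i ∈ A, cylinderLaw V n i (u i + 1) u y < cylinderLaw V n i (u i) u y) :
    scDecode V n A f y = u := by
  have key : ∀ m : ℕ, ∀ i : Fin (2 ^ n), i.1 = m → scDecode V n A f y i = u i := by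
    intro m
    induction m using Nat.strong_induction_on with
    | _ m ih =>
      intro i hi
      have hpre : (fun j : Fin i.1 => scDecode V n A f y ⟨j.1, j.2.trans i.2⟩) = prefixOf i u := by
        funext j
        exact ih j.1 (hi ▸ j.2) _ rfl
      rw [scDecode]
      by_cases h : i ∈ A
      · have hle : ∀ a b : ZMod 2, synthChannel V n i a (y, prefixOf i u) ≤
            synthChannel V n i b (y, prefixOf i u) ↔
            cylinderLaw V n i a u y ≤ cylinderLaw V n i b u y := fun a b => by
          rw [synthChannel_prefixOf, synthChannel_prefixOf,
            div_le_div_iff_of_pos_right (by positivity)]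
        rw [if_pos h, hpre]
        have h1 := hA i h
        have ht : u i = 0 ∨ u i = 1 := by generalize u i = t; revert t; decide
        rcases ht with ht | ht
        · rw [ht, zero_add] at h1
          rw [if_pos ((hle _ _).2 h1.le), ht]
        · rw [ht, show (1 : ZMod 2) + 1 = 0 by decide] at h1
          rw [if_neg fun h2 => h1.not_ge ((hle _ _).1 h2), ht]
      · rw [if_neg h, hf i h]
  exact funext fun i => key i.1 i rfl

lemma sum_ite_agree {n : ℕ} (A : Finset (Fin (2 ^ n))) (u : Fin (2 ^ n) → ZMod 2) (k : ℝ) :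
    (open scoped Classical in ∑ f : Fin (2 ^ n) → ZMod 2, if ∀ i, i ∉ A → u i = f i then k else 0)
      = 2 ^ A.card * k := by
  classical
  have h : (Finset.univ.filter fun f : Fin (2 ^ n) → ZMod 2 => ∀ i, i ∉ A → u i = f i) =
      Fintype.piFinset fun i => if i ∈ A then Finset.univ else {u i} := by
    ext f
    simp only [Finset.mem_filter, Finset.mem_univ, true_and, Fintype.mem_piFinset]
    refine forall_congr' fun i => ?_
    by_cases hi : i ∈ A <;> simp [hi, eq_comm]
  have hcard : (Finset.univ.filter fun f : Fin (2 ^ n) → ZMod 2 =>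
      ∀ i, i ∉ A → u i = f i).card = 2 ^ A.card := by
    rw [h, Fintype.card_piFinset]
    have : ∀ i, (if i ∈ A then (Finset.univ : Finset (ZMod 2)) else {u i}).card =
        if i ∈ A then 2 else 1 := fun i => by split_ifs <;> simp
    simp only [this]
    rw [Finset.prod_ite, Finset.prod_const_one, mul_one, Finset.prod_const]
    simp
  rw [← Finset.sum_filter, Finset.sum_const, nsmul_eq_mul]
  congr 1
  rw [← Nat.cast_ofNat (R := ℝ) (n := 2), ← Nat.cast_pow, ← hcard]

variable [Fintype Y]

/-- The mismatched information of a channel is the information of its ratio law. -/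
lemma mismatchedInfo_synthChannel {W V : ZMod 2 → Y → ℝ} (hW : IsChannel W)
    (hV : ∀ x y, 0 ≤ V x y) (hac : ∀ x y, V x y = 0 → W x y = 0) (n : ℕ) (i : Fin (2 ^ n)) :
    mismatchedInfo (synthChannel W n i) (synthChannel V n i) =
      (((ratioLaw W V hW hV).node n i.1).info : EReal) := by
  rw [mismatchedInfo_eq (synthChannel_eq_zero hV hac n i)]
  unfold mismatchedInfoReal
  rw [sum_synthChannel W n i fun x z =>
    Real.logb 2 (synthChannel V n i x z / outputDist (synthChannel V n i) z)]
  rw [RatioLaw.info, RatioLaw.logLoss, ← blockMean_blockRatio hW hV hac n i,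
    ← blockMean_const hW n 1, ← blockMean_sub, blockMean_const hW n 1]
  congr 1
  refine blockMean_congr fun u y hb => ?_
  have hp := cylinderLaw_pos hV i (blockLaw_ne_zero hac hb)
  have hp' := cylinderLaw_nonneg hV n i (u i + 1) u y
  have hD : (0 : ℝ) < 2 ^ (2 ^ n - 1) := by positivity
  rw [logb_div_outputDist, synthChannel_prefixOf, synthChannel_prefixOf,
    div_div_div_cancel_right₀ hD.ne']
  · rfl
  · rw [synthChannel_prefixOf]; positivity
  · rw [synthChannel_prefixOf]; positivity

lemma mismatchedInfoReal_eq_info {W V : ZMod 2 → Y → ℝ} (hW : IsChannel W)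
    (hV : ∀ x y, 0 ≤ V x y) (hac : ∀ x y, V x y = 0 → W x y = 0) :
    mismatchedInfoReal W V = (ratioLaw W V hW hV).info := by
  have h1 : (∑ x, ∑ y, W x y / 2) = (1 : ℝ) := by
    simp only [← Finset.sum_div, hW.2]
    simp
  have h2 : (ratioLaw W V hW hV).info = (∑ x, ∑ y, W x y / 2) -
      ∑ x, ∑ y, W x y / 2 * Real.logb 2 (1 + V (x + 1) y / V x y) := by
    rw [h1, ← ratioLaw_E W V hW hV fun a => Real.logb 2 (1 + a)]; rfl
  rw [h2, mismatchedInfoReal, Finset.sum_comm, ← Finset.sum_sub_distrib]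
  refine Finset.sum_congr rfl fun x _ => ?_
  rw [← Finset.sum_sub_distrib]
  refine Finset.sum_congr rfl fun y _ => ?_
  rcases (hV x y).eq_or_lt with h0 | h0
  · simp [hac x y h0.symm]
  · rw [logb_div_outputDist h0 (hV _ _)]; ring

lemma card_infoSet {W V : ZMod 2 → Y → ℝ} (hW : IsChannel W) (hV : ∀ x y, 0 ≤ V x y)
    (hac : ∀ x y, V x y = 0 → W x y = 0) (n : ℕ) (ε : ℝ) :
    ((infoSet W V n ε).card : ℝ) =
      2 ^ n * RatioLaw.avg^[n] (RatioLaw.ind fun σ => 1 - ε ≤ σ.info) (ratioLaw W V hW hV) := by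
  rw [RatioLaw.avg_iterate, mul_div_cancel₀ _ (by positivity), infoSet, Finset.card_filter,
    ← Fin.sum_univ_eq_sum_range (fun i => RatioLaw.ind (fun σ => 1 - ε ≤ σ.info)
      ((ratioLaw W V hW hV).node n i))]
  rw [Nat.cast_sum]
  refine Finset.sum_congr rfl fun i _ => ?_
  have h := mismatchedInfo_synthChannel hW hV hac n i
  by_cases hi : 1 - ε ≤ ((ratioLaw W V hW hV).node n i.1).info
  · rw [RatioLaw.ind, if_pos hi, if_pos (by rw [h]; exact EReal.coe_le_coe_iff.2 hi), Nat.cast_one]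
  · rw [RatioLaw.ind, if_neg hi, if_neg (by rw [h]; exact fun h1 => hi (EReal.coe_le_coe_iff.1 h1)),
      Nat.cast_zero]

/-- An error, ties included, means likelihood ratio at least one, and there the log-loss `log₂ (1 +
L)` is at least one. -/
lemma blockMean_genieError_le {W V : ZMod 2 → Y → ℝ} (hW : IsChannel W)
    (hV : ∀ x y, 0 ≤ V x y) (hac : ∀ x y, V x y = 0 → W x y = 0) (n : ℕ) (i : Fin (2 ^ n)) :
    blockMean W n (genieError V n i) ≤ 1 - ((ratioLaw W V hW hV).node n i.1).info := by
  rw [RatioLaw.info, sub_sub_cancel, RatioLaw.logLoss, ← blockMean_blockRatio hW hV hac n i]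
  refine blockMean_mono hW.1 fun u y hb => ?_
  have hp := cylinderLaw_pos hV i (blockLaw_ne_zero hac hb)
  have hr : 0 ≤ blockRatio V n i u y := div_nonneg (cylinderLaw_nonneg hV _ _ _ _ _) hp.le
  unfold genieError
  split_ifs with h
  · have h1 : 1 ≤ blockRatio V n i u y := (one_le_div hp).2 h
    rw [Real.le_logb_iff_rpow_le (by norm_num) (by linarith), Real.rpow_one]
    linarith
  · exact RatioLaw.logb_one_add_nonneg hr

/-- The union bound for successive cancellation decoding. -/
lemma scErrorProb_le_sum {W V : ZMod 2 → Y → ℝ} (hW : ∀ x y, 0 ≤ W x y) (n : ℕ)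
    (A : Finset (Fin (2 ^ n))) :
    scErrorProb W V n A ≤ ∑ i ∈ A, blockMean W n (genieError V n i) := by
  classical
  rw [← blockMean_sum]
  set g : (Fin (2 ^ n) → ZMod 2) → ℝ := fun u =>
    ∑ y, blockLaw W n u y * ∑ i ∈ A, genieError V n i u y with hg
  have hgn : ∀ u y, 0 ≤ ∑ i ∈ A, genieError V n i u y := fun u y =>
    Finset.sum_nonneg fun i _ => genieError_nonneg V n i u y
  have h1 : ∀ f, codeErrorProb W V n A f ≤
      (∑ u, if ∀ i, i ∉ A → u i = f i then g u else 0) / 2 ^ A.card := by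
    intro f
    unfold codeErrorProb
    gcongr with u _
    split_ifs with hu
    · refine Finset.sum_le_sum fun y _ => ?_
      have hb := blockLaw_nonneg hW n u y
      split_ifs with hd
      · exact mul_nonneg hb (hgn u y)
      · refine le_mul_of_one_le_right hb ?_
        by_contra hlt
        refine hd (scDecode_eq hu fun i hi => ?_)
        by_contra hi'
        refine hlt ?_
        have h2 := Finset.single_le_sum (fun i _ => genieError_nonneg V n i u y) hi
        rwa [genieError, if_pos (not_lt.1 hi')] at h2
    · exact le_rfl
  unfold scErrorProb
  calc (∑ f, codeErrorProb W V n A f) / 2 ^ 2 ^ n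
      ≤ (∑ f : Fin (2 ^ n) → ZMod 2, (∑ u, if ∀ i, i ∉ A → u i = f i then g u else 0) / 2 ^ A.card) / 2 ^ 2 ^ n := by
        gcongr with f _
        exact h1 f
    _ = (∑ u, g u) / 2 ^ 2 ^ n := by
        rw [← Finset.sum_div, Finset.sum_comm]
        congr 1
        rw [div_eq_iff (by positivity), Finset.sum_mul]
        refine Finset.sum_congr rfl fun u _ => ?_
        -- Each input block agrees with `2 ^ A.card` frozen vectors, which cancels the code
        -- normalization and leaves a uniform input.
        rw [mul_comm, ← sum_ite_agree A u (g u)]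
    _ = blockMean W n fun u y => ∑ i ∈ A, genieError V n i u y := by
        unfold blockMean
        rw [Finset.sum_div]
        refine Finset.sum_congr rfl fun u _ => ?_
        rw [hg, Finset.sum_div]
        exact Finset.sum_congr rfl fun y _ => by ring

lemma scErrorProb_infoSet_le {W V : ZMod 2 → Y → ℝ} (hW : IsChannel W)
    (hV : ∀ x y, 0 ≤ V x y) (hac : ∀ x y, V x y = 0 → W x y = 0) (n : ℕ) {ε : ℝ} (hε : 0 ≤ ε) :
    scErrorProb W V n (infoSet W V n ε) ≤ 2 ^ n * ε := by
  refine (scErrorProb_le_sum hW.1 n _).trans ?_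
  have h : ∀ i ∈ infoSet W V n ε, blockMean W n (genieError V n i) ≤ ε := by
    intro i hi
    rw [infoSet, Finset.mem_filter, mismatchedInfo_synthChannel hW hV hac,
      EReal.coe_le_coe_iff] at hi
    linarith [blockMean_genieError_le hW hV hac n i]
  refine (Finset.sum_le_card_nsmul _ _ _ h).trans ?_
  rw [nsmul_eq_mul]
  have hc : ((infoSet W V n ε).card : ℝ) ≤ 2 ^ n := by
    have := Finset.card_le_univ (infoSet W V n ε)
    rw [Fintype.card_fin] at this
    exact_mod_cast this
  gcongr

end Code

/-! ### Uniformity over the class by compactness -/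

section Uniform

variable {Y : Type u} [Fintype Y]

/-- The channels dominated by `V` whose mismatched information with `V` is at least `γ`. -/
def dominatedClass (V : ZMod 2 → Y → ℝ) (γ : ℝ) : Set (ZMod 2 → Y → ℝ) :=
  {W | IsChannel W ∧ (∀ x y, V x y = 0 → W x y = 0) ∧ γ ≤ mismatchedInfoReal W V}

lemma isClosed_setOf_isChannel : IsClosed {W : ZMod 2 → Y → ℝ | IsChannel W} := by
  have h : {W : ZMod 2 → Y → ℝ | IsChannel W} =
      (⋂ x, ⋂ y, {W | 0 ≤ W x y}) ∩ ⋂ x, {W | ∑ y, W x y = 1} := by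
    ext W; simp [IsChannel]
  rw [h]
  refine IsClosed.inter (isClosed_iInter fun x => isClosed_iInter fun y => ?_)
    (isClosed_iInter fun x => ?_)
  · exact isClosed_le continuous_const (by fun_prop)
  · exact isClosed_eq (by fun_prop) continuous_const

lemma isCompact_setOf_isChannel : IsCompact {W : ZMod 2 → Y → ℝ | IsChannel W} := by
  refine (isCompact_Icc (a := (0 : ZMod 2 → Y → ℝ)) (b := 1)).of_isClosed_subset
    isClosed_setOf_isChannel fun W hW => ⟨fun x y => hW.1 x y, fun x y => ?_⟩
  rw [Pi.one_apply, Pi.one_apply, ← hW.2 x]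
  exact Finset.single_le_sum (fun y _ => hW.1 x y) (Finset.mem_univ y)

/-- With `V` fixed, domination and the information bound are closed linear conditions on `W`. -/
lemma isCompact_dominatedClass (V : ZMod 2 → Y → ℝ) (γ : ℝ) :
    IsCompact (dominatedClass V γ) := by
  have h : dominatedClass V γ = {W | IsChannel W} ∩
      ((⋂ x, ⋂ y, ⋂ _ : V x y = 0, {W | W x y = 0}) ∩ {W | γ ≤ mismatchedInfoReal W V}) := by
    ext W; simp [dominatedClass]
  rw [h]
  refine isCompact_setOf_isChannel.inter_right (IsClosed.inter
    (isClosed_iInter fun x => isClosed_iInter fun y => isClosed_iInter fun _ => ?_) ?_)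
  · exact isClosed_eq (by fun_prop) continuous_const
  · unfold mismatchedInfoReal
    exact isClosed_le continuous_const (by fun_prop)

lemma continuous_blockMean (n : ℕ) (F : (Fin (2 ^ n) → ZMod 2) → (Fin (2 ^ n) → Y) → ℝ) :
    Continuous fun W : ZMod 2 → Y → ℝ => blockMean W n F := by
  unfold blockMean blockLaw
  fun_prop

/-- Polarization is uniform near each channel. -/
lemma exists_nhds_card_infoSet {V : ZMod 2 → Y → ℝ} (hV : ∀ x y, 0 ≤ V x y) {β γ R : ℝ}
    (hβ0 : 0 < β) (hβ : β < 1 / 2) (hR0 : 0 ≤ R) (hR : R < γ) {W₀ : ZMod 2 → Y → ℝ}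
    (hW₀ : W₀ ∈ dominatedClass V γ) : ∃ t ∈ nhds W₀, ∀ᶠ n : ℕ in atTop,
      ∀ W ∈ t, W ∈ dominatedClass V γ →
        (2 : ℝ) ^ n * R ≤ ((infoSet W V n ((2 : ℝ) ^ (-((2 : ℝ) ^ n) ^ β))).card : ℝ) := by
  classical
  have hr : 0 < (R + γ) / 2 := by linarith
  -- The loss is chosen so that a proportion `(R + γ) / 2` of good nodes at level `m`, times `1 -
  -- ε`, is exactly `R`.
  obtain ⟨θ, hθ, hfast⟩ := RatioLaw.exists_fast.{u} hβ0 hβ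
    (ε := 1 - R / ((R + γ) / 2)) (by rw [sub_pos, div_lt_one hr]; linarith)
  set σ := ratioLaw W₀ V hW₀.1 hV with hσ
  have hlim : (R + γ) / 2 < RatioLaw.goodLimit θ σ := by
    refine lt_of_lt_of_le ?_ (RatioLaw.info_le_goodLimit hθ σ)
    rw [hσ, ← mismatchedInfoReal_eq_info hW₀.1 hV hW₀.2.1]
    linarith [hW₀.2.2]
  obtain ⟨m, hm⟩ := (RatioLaw.eventually_of_lt_goodLimit hlim).exists
  -- The orders are frozen at `W₀`, one per node, because `exists_fast` needs a fixed order; nodes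
  -- that are not good get the dummy value `1`.
  have hs : ∀ i : Fin (2 ^ m), ∃ s : ℝ, 0 < s ∧ s ≤ 1 ∧
      (RatioLaw.SmallMoment θ (σ.node m i.1) → (σ.node m i.1).moment s < θ) := by
    intro i
    by_cases h : RatioLaw.SmallMoment θ (σ.node m i.1)
    · obtain ⟨s, h0, h1, h2⟩ := h
      exact ⟨s, h0, h1, fun _ => h2⟩
    · exact ⟨1, one_pos, le_rfl, fun h' => absurd h' h⟩
  choose s hs0 hs1 hsθ using hs
  have hmoment : ∀ W (hW : W ∈ dominatedClass V γ) (i : Fin (2 ^ m)),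
      ((ratioLaw W V hW.1 hV).node m i.1).moment (s i) =
        blockMean W m fun u y => blockRatio V m i u y ^ s i := fun W hW i =>
    (blockMean_blockRatio hW.1 hV hW.2.1 m i fun a => a ^ s i).symm
  refine ⟨⋂ i : Fin (2 ^ m), {W | RatioLaw.SmallMoment θ (σ.node m i.1) →
    (blockMean W m fun u y => blockRatio V m i u y ^ s i) < θ}, ?_, ?_⟩
  · refine (Filter.iInter_mem).2 fun i => ?_
    by_cases h : RatioLaw.SmallMoment θ (σ.node m i.1)
    · have h1 := hsθ i h
      rw [hσ, hmoment W₀ hW₀ i] at h1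
      filter_upwards [(continuous_blockMean m _).continuousAt.eventually_lt continuousAt_const h1]
        with W hW _ using hW
    · exact Filter.univ_mem' fun W h' => absurd h' h
  · have hall : ∀ᶠ k : ℕ in atTop, ∀ i : Fin (2 ^ m), ∀ τ : RatioLaw.{u}, τ.moment (s i) < θ →
        1 - (1 - R / ((R + γ) / 2)) ≤ RatioLaw.avg^[k] (RatioLaw.ind fun τ =>
          1 - (2 : ℝ) ^ (-((2 : ℝ) ^ (m + k)) ^ β) ≤ τ.info) τ :=
      eventually_all.2 fun i => hfast (s i) (hs0 i) (hs1 i) m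
    rw [← Filter.map_add_atTop_eq_nat m, eventually_map]
    filter_upwards [hall] with k hk W hWt hW
    rw [Set.mem_iInter] at hWt
    rw [card_infoSet hW.1 hV hW.2.1, add_comm k m]
    refine mul_le_mul_of_nonneg_left ?_ (by positivity)
    -- The first `m` levels carry the certificate that holds near `W₀`; the remaining `k` levels
    -- polarize each certified node.
    rw [Function.iterate_add_apply, RatioLaw.avg_iterate]
    rw [RatioLaw.avg_iterate] at hm
    have hterm : ∀ i ∈ Finset.range (2 ^ m),
        R / ((R + γ) / 2) * RatioLaw.ind (RatioLaw.SmallMoment θ) (σ.node m i) ≤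
          RatioLaw.avg^[k] (RatioLaw.ind fun τ => 1 - (2 : ℝ) ^ (-((2 : ℝ) ^ (m + k)) ^ β) ≤
            τ.info) ((ratioLaw W V hW.1 hV).node m i) := by
      intro i hi
      rw [Finset.mem_range] at hi
      by_cases h : RatioLaw.SmallMoment θ (σ.node m i)
      · have h1 := hk ⟨i, hi⟩ ((ratioLaw W V hW.1 hV).node m i) (by
          rw [hmoment W hW ⟨i, hi⟩]; exact hWt ⟨i, hi⟩ h)
        rw [RatioLaw.ind, if_pos h, mul_one]
        linarith
      · rw [RatioLaw.ind, if_neg h, mul_zero]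
        exact RatioLaw.avg_iterate_ind_nonneg _ _ _
    rw [le_div_iff₀ (by positivity)]
    refine le_trans ?_ (Finset.sum_le_sum hterm)
    rw [← Finset.mul_sum]
    rw [lt_div_iff₀ (by positivity)] at hm
    calc R * 2 ^ m = R / ((R + γ) / 2) * ((R + γ) / 2 * 2 ^ m) := by
          rw [← mul_assoc, div_mul_cancel₀ _ hr.ne']
      _ ≤ _ := mul_le_mul_of_nonneg_left hm.le (by positivity)

lemma eventually_card_infoSet {V : ZMod 2 → Y → ℝ} (hV : ∀ x y, 0 ≤ V x y) {β γ R : ℝ}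
    (hβ0 : 0 < β) (hβ : β < 1 / 2) (hR : R < γ) : ∀ᶠ n : ℕ in atTop,
      ∀ W ∈ dominatedClass V γ,
        (2 : ℝ) ^ n * R ≤ ((infoSet W V n ((2 : ℝ) ^ (-((2 : ℝ) ^ n) ^ β))).card : ℝ) := by
  rcases lt_or_ge R 0 with hR0 | hR0
  · refine Eventually.of_forall fun n W _ => le_trans ?_ (Nat.cast_nonneg _)
    exact mul_nonpos_of_nonneg_of_nonpos (by positivity) hR0.le
  have key := (isCompact_dominatedClass V γ).induction_on (p := fun t => ∀ᶠ n : ℕ in atTop,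
    ∀ W ∈ t, W ∈ dominatedClass V γ →
      (2 : ℝ) ^ n * R ≤ ((infoSet W V n ((2 : ℝ) ^ (-((2 : ℝ) ^ n) ^ β))).card : ℝ))
    (Eventually.of_forall fun n W hW => absurd hW (Set.notMem_empty W))
    (fun s t hst ht => ht.mono fun n hn W hW => hn W (hst hW))
    (fun s t hs ht => by
      filter_upwards [hs, ht] with n h1 h2 W hW
      exact hW.elim (h1 W) (h2 W))
    (fun W₀ hW₀ => by
      obtain ⟨t, ht, h⟩ := exists_nhds_card_infoSet hV hβ0 hβ hR0 hR hW₀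
      exact ⟨t, mem_nhdsWithin_of_mem_nhds ht, h⟩)
  exact key.mono fun n hn W hW => hn W hW hW

lemma tendsto_two_pow_mul_rpow {β : ℝ} (hβ : 0 < β) :
    Tendsto (fun n : ℕ => (2 : ℝ) ^ n * (2 : ℝ) ^ (-((2 : ℝ) ^ n) ^ β)) atTop (nhds 0) := by
  have h1 : Tendsto (fun x : ℝ => x ^ (1 / β) * Real.exp (-Real.log 2 * x)) atTop (nhds 0) :=
    tendsto_rpow_mul_exp_neg_mul_atTop_nhds_zero _ _ (Real.log_pos (by norm_num))
  have h2 : Tendsto (fun n : ℕ => ((2 : ℝ) ^ n) ^ β) atTop atTop :=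
    (tendsto_rpow_atTop hβ).comp (tendsto_pow_atTop_atTop_of_one_lt (by norm_num))
  refine (h1.comp h2).congr fun n => ?_
  simp only [Function.comp]
  rw [← Real.rpow_mul (by positivity), mul_one_div_cancel hβ.ne', Real.rpow_one,
    Real.rpow_def_of_pos (by norm_num : (0 : ℝ) < 2)]
  congr 2
  ring

lemma eventually_scErrorProb_le {V : ZMod 2 → Y → ℝ} (hV : ∀ x y, 0 ≤ V x y) {β δ : ℝ}
    (hβ0 : 0 < β) (hδ : 0 < δ) : ∀ᶠ n : ℕ in atTop, ∀ W, IsChannel W →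
      (∀ x y, V x y = 0 → W x y = 0) →
        scErrorProb W V n (infoSet W V n ((2 : ℝ) ^ (-((2 : ℝ) ^ n) ^ β))) ≤ δ := by
  filter_upwards [(tendsto_two_pow_mul_rpow hβ0).eventually (gt_mem_nhds hδ)] with n hn W hW hac
  exact (scErrorProb_infoSet_le hW hV hac n (by positivity)).trans hn.le

end Uniform

/-! ### Compound capacity and Gibbs' inequality -/

section Capacity

variable {Y : Type u}

lemma sum_outputDist_input (V : ZMod 2 → Y → ℝ) (y : Y) :
    ∑ x, 1 / 2 * V x y = outputDist V y := by
  have h : ∑ x, 1 / 2 * V x y = 1 / 2 * V 0 y + 1 / 2 * V 1 y :=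
    Fin.sum_univ_two fun x : ZMod 2 => 1 / 2 * V x y
  rw [h, outputDist]
  ring

lemma outputDist_pos {V : ZMod 2 → Y → ℝ} (hV : ∀ x y, 0 ≤ V x y) {x : ZMod 2} {y : Y}
    (h : V x y ≠ 0) : 0 < outputDist V y := by
  rw [← sum_outputDist_input]
  have h1 := Finset.single_le_sum (f := fun x => 1 / 2 * V x y)
    (fun x _ => mul_nonneg (by norm_num) (hV x y)) (Finset.mem_univ x)
  have h2 := (hV x y).lt_of_ne' h
  refine lt_of_lt_of_le ?_ h1
  positivity

lemma div_mul_self_le {a : ℝ} (ha : 0 ≤ a) (b : ℝ) : a / b * b ≤ a := by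
  by_cases hb : b = 0
  · simpa [hb] using ha
  · rw [div_mul_cancel₀ _ hb]

lemma outputDist_convexComb (V W : ZMod 2 → Y → ℝ) (t : ℝ) (y : Y) :
    outputDist ((1 - t) • V + t • W) y = (1 - t) * outputDist V y + t * outputDist W y := by
  simp only [outputDist, Pi.add_apply, Pi.smul_apply, smul_eq_mul]
  ring

variable [Fintype Y]

lemma sum_outputDist {V : ZMod 2 → Y → ℝ} (hV : IsChannel V) : ∑ y, outputDist V y = 1 := by
  simp only [outputDist]
  rw [← Finset.sum_div, Finset.sum_add_distrib, hV.2, hV.2]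
  norm_num

lemma symCapacity_eq (V : ZMod 2 → Y → ℝ) : symCapacity V = mismatchedInfoReal V V := by
  unfold symCapacity mutualInfo mismatchedInfoReal
  simp only [sum_outputDist_input]

/-- Apply `log r ≤ r - 1` to `r = a / b`. This common form of Gibbs' inequality serves both for a
mismatched decoding law and for a nonuniform input. -/
lemma sum_mul_logb_le {p a b : Y → ZMod 2 → ℝ} (hp : ∀ y x, 0 ≤ p y x)
    (ha : ∀ y x, p y x ≠ 0 → 0 < a y x) (hb : ∀ y x, p y x ≠ 0 → 0 < b y x)
    (h : ∑ y, ∑ x, p y x * (a y x / b y x) ≤ ∑ y, ∑ x, p y x) :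
    ∑ y, ∑ x, p y x * Real.logb 2 (a y x) ≤ ∑ y, ∑ x, p y x * Real.logb 2 (b y x) := by
  have hl : (0 : ℝ) < Real.log 2 := Real.log_pos (by norm_num)
  rw [← sub_nonpos]
  simp only [← Finset.sum_sub_distrib]
  calc ∑ y, ∑ x, (p y x * Real.logb 2 (a y x) - p y x * Real.logb 2 (b y x))
      ≤ ∑ y, ∑ x, (p y x * (a y x / b y x) - p y x) / Real.log 2 := by
        refine Finset.sum_le_sum fun y _ => Finset.sum_le_sum fun x _ => ?_
        by_cases h0 : p y x = 0
        · simp [h0]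
        · have h1 := ha y x h0
          have h2 := hb y x h0
          have h3 := Real.log_le_sub_one_of_pos (div_pos h1 h2)
          rw [← mul_sub, ← Real.logb_div h1.ne' h2.ne', Real.logb, ← mul_div_assoc]
          gcongr
          calc p y x * Real.log (a y x / b y x) ≤ p y x * (a y x / b y x - 1) :=
                mul_le_mul_of_nonneg_left h3 (hp y x)
            _ = _ := by ring
    _ ≤ 0 := by
        simp only [← Finset.sum_div, Finset.sum_sub_distrib]
        exact div_nonpos_of_nonpos_of_nonneg (by linarith) hl.le

/-- Gibbs' inequality for the mismatched information. -/
lemma mismatchedInfoReal_le_self {U V : ZMod 2 → Y → ℝ} (hU : IsChannel U) (hV : IsChannel V)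
    (h : ∀ x y, V x y ≠ 0 → U x y ≠ 0) : mismatchedInfoReal V U ≤ mismatchedInfoReal V V := by
  have hpos : ∀ y x, 1 / 2 * V x y ≠ 0 → V x y ≠ 0 := fun y x h0 => right_ne_zero_of_mul h0
  refine sum_mul_logb_le (p := fun y x => 1 / 2 * V x y)
    (a := fun y x => U x y / outputDist U y) (b := fun y x => V x y / outputDist V y)
    (fun y x => mul_nonneg (by norm_num) (hV.1 x y)) (fun y x h0 => ?_) (fun y x h0 => ?_) ?_
  · exact div_pos ((hU.1 x y).lt_of_ne' (h x y (hpos y x h0)))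
      (outputDist_pos hU.1 (h x y (hpos y x h0)))
  · exact div_pos ((hV.1 x y).lt_of_ne' (hpos y x h0)) (outputDist_pos hV.1 (hpos y x h0))
  · have hq : ∀ {T : ZMod 2 → Y → ℝ}, IsChannel T → ∀ y, 0 ≤ outputDist T y := fun hT y =>
      div_nonneg (add_nonneg (hT.1 _ _) (hT.1 _ _)) (by norm_num)
    simp only [sum_outputDist_input]
    refine Finset.sum_le_sum fun y _ => ?_
    calc ∑ x, 1 / 2 * V x y * (U x y / outputDist U y / (V x y / outputDist V y))
        ≤ ∑ x, outputDist V y / outputDist U y * (1 / 2 * U x y) := by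
          refine Finset.sum_le_sum fun x _ => ?_
          by_cases h0 : V x y = 0
          · rw [h0]
            have := hq hU y
            have := hq hV y
            have := hU.1 x y
            simp only [mul_zero, zero_mul]
            positivity
          · have := outputDist_pos hV.1 h0
            have := outputDist_pos hU.1 (h x y h0)
            refine le_of_eq ?_
            field_simp
      _ = outputDist V y / outputDist U y * outputDist U y := by
          rw [← Finset.mul_sum, sum_outputDist_input]
      _ ≤ outputDist V y := div_mul_self_le (hq hV y) _

/-- By symmetry the divergence of `V(·|x)` from `outputDist V` is the same for both inputs, so its
mean under any `Q` is the symmetric capacity. Replacing `outputDist V` by the true output law of `Q`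
only lowers the sum. -/
lemma mutualInfo_le_symCapacity {V : ZMod 2 → Y → ℝ} (hV : IsChannel V) (hs : IsSymmetric V)
    {Q : ZMod 2 → ℝ} (hQ : IsInputDist Q) : mutualInfo Q V ≤ symCapacity V := by
  obtain ⟨π, hπ, hVπ⟩ := hs
  have hVπ' : ∀ y, V 0 y = V 1 (π y) := fun y => by rw [hVπ, hπ]
  have hqπ : ∀ y, outputDist V (π y) = outputDist V y := fun y => by
    unfold outputDist
    rw [← hVπ, ← hVπ', add_comm]
  set D := ∑ y, V 0 y * Real.logb 2 (V 0 y / outputDist V y) with hD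
  have hD1 : ∀ x, ∑ y, V x y * Real.logb 2 (V x y / outputDist V y) = D := by
    intro x
    have hx : x = 0 ∨ x = 1 := by revert x; decide
    rcases hx with rfl | rfl
    · rfl
    · rw [hD, ← Equiv.sum_comp π]
      exact Finset.sum_congr rfl fun y _ => by rw [← hVπ', hqπ]
  have hsum : ∀ P : ZMod 2 → ℝ, ∑ x, P x = 1 →
      ∑ y, ∑ x, P x * V x y * Real.logb 2 (V x y / outputDist V y) = D := by
    intro P hP
    rw [Finset.sum_comm]
    simp only [mul_assoc, ← Finset.mul_sum, hD1]
    rw [← Finset.sum_mul, hP, one_mul]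
  have hcap : symCapacity V = D := by
    rw [symCapacity_eq, ← hsum (fun _ => 1 / 2) (by simp)]
    rfl
  rw [hcap, ← hsum Q hQ.2]
  have hqQ : ∀ y x, Q x * V x y ≠ 0 → 0 < ∑ x', Q x' * V x' y := fun y x h0 =>
    lt_of_lt_of_le ((mul_nonneg (hQ.1 x) (hV.1 x y)).lt_of_ne' h0)
      (Finset.single_le_sum (f := fun x => Q x * V x y)
        (fun x _ => mul_nonneg (hQ.1 x) (hV.1 x y)) (Finset.mem_univ x))
  have hq : ∀ y, 0 ≤ outputDist V y := fun y =>
    div_nonneg (add_nonneg (hV.1 _ _) (hV.1 _ _)) (by norm_num)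
  refine sum_mul_logb_le (p := fun y x => Q x * V x y)
    (a := fun y x => V x y / ∑ x', Q x' * V x' y) (b := fun y x => V x y / outputDist V y)
    (fun y x => mul_nonneg (hQ.1 x) (hV.1 x y)) (fun y x h0 => ?_) (fun y x h0 => ?_) ?_
  · exact div_pos ((hV.1 x y).lt_of_ne' (right_ne_zero_of_mul h0)) (hqQ y x h0)
  · exact div_pos ((hV.1 x y).lt_of_ne' (right_ne_zero_of_mul h0))
      (outputDist_pos hV.1 (right_ne_zero_of_mul h0))
  · have hQ1 : ∑ y, ∑ x, Q x * V x y = 1 := by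
      rw [Finset.sum_comm]
      simp only [← Finset.mul_sum, hV.2, mul_one, hQ.2]
    rw [hQ1, ← sum_outputDist hV]
    refine Finset.sum_le_sum fun y _ => ?_
    calc ∑ x, Q x * V x y * (V x y / (∑ x', Q x' * V x' y) / (V x y / outputDist V y))
        ≤ ∑ x, outputDist V y / (∑ x', Q x' * V x' y) * (Q x * V x y) := by
          refine Finset.sum_le_sum fun x _ => ?_
          by_cases h0 : Q x * V x y = 0
          · rw [h0]; simp
          · have h1 := outputDist_pos hV.1 (right_ne_zero_of_mul h0)
            have h2 := hqQ y x h0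
            have h3 := right_ne_zero_of_mul h0
            refine le_of_eq ?_
            generalize (∑ x', Q x' * V x' y) = q at *
            field_simp
      _ = outputDist V y / (∑ x', Q x' * V x' y) * ∑ x, Q x * V x y := by
          rw [← Finset.mul_sum]
      _ ≤ outputDist V y := div_mul_self_le (hq y) _

/-- The permutation may vary with the channel, but a finite alphabet has only finitely many. -/
lemma isClosed_setOf_isSymmetric : IsClosed {W : ZMod 2 → Y → ℝ | IsSymmetric W} := by
  classical
  have h : {W : ZMod 2 → Y → ℝ | IsSymmetric W} =
      ⋃ π : Equiv.Perm Y, {W | (∀ y, π (π y) = y) ∧ ∀ y, W 1 y = W 0 (π y)} := by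
    ext W; simp [IsSymmetric]
  rw [h]
  refine isClosed_iUnion_of_finite fun π => ?_
  have h1 : {W : ZMod 2 → Y → ℝ | (∀ y, π (π y) = y) ∧ ∀ y, W 1 y = W 0 (π y)} =
      {W | ∀ y, π (π y) = y} ∩ ⋂ y, {W | W 1 y = W 0 (π y)} := by
    ext W; simp
  rw [h1]
  exact isClosed_const.inter (isClosed_iInter fun y => isClosed_eq (by fun_prop) (by fun_prop))

/-- The mutual information is the restriction of a continuous function. -/
lemma exists_continuous_mutualInfo {Q : ZMod 2 → ℝ} (hQ : IsInputDist Q) :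
    ∃ g : (ZMod 2 → Y → ℝ) → ℝ, Continuous g ∧ ∀ W, IsChannel W → mutualInfo Q W = g W := by
  -- Splitting the logarithm of the quotient leaves only `x * log x`, which is continuous at zero.
  refine ⟨fun W => ∑ y, ((∑ x, Q x * (W x y * Real.log (W x y))) -
    (∑ x, Q x * W x y) * Real.log (∑ x, Q x * W x y)) / Real.log 2, ?_, fun W hW => ?_⟩
  · refine continuous_finsetSum _ fun y _ => Continuous.div_const (Continuous.sub ?_ ?_) _
    · exact continuous_finsetSum _ fun x _ => continuous_const.mul
        (Real.continuous_mul_log.comp (by fun_prop))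
    · exact Real.continuous_mul_log.comp (by fun_prop)
  · refine Finset.sum_congr rfl fun y _ => ?_
    rw [Finset.sum_mul, ← Finset.sum_sub_distrib, Finset.sum_div]
    refine Finset.sum_congr rfl fun x _ => ?_
    by_cases h0 : Q x * W x y = 0
    · rw [h0, ← mul_assoc, h0]; simp
    · have h1 : 0 < ∑ x', Q x' * W x' y :=
        lt_of_lt_of_le ((mul_nonneg (hQ.1 x) (hW.1 x y)).lt_of_ne' h0)
          (Finset.single_le_sum (f := fun x => Q x * W x y)
            (fun x _ => mul_nonneg (hQ.1 x) (hW.1 x y)) (Finset.mem_univ x))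
      rw [Real.logb, Real.log_div (right_ne_zero_of_mul h0) h1.ne']
      ring

lemma sInf_mutualInfo_le {𝒲 : Set (ZMod 2 → Y → ℝ)} (h𝒲 : ∀ W ∈ 𝒲, IsChannel W)
    {Q : ZMod 2 → ℝ} (hQ : IsInputDist Q) {V : ZMod 2 → Y → ℝ} (hV : V ∈ closure 𝒲) :
    sInf (mutualInfo Q '' 𝒲) ≤ mutualInfo Q V := by
  obtain ⟨g, hg, hgQ⟩ := exists_continuous_mutualInfo (Y := Y) hQ
  have hcl : closure 𝒲 ⊆ {W | IsChannel W} := closure_minimal h𝒲 isClosed_setOf_isChannel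
  have hbdd : BddBelow (mutualInfo Q '' 𝒲) := by
    refine ((isCompact_setOf_isChannel (Y := Y)).image hg).bddBelow.mono ?_
    rintro _ ⟨W, hW, rfl⟩
    exact ⟨W, h𝒲 W hW, (hgQ W (h𝒲 W hW)).symm⟩
  rw [hgQ V (hcl hV)]
  refine closure_minimal (s := 𝒲) (t := {W | sInf (mutualInfo Q '' 𝒲) ≤ g W}) (fun W hW => ?_)
    (isClosed_le continuous_const hg) hV
  rw [Set.mem_ofPred_eq, ← hgQ W (h𝒲 W hW)]
  exact csInf_le hbdd ⟨W, hW, rfl⟩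

/-- The compound capacity is the least symmetric capacity over the closure of the class. -/
lemma isGreatest_compoundCapacity {𝒲 : Set (ZMod 2 → Y → ℝ)} {V : ZMod 2 → Y → ℝ}
    (h𝒲 : ∀ W ∈ 𝒲, IsChannel W ∧ IsSymmetric W) (hV : IsClosureMinimizer 𝒲 V) :
    IsGreatest {c : ℝ | ∃ Q : ZMod 2 → ℝ, IsInputDist Q ∧ c = sInf (mutualInfo Q '' 𝒲)}
      (symCapacity V) := by
  have hVc : IsChannel V :=
    closure_minimal (fun W hW => (h𝒲 W hW).1) isClosed_setOf_isChannel hV.1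
  have hVs : IsSymmetric V :=
    closure_minimal (fun W hW => (h𝒲 W hW).2) isClosed_setOf_isSymmetric hV.1
  have hne : 𝒲.Nonempty := closure_nonempty_iff.1 ⟨V, hV.1⟩
  have hunif : IsInputDist fun _ => 1 / 2 := ⟨fun _ => by norm_num, by simp⟩
  refine ⟨⟨fun _ => 1 / 2, hunif, le_antisymm ?_ ?_⟩, ?_⟩
  · refine le_csInf (hne.image _) ?_
    rintro _ ⟨W, hW, rfl⟩
    exact hV.2 W (subset_closure hW)
  · exact sInf_mutualInfo_le (fun W hW => (h𝒲 W hW).1) hunif hV.1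
  · rintro _ ⟨Q, hQ, rfl⟩
    exact (sInf_mutualInfo_le (fun W hW => (h𝒲 W hW).1) hQ hV.1).trans
      (mutualInfo_le_symCapacity hVc hVs hQ)

end Capacity

/-! ### Domination and the information bound from either hypothesis -/

section Dominated

variable {Y : Type u} [Fintype Y]

lemma mem_dominatedClass_of_le_mismatchedInfo {W V : ZMod 2 → Y → ℝ} (hW : IsChannel W) {γ : ℝ}
    (h : (γ : EReal) ≤ mismatchedInfo W V) : W ∈ dominatedClass V γ := by
  have hac : ∀ x y, V x y = 0 → W x y = 0 := by
    intro x y h0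
    by_contra h1
    rw [mismatchedInfo_eq_bot h0 h1] at h
    exact absurd (le_bot_iff.1 h) (EReal.coe_ne_bot γ)
  rw [mismatchedInfo_eq hac, EReal.coe_le_coe_iff] at h
  exact ⟨hW, hac, h⟩

lemma mismatchedInfoReal_convexComb (V W U : ZMod 2 → Y → ℝ) (t : ℝ) :
    mismatchedInfoReal ((1 - t) • V + t • W) U =
      (1 - t) * mismatchedInfoReal V U + t * mismatchedInfoReal W U := by
  simp only [mismatchedInfoReal, Finset.mul_sum, ← Finset.sum_add_distrib]
  refine Finset.sum_congr rfl fun y _ => Finset.sum_congr rfl fun x _ => ?_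
  simp only [Pi.add_apply, Pi.smul_apply, smul_eq_mul]
  ring

/-- Minimality of the symmetric capacity, at a positive distance from the minimizer. -/
lemma symCapacity_le_mismatchedInfoReal_convexComb {V W : ZMod 2 → Y → ℝ} (hV : IsChannel V)
    (hW : IsChannel W) {t : ℝ} (ht0 : 0 < t) (ht1 : t < 1)
    (hmin : symCapacity V ≤ symCapacity ((1 - t) • V + t • W)) :
    symCapacity V ≤ mismatchedInfoReal W ((1 - t) • V + t • W) := by
  have hU : IsChannel ((1 - t) • V + t • W) := by
    constructor
    · intro x y
      have := hV.1 x y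
      have := hW.1 x y
      have : 0 ≤ 1 - t := by linarith
      simp only [Pi.add_apply, Pi.smul_apply, smul_eq_mul]
      positivity
    · intro x
      simp only [Pi.add_apply, Pi.smul_apply, smul_eq_mul, Finset.sum_add_distrib,
        ← Finset.mul_sum, hV.2, hW.2]
      ring
  have hG := mismatchedInfoReal_le_self hU hV fun x y h0 => by
    have h1 := (hV.1 x y).lt_of_ne' h0
    have := hW.1 x y
    have : 0 < 1 - t := by linarith
    simp only [Pi.add_apply, Pi.smul_apply, smul_eq_mul]
    positivity
  rw [symCapacity_eq ((1 - t) • V + t • W), mismatchedInfoReal_convexComb] at hmin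
  rw [← symCapacity_eq] at hG
  have h1 : (1 - t) * mismatchedInfoReal V ((1 - t) • V + t • W) ≤ (1 - t) * symCapacity V :=
    mul_le_mul_of_nonneg_left hG (by linarith)
  have h2 : t * symCapacity V ≤ t * mismatchedInfoReal W ((1 - t) • V + t • W) := by linarith
  exact le_of_mul_le_mul_left h2 ht0

/-- Every posterior ratio is at most two, so all summands but one contribute at most their total
weight; a single very negative summand then drags down the whole information. -/
lemma mismatchedInfoReal_le_one_add {W U : ZMod 2 → Y → ℝ} (hW : IsChannel W)
    (hU : ∀ x y, 0 ≤ U x y) (x₀ : ZMod 2) (y₀ : Y) :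
    mismatchedInfoReal W U ≤
      1 + 1 / 2 * W x₀ y₀ * Real.logb 2 (U x₀ y₀ / outputDist U y₀) := by
  classical
  have hterm : ∀ x y, 1 / 2 * W x y * Real.logb 2 (U x y / outputDist U y) ≤ 1 / 2 * W x y := by
    intro x y
    have hw : 0 ≤ 1 / 2 * W x y := mul_nonneg (by norm_num) (hW.1 x y)
    refine mul_le_of_le_one_right hw ?_
    rcases (hU x y).eq_or_lt with h0 | h0
    · rw [← h0]; simp
    · rw [logb_div_outputDist h0 (hU _ _)]
      linarith [RatioLaw.logb_one_add_nonneg (div_nonneg (hU (x + 1) y) h0.le)]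
  have h1 : ∑ p : Y × ZMod 2, 1 / 2 * W p.2 p.1 = (1 : ℝ) := by
    rw [Fintype.sum_prod_type]
    simp only [sum_outputDist_input, sum_outputDist hW]
  have h2 : mismatchedInfoReal W U =
      ∑ p : Y × ZMod 2, 1 / 2 * W p.2 p.1 * Real.logb 2 (U p.2 p.1 / outputDist U p.1) := by
    rw [Fintype.sum_prod_type]; rfl
  rw [← Finset.add_sum_erase _ _ (Finset.mem_univ (y₀, x₀))] at h1 h2
  have h3 := Finset.sum_le_sum (s := (Finset.univ : Finset (Y × ZMod 2)).erase (y₀, x₀))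
    fun p _ => hterm p.2 p.1
  have h4 : 0 ≤ 1 / 2 * W x₀ y₀ := mul_nonneg (by norm_num) (hW.1 x₀ y₀)
  dsimp only at h1 h2 h3
  rw [h2]
  linarith

/-- For `U = (1 - t) • V + t • W`, minimality gives `I(V) ≤ I(U) = (1 - t) * I(V,U) + t * I(W,U)`,
and Gibbs' inequality gives `I(V,U) ≤ I(V)`, hence `I(V) ≤ I(W,U)`. Now let `t` tend to zero from
above. -/
lemma mem_dominatedClass_of_convex {𝒲 : Set (ZMod 2 → Y → ℝ)} {V W : ZMod 2 → Y → ℝ}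
    (hconv : Convex ℝ 𝒲) (h𝒲 : ∀ W ∈ 𝒲, IsChannel W) (hV : IsClosureMinimizer 𝒲 V)
    (hW : W ∈ 𝒲) (hq : ∀ y, outputDist V y = 0 → outputDist W y = 0) :
    W ∈ dominatedClass V (symCapacity V) := by
  have hVc : IsChannel V := closure_minimal h𝒲 isClosed_setOf_isChannel hV.1
  have hWc := h𝒲 W hW
  have hIoo : ∀ᶠ t : ℝ in nhdsWithin 0 (Set.Ioi 0), 0 < t ∧ t < 1 := by
    filter_upwards [Ioo_mem_nhdsGT (show (0 : ℝ) < 1 by norm_num)] with t ht using ht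
  have hle : ∀ᶠ t : ℝ in nhdsWithin 0 (Set.Ioi 0),
      symCapacity V ≤ mismatchedInfoReal W ((1 - t) • V + t • W) := by
    filter_upwards [hIoo] with t ht
    refine symCapacity_le_mismatchedInfoReal_convexComb hVc hWc ht.1 ht.2 (hV.2 _ ?_)
    exact hconv.closure hV.1 (subset_closure hW) (by linarith) ht.1.le (by ring)
  have hlim : ∀ x y, 0 < outputDist V y → Tendsto (fun t : ℝ =>
      ((1 - t) • V + t • W) x y / outputDist ((1 - t) • V + t • W) y)
      (nhdsWithin 0 (Set.Ioi 0)) (nhds (V x y / outputDist V y)) := by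
    intro x y h0
    refine Tendsto.mono_left ?_ nhdsWithin_le_nhds
    simp only [outputDist_convexComb, Pi.add_apply, Pi.smul_apply, smul_eq_mul]
    have h1 : ContinuousAt (fun t : ℝ => ((1 - t) * V x y + t * W x y) /
        ((1 - t) * outputDist V y + t * outputDist W y)) 0 := by
      refine ContinuousAt.div (by fun_prop) (by fun_prop) ?_
      simpa using h0.ne'
    have h2 := h1.tendsto
    simpa using h2
  have hqpos : ∀ x y, W x y ≠ 0 → 0 < outputDist V y := by
    intro x y h0
    have hn : 0 ≤ outputDist V y :=
      div_nonneg (add_nonneg (hVc.1 _ _) (hVc.1 _ _)) (by norm_num)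
    exact hn.lt_of_ne' fun h1 => (outputDist_pos hWc.1 h0).ne' (hq y h1)
  have hac : ∀ x y, V x y = 0 → W x y = 0 := by
    intro x y h0
    by_contra h1
    have hw : 0 < W x y := (hWc.1 x y).lt_of_ne' h1
    have hl := hlim x y (hqpos x y h1)
    rw [h0, zero_div] at hl
    -- If `W` charged a zero of `V`, the posterior ratio of `U` would tend to zero through positive
    -- values, since `outputDist V y > 0`, and its logarithm would drive `I(W,U)` below `I(V)`.
    have hl' : Tendsto (fun t : ℝ =>
        ((1 - t) • V + t • W) x y / outputDist ((1 - t) • V + t • W) y)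
        (nhdsWithin 0 (Set.Ioi 0)) (nhdsWithin 0 (Set.Ioi 0)) := by
      refine tendsto_nhdsWithin_iff.2 ⟨hl, ?_⟩
      filter_upwards [hIoo] with t ht
      have h2 : 0 < 1 - t := by linarith [ht.2]
      have h3 := hqpos x y h1
      have h4 := outputDist_pos hWc.1 h1
      have h5 := ht.1
      rw [Set.mem_Ioi, outputDist_convexComb]
      simp only [Pi.add_apply, Pi.smul_apply, smul_eq_mul, h0]
      positivity
    have hlog := (Real.tendsto_logb_nhdsGT_zero (b := 2) (by norm_num)).comp hl'
    have hbot := hlog.const_mul_atBot (show 0 < 1 / 2 * W x y by positivity)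
    obtain ⟨t, h6, h7, h8⟩ := (hle.and (hIoo.and
      (hbot.eventually (eventually_lt_atBot (symCapacity V - 1))))).exists
    have h9 := mismatchedInfoReal_le_one_add (U := (1 - t) • V + t • W) hWc (fun x y => by
      have := hVc.1 x y
      have := hWc.1 x y
      have : 0 ≤ 1 - t := by linarith [h7.2]
      have := h7.1
      simp only [Pi.add_apply, Pi.smul_apply, smul_eq_mul]
      positivity) x y
    simp only [Function.comp] at h8
    linarith
  refine ⟨hWc, hac, ?_⟩
  have hT : Tendsto (fun t : ℝ => mismatchedInfoReal W ((1 - t) • V + t • W))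
      (nhdsWithin 0 (Set.Ioi 0)) (nhds (mismatchedInfoReal W V)) := by
    refine tendsto_finsetSum _ fun y _ => tendsto_finsetSum _ fun x _ => ?_
    by_cases h0 : W x y = 0
    · simp [h0]
    · have hV0 : V x y ≠ 0 := fun h => h0 (hac x y h)
      have h1 := hlim x y (hqpos x y h0)
      have h2 : V x y / outputDist V y ≠ 0 := div_ne_zero hV0 (hqpos x y h0).ne'
      exact ((Real.continuousAt_logb h2).tendsto.comp h1).const_mul _
  exact ge_of_tendsto hT hle

end Dominated

end PolarCompound

theorem theorem2 {Y : Type*} [Fintype Y] (𝒲 : Set (ZMod 2 → Y → ℝ)) (V : ZMod 2 → Y → ℝ)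
    (h𝒲 : ∀ W ∈ 𝒲, PolarCompound.IsChannel W ∧ PolarCompound.IsSymmetric W)
    (hV : PolarCompound.IsOneSided 𝒲 V ∨
      (Convex ℝ 𝒲 ∧ PolarCompound.IsClosureMinimizer 𝒲 V ∧
        ∀ W ∈ 𝒲, ∀ y, PolarCompound.outputDist V y = 0 → PolarCompound.outputDist W y = 0)) :
    IsGreatest {c : ℝ | ∃ Q : ZMod 2 → ℝ, PolarCompound.IsInputDist Q ∧
        c = sInf (PolarCompound.mutualInfo Q '' 𝒲)} (PolarCompound.symCapacity V) ∧
    ∀ β : ℝ, 0 < β → β < 1 / 2 →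
      (∀ R : ℝ, R < PolarCompound.symCapacity V →
        ∀ᶠ n : ℕ in atTop, ∀ W ∈ 𝒲,
          (2 : ℝ) ^ n * R ≤
            ((PolarCompound.infoSet W V n ((2 : ℝ) ^ (-((2 : ℝ) ^ n) ^ β))).card : ℝ)) ∧
      (∀ δ : ℝ, 0 < δ →
        ∀ᶠ n : ℕ in atTop, ∀ W ∈ 𝒲,
          PolarCompound.scErrorProb W V n
            (PolarCompound.infoSet W V n ((2 : ℝ) ^ (-((2 : ℝ) ^ n) ^ β))) ≤ δ) := by
  have hmin : PolarCompound.IsClosureMinimizer 𝒲 V := hV.elim (fun h => h.1) fun h => h.2.1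
  have hVc : PolarCompound.IsChannel V := closure_minimal (fun W hW => (h𝒲 W hW).1)
    PolarCompound.isClosed_setOf_isChannel hmin.1
  have hdom : ∀ W ∈ 𝒲, W ∈ PolarCompound.dominatedClass V (PolarCompound.symCapacity V) := by
    intro W hW
    rcases hV with h | ⟨hconv, -, hq⟩
    · exact PolarCompound.mem_dominatedClass_of_le_mismatchedInfo (h𝒲 W hW).1 (h.2.2 W hW)
    · exact PolarCompound.mem_dominatedClass_of_convex hconv (fun W hW => (h𝒲 W hW).1) hmin hW
        (hq W hW)
  refine ⟨PolarCompound.isGreatest_compoundCapacity h𝒲 hmin, fun β hβ0 hβ => ⟨fun R hR => ?_,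
    fun δ hδ => ?_⟩⟩
  · filter_upwards [PolarCompound.eventually_card_infoSet hVc.1 hβ0 hβ hR] with n hn W hW
      using hn W (hdom W hW)
  · filter_upwards [PolarCompound.eventually_scErrorProb_le hVc.1 hβ0 hδ] with n hn W hW
      using hn W (h𝒲 W hW).1 (hdom W hW).2.1

end
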